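/- Let $n,t\ge 1$ be integers. Let $\mathcal P_n=\{\mathbf 1,\sigma^x,\sigma^y,\sigma^z\}^{\otimes n}\setminus\{\mathbf 1^{\otimes n}\}$ be the set of nonidentity $n$-qubit Pauli operators. On the operators $\eta$ on $((\mathbb C^{2})^{\otimes n})^{\otimes t}$ consider the two mixed unitary channels $$\mathcal C_t(\eta)=\mathop{\mathbb E}_{P,\theta}\,\bigl(e^{\mathrm i\theta P/2}\bigr)^{\otimes t}\,\eta\,\bigl(e^{-\mathrm i\theta P/2}\bigr)^{\otimes t},\qquad \mathcal H_t(\eta)=\mathop{\mathbb E}_{U}\,U^{\otimes t}\,\eta\,(U^{\dagger})^{\otimes t},$$ where $P$ is uniform on $\mathcal P_n$, $\theta$ is independent of $P$ and uniform on $(-\pi,\pi)$, and $U$ is Haar random in $\mathrm{SU}(2^n)$. Let $\mathcal C_t^k$ be the $k$-fold composition of $\mathcal C_t$, let $\|\cdot\|_\diamond$ be the diamond norm (the supremum over all finite-dimensional auxiliary systems of the norm of $\mathcal D\otimes\mathrm{id}$ induced by the trace norm), and write $\mathcal A\preceq\mathcal B$ if $\mathcal B-\mathcal A$ is completely positive.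 Then for every real $\varepsilon>0$ and every integer $k\ge 0$ (with natural logarithms): 1. if $k\ge(4\log 2)\,n t^2+4t\log\frac1\varepsilon$, then $\|\mathcal C_t^k-\mathcal H_t\|_\diamond\le\varepsilon$; 2. if $k\ge(4\log 8)\,n t^2+4t\log\frac1\varepsilon$, then $(1-\varepsilon)\mathcal H_t\preceq\mathcal C_t^k\preceq(1+\varepsilon)\mathcal H_t$. Moreover, there is an absolute constant $C$ such that for all integers $n\ge1$ and $k\ge 0$, all $P_1,\dots,P_k\in\mathcal P_n$ and all $\theta_1,\dots,\theta_k\in\mathbb R$, the unitary $e^{\mathrm i\theta_kP_k/2}\cdots e^{\mathrm i\theta_1P_1/2}$ is implemented exactly, on $n$ qubits without ancillas, by a circuit of at most $C\,kn$ gates, each an arbitrary $1$-qubit unitary or a $\mathrm{CNOT}$ between an arbitrary ordered pair of distinct qubits, and of depth at most $C\,k\max(1,\log n)$. Here the depth is the number of layers, and the gates within one layer act on disjoint sets of qubits. -/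

import Mathlib

open MeasureTheory
open scoped ComplexOrder

noncomputable section

namespace RandomPauli

/-! ### Tensor products of matrices -/

/-- The tensor product `⨂ j, A j` of square matrices, acting on the product basis indexed by
functions `m → ι`. -/
def tensor {m ι : Type} [Fintype m] (A : m → Matrix ι ι ℂ) : Matrix (m → ι) (m → ι) ℂ :=
  Matrix.of fun x y => ∏ j, A j (x j) (y j)

/-- The tensor power `A^{⊗ t}`. -/
def tensorPow {ι : Type} (t : ℕ) (A : Matrix ι ι ℂ) : Matrix (Fin t → ι) (Fin t → ι) ℂ :=
  tensor fun _ : Fin t => A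

/-- The computational basis of `n` qubits: bit strings of length `n`. -/
abbrev Bits (n : ℕ) : Type := Fin n → Fin 2

/-- The product basis of `t` copies of `n` qubits. -/
abbrev Copies (n t : ℕ) : Type := Fin t → Bits n

/-! ### Pauli operators and Pauli rotations -/

/-- The one-qubit matrices `1, σˣ, σʸ, σᶻ`. -/
def pauliMatrix : Fin 4 → Matrix (Fin 2) (Fin 2) ℂ :=
  ![1, !![0, 1; 1, 0], !![0, -Complex.I; Complex.I, 0], !![1, 0; 0, -1]]

/-- Labels of the nonidentity `n`-qubit Pauli operators: strings other than `(0, …, 0)`.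
Distinct labels give distinct operators. -/
abbrev PauliLabel (n : ℕ) : Type := {p : Fin n → Fin 4 // p ≠ 0}

/-- The `n`-qubit Pauli operator with the given label. -/
def pauliOp {n : ℕ} (p : PauliLabel n) : Matrix (Bits n) (Bits n) ℂ :=
  tensor fun j => pauliMatrix (p.1 j)

/-- The Pauli rotation `exp (i θ P / 2)`. -/
def pauliRotation {n : ℕ} (p : PauliLabel n) (θ : ℝ) : Matrix (Bits n) (Bits n) ℂ :=
  NormedSpace.exp ((Complex.I * (θ : ℂ) / 2) • pauliOp p)

/-- The product `exp (i θ_k P_k / 2) ⋯ exp (i θ_1 P_1 / 2)`; the first rotation is the rightmost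
factor. -/
def rotationProduct {n k : ℕ} (P : Fin k → PauliLabel n) (θ : Fin k → ℝ) :
    Matrix (Bits n) (Bits n) ℂ :=
  (List.ofFn fun j => pauliRotation (P j) (θ j)).reverse.prod

/-! ### Haar probability measure on the special unitary group -/

section Haar

variable {ι : Type} [Fintype ι] [DecidableEq ι]

instance : MeasurableSpace (Matrix.specialUnitaryGroup ι ℂ) := borel _

instance : BorelSpace (Matrix.specialUnitaryGroup ι ℂ) := ⟨rfl⟩

instance : IsTopologicalGroup (Matrix.specialUnitaryGroup ι ℂ) where
  continuous_inv := by
    refine Continuous.subtype_mk (f := fun U : Matrix.specialUnitaryGroup ι ℂ => star U.1) ?_ _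
    exact continuous_subtype_val.star

instance : CompactSpace (Matrix.specialUnitaryGroup ι ℂ) := by
  refine isCompact_iff_compactSpace.mp ?_
  have hK : IsCompact (Set.univ.pi fun _ : ι => Set.univ.pi fun _ : ι =>
      Metric.closedBall (0 : ℂ) 1) :=
    isCompact_univ_pi fun _ => isCompact_univ_pi fun _ => isCompact_closedBall _ _
  refine IsCompact.of_isClosed_subset (s := (Set.univ.pi fun _ : ι => Set.univ.pi fun _ : ι =>
      Metric.closedBall (0 : ℂ) 1 : Set (Matrix ι ι ℂ))) hK ?_ ?_
  · have h : (Matrix.specialUnitaryGroup ι ℂ : Set (Matrix ι ι ℂ)) =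
        {A | A * star A = 1} ∩ {A | A.det = 1} := by
      ext A
      simp [Matrix.mem_specialUnitaryGroup_iff, Matrix.mem_unitaryGroup_iff]
    rw [h]
    exact (isClosed_eq (continuous_id.mul continuous_id.star) continuous_const).inter
      (isClosed_eq continuous_id.matrix_det continuous_const)
  · intro A hA i _ j _
    simpa using entry_norm_bound_of_unitary (Matrix.mem_specialUnitaryGroup_iff.mp hA).1 i j

/-- The Haar probability measure on `SU(ι)`, i.e. the Haar measure giving mass `1` to the whole
group. -/
def haarSU (ι : Type) [Fintype ι] [DecidableEq ι] :
    Measure (Matrix.specialUnitaryGroup ι ℂ) :=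
  Measure.haarMeasure ⊤

end Haar

/-! ### The two mixed unitary channels -/

/-- Linear maps on the operators of a system with basis `a`. -/
abbrev SuperOp (a : Type) : Type := Matrix a a ℂ →ₗ[ℂ] Matrix a a ℂ

theorem continuous_tensorPow {X ι : Type} [TopologicalSpace X] (t : ℕ)
    {A : X → Matrix ι ι ℂ} (hA : Continuous A) : Continuous fun x => tensorPow t (A x) := by
  refine continuous_matrix fun i j => ?_
  exact continuous_finsetProd Finset.univ fun l _ => hA.matrix_elem (i l) (j l)

theorem continuous_pauliRotation {n : ℕ} (p : PauliLabel n) :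
    Continuous (pauliRotation p) := by
  open scoped Matrix.Norms.Operator in
  exact NormedSpace.exp_continuous.comp
    (((continuous_const.mul Complex.continuous_ofReal).div_const _).smul continuous_const)

theorem continuous_copiesRotation {n t : ℕ} (p : PauliLabel n)
    (η : Matrix (Copies n t) (Copies n t) ℂ) :
    Continuous fun θ : ℝ =>
      tensorPow t (pauliRotation p θ) * η * tensorPow t (pauliRotation p (-θ)) :=
  ((continuous_tensorPow t (continuous_pauliRotation p)).matrix_mul continuous_const).matrix_mul
    (continuous_tensorPow t ((continuous_pauliRotation p).comp continuous_neg))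

theorem continuous_copiesConj {n t : ℕ} (η : Matrix (Copies n t) (Copies n t) ℂ) :
    Continuous fun U : Matrix.specialUnitaryGroup (Bits n) ℂ =>
      tensorPow t U.1 * η * (tensorPow t U.1).conjTranspose :=
  ((continuous_tensorPow t continuous_subtype_val).matrix_mul continuous_const).matrix_mul
    (continuous_tensorPow t continuous_subtype_val).matrix_conjTranspose

/-- The channel `η ↦ E_{P, θ} (exp (i θ P / 2))^{⊗ t} η (exp (- i θ P / 2))^{⊗ t}`, with `P`
uniform over the nonidentity Pauli operators and `θ` uniform on `(-π, π)`. The average over `θ` is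
taken entry by entry. -/
def pauliChannel (n t : ℕ) : SuperOp (Copies n t) where
  toFun η := Matrix.of fun x y =>
    (Fintype.card (PauliLabel n) : ℂ)⁻¹ * ∑ p : PauliLabel n,
      (2 * Real.pi : ℂ)⁻¹ * ∫ θ in (-Real.pi)..Real.pi,
        (tensorPow t (pauliRotation p θ) * η * tensorPow t (pauliRotation p (-θ))) x y
  map_add' η ξ := by
    ext x y
    have h (ζ : Matrix (Copies n t) (Copies n t) ℂ) (p : PauliLabel n) :=
      ((continuous_copiesRotation p ζ).matrix_elem x y).intervalIntegrable
        (μ := volume) (-Real.pi) Real.pi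
    simp only [Matrix.of_apply, Matrix.add_apply, mul_add, add_mul]
    simp_rw [fun p => intervalIntegral.integral_add (h η p) (h ξ p)]
    simp only [mul_add, Finset.sum_add_distrib]
  map_smul' c η := by
    ext x y
    simp only [Matrix.of_apply, Matrix.smul_apply, Matrix.mul_smul, Matrix.smul_mul, smul_eq_mul,
      intervalIntegral.integral_const_mul, RingHom.id_apply, Finset.mul_sum]
    exact Finset.sum_congr rfl fun p _ => by ring

/-- The Haar twirl `η ↦ E_U U^{⊗ t} η (U^†)^{⊗ t}` over `SU(2^n)`; the average is taken entry by
entry. -/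
def haarChannel (n t : ℕ) : SuperOp (Copies n t) where
  toFun η := Matrix.of fun x y =>
    ∫ U, (tensorPow t U.1 * η * (tensorPow t U.1).conjTranspose) x y ∂(haarSU (Bits n))
  map_add' η ξ := by
    ext x y
    have h (ζ : Matrix (Copies n t) (Copies n t) ℂ) :
        Integrable (fun U : Matrix.specialUnitaryGroup (Bits n) ℂ =>
          (tensorPow t U.1 * ζ * (tensorPow t U.1).conjTranspose) x y) (haarSU (Bits n)) :=
      haveI : IsFiniteMeasure (haarSU (Bits n)) := by unfold haarSU; infer_instance
      integrableOn_univ.mp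
        (((continuous_copiesConj ζ).matrix_elem x y).continuousOn.integrableOn_compact
          isCompact_univ)
    simp only [Matrix.of_apply, Matrix.add_apply, mul_add, add_mul]
    exact integral_add (h η) (h ξ)
  map_smul' c η := by
    ext x y
    simp only [Matrix.of_apply, Matrix.smul_apply, Matrix.mul_smul, Matrix.smul_mul, smul_eq_mul,
      integral_const_mul, RingHom.id_apply]

/-! ### Diamond norm and the completely positive order -/

/-- The Schatten 1-norm: the sum of the singular values, which are the square roots of the
eigenvalues of `X† X`. -/
def traceNorm {b : Type} [Fintype b] [DecidableEq b] (X : Matrix b b ℂ) : ℝ :=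
  ∑ i, Real.sqrt ((Matrix.isHermitian_conjTranspose_mul_self X).eigenvalues i)

/-- `D ⊗ id`, where `id` is the identity map on the operators of an auxiliary system of dimension
`m`: `D` is applied to each block of a block matrix. -/
def tensorId {a : Type} (D : SuperOp a) (m : ℕ) : SuperOp (a × Fin m) where
  toFun X := Matrix.of fun p q => D (Matrix.of fun i j => X (i, p.2) (j, q.2)) p.1 q.1
  map_add' X Y := by
    ext p q
    exact congrFun (congrFun (map_add D (Matrix.of fun i j => X (i, p.2) (j, q.2))
      (Matrix.of fun i j => Y (i, p.2) (j, q.2))) p.1) q.1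
  map_smul' c X := by
    ext p q
    exact congrFun (congrFun
      (map_smul D c (Matrix.of fun i j => X (i, p.2) (j, q.2))) p.1) q.1

/-- The diamond norm (completely bounded trace norm): the supremum over all finite-dimensional
auxiliary systems of the norm of `D ⊗ id` induced by the trace norm. It takes values in `[0, ∞]`, so
that the supremum always makes sense. -/
def diamondNorm {a : Type} [Fintype a] [DecidableEq a] (D : SuperOp a) : ENNReal :=
  ⨆ (m : ℕ) (X : Matrix (a × Fin m) (a × Fin m) ℂ) (_ : traceNorm X ≤ 1),
    ENNReal.ofReal (traceNorm (tensorId D m X))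

/-- Complete positivity: `D ⊗ id` preserves positive semidefiniteness for every auxiliary system. -/
def IsCompletelyPositive {a : Type} (D : SuperOp a) : Prop :=
  ∀ (m : ℕ) (X : Matrix (a × Fin m) (a × Fin m) ℂ), X.PosSemidef → (tensorId D m X).PosSemidef

/-- The order `D ⪯ E` on superoperators: `E - D` is completely positive. -/
def CPLE {a : Type} (D E : SuperOp a) : Prop := IsCompletelyPositive (E - D)

/-! ### Quantum circuits -/

/-- Gates on `n` qubits: an arbitrary one-qubit unitary on any qubit, or a CNOT with any control and
any other target. -/
inductive Gate (n : ℕ) : Type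
  | single (q : Fin n) (u : Matrix.unitaryGroup (Fin 2) ℂ) : Gate n
  | cnot (c q : Fin n) (h : c ≠ q) : Gate n

/-- The qubits on which a gate acts. -/
def Gate.support {n : ℕ} : Gate n → Finset (Fin n)
  | .single q _ => {q}
  | .cnot c q _ => {c, q}

/-- The unitary implemented by a gate. The CNOT maps the basis vector `|y⟩` to the basis vector in
which the target bit `y q` is replaced by `y q + y c` modulo 2. -/
def Gate.matrix {n : ℕ} : Gate n → Matrix (Bits n) (Bits n) ℂ
  | .single q u => tensor (Function.update (fun _ => 1) q u.1)
  | .cnot c q _ => Matrix.of fun x y => if x = Function.update y q (y q + y c) then 1 else 0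

/-- A circuit on `n` qubits: a list of layers, the first one being applied first, where the gates of
one layer act on pairwise disjoint sets of qubits. -/
structure Circuit (n : ℕ) : Type where
  layers : List (List (Gate n))
  disjoint : ∀ l ∈ layers, l.Pairwise fun g h => Disjoint g.support h.support

/-- The number of gates. -/
def Circuit.size {n : ℕ} (c : Circuit n) : ℕ := (c.layers.map List.length).sum

/-- The number of layers. -/
def Circuit.depth {n : ℕ} (c : Circuit n) : ℕ := c.layers.length

/-- The unitary implemented by a circuit; the order of the gates within a layer is immaterial. -/
def Circuit.matrix {n : ℕ} (c : Circuit n) : Matrix (Bits n) (Bits n) ℂ :=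
  (c.layers.map fun l => (l.map Gate.matrix).prod).reverse.prod

end RandomPauli

end

noncomputable section

namespace RandomPauli

set_option linter.unusedSectionVars false

/-! ### Tensor products and tensor powers -/

section TensorAlgebra

variable {m ι : Type} [Fintype m]

/-! Write N = 2^n, d = N^t, and P^(t) for the sum of the copies of P on the t tensor factors.
Averaging over θ turns conjugation by a Pauli rotation into the orthogonal projection, for the
Hilbert–Schmidt inner product, onto the operators commuting with P^(t). The channel is therefore a
self-adjoint average of projections, and the task is to bound its spectral gap.

The gap comes from the Casimir operator of gl(N) acting by commutators: the squares of the
commutators with all P^(t) add up to N times `casimir` (`sum_lieAction_pauliOp`), and the channel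
commutes with it. On an eigenspace of `casimir` with eigenvalue c ≠ 0, let m be the largest ℓ¹ norm
of an occurring weight. An extremal weight argument (`exists_casimir_bound`) gives N m ≤ 2c and m ≤
2t. There the commutator with P^(t) has eigenvalues of modulus at most m, so an eigenvalue M of the
channel satisfies N c ≤ m² (N² - 1)(1 - M), hence 1 - M ≥ 1/(2m) ≥ 1/(4t)
(`pauliChannel_eigenvalue`). Large weights weaken the bound on the commutators, but they force c to
be large as well.

On the kernel of `casimir` both channels are the identity (`tensorPow_comm`), and the Haar twirl
kills the remaining eigenvectors. So the difference of the channels has Hilbert–Schmidt operator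
norm at most κ = (1 - 1/(4t))^k.

Passing to the diamond norm costs a factor d = 2^(nt) (`diamondNorm_le`). For the completely
positive order one compares Choi forms: that of the difference has norm at most dκ and vanishes on
the kernel of the Choi form of the twirl (`choiMap_pauliChannel_pow_eq_zero`), whose nonzero
eigenvalues are at least d⁻² (`choiMap_haarChannel_eigenvalue`). The cost is d³ = 8^(nt). This is
the source of log 2 and log 8.

For circuits, one-qubit unitaries diagonalize P, so that the rotation becomes a phase depending on a
parity. A balanced tree of CNOTs computes the parity on one qubit and then undoes itself. -/

theorem tensor_mul [Fintype ι] [DecidableEq m] (A B : m → Matrix ι ι ℂ) :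
    tensor A * tensor B = tensor fun j => A j * B j := by
  ext x y
  simp only [tensor, Matrix.mul_apply, Matrix.of_apply, ← Finset.prod_mul_distrib]
  rw [Finset.prod_univ_sum, Fintype.piFinset_univ]

theorem tensor_diagonal [DecidableEq ι] [DecidableEq m] (d : m → ι → ℂ) :
    tensor (fun j => Matrix.diagonal (d j)) = Matrix.diagonal fun x => ∏ j, d j (x j) := by
  ext x y
  by_cases h : x = y
  · subst h; simp [tensor]
  · obtain ⟨j, hj⟩ := Function.ne_iff.mp h
    rw [Matrix.diagonal_apply_ne _ h]
    exact Finset.prod_eq_zero (Finset.mem_univ j) (Matrix.diagonal_apply_ne _ hj)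

theorem tensor_one [DecidableEq ι] [DecidableEq m] : tensor (fun _ : m => (1 : Matrix ι ι ℂ)) = 1 := by
  rw [← Matrix.diagonal_one, tensor_diagonal, ← Matrix.diagonal_one]
  simp

theorem tensor_conjTranspose (A : m → Matrix ι ι ℂ) :
    (tensor A).conjTranspose = tensor fun j => (A j).conjTranspose := by
  ext x y
  simp [tensor, Matrix.conjTranspose_apply]

variable [Fintype ι] [DecidableEq ι] {t : ℕ}

theorem tensorPow_mul (A B : Matrix ι ι ℂ) : tensorPow t (A * B) = tensorPow t A * tensorPow t B :=
  (tensor_mul _ _).symm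

theorem tensorPow_one : tensorPow t (1 : Matrix ι ι ℂ) = 1 := tensor_one

theorem tensorPow_conjTranspose (A : Matrix ι ι ℂ) :
    tensorPow t A.conjTranspose = (tensorPow t A).conjTranspose :=
  (tensor_conjTranspose _).symm

theorem tensorPow_smul (c : ℂ) (A : Matrix ι ι ℂ) : tensorPow t (c • A) = c ^ t • tensorPow t A := by
  ext x y
  simp [tensorPow, tensor, Finset.prod_mul_distrib]

theorem tensorPow_diagonal (d : ι → ℂ) :
    tensorPow t (Matrix.diagonal d) = Matrix.diagonal fun x => ∏ l, d (x l) :=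
  tensor_diagonal _

theorem tensorPow_mem_unitary {u : Matrix ι ι ℂ} (hu : u ∈ Matrix.unitaryGroup ι ℂ) :
    tensorPow t u ∈ Matrix.unitaryGroup (Fin t → ι) ℂ := by
  rw [Matrix.mem_unitaryGroup_iff, Matrix.star_eq_conjTranspose, ← tensorPow_conjTranspose,
    ← tensorPow_mul, ← Matrix.star_eq_conjTranspose, Matrix.mem_unitaryGroup_iff.mp hu, tensorPow_one]

/-- The operator `A` acting on the tensor factor `l`. -/
def site (l : m) [DecidableEq m] (A : Matrix ι ι ℂ) : Matrix (m → ι) (m → ι) ℂ :=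
  tensor (Function.update (fun _ => 1) l A)

theorem site_mul [DecidableEq m] (l : m) (A B : Matrix ι ι ℂ) :
    site l A * site l B = site l (A * B) := by
  rw [site, site, tensor_mul, site]
  congr 1
  ext1 j
  by_cases h : j = l
  · subst h; simp
  · simp [h]

theorem site_commute [DecidableEq m] {l k : m} (h : l ≠ k) (A B : Matrix ι ι ℂ) :
    site l A * site k B = site k B * site l A := by
  rw [site, site, tensor_mul, tensor_mul]
  congr 1
  ext1 j
  by_cases h1 : j = l
  · subst h1; simp [h]
  · simp [h1]

theorem site_apply [DecidableEq m] (l : m) (A : Matrix ι ι ℂ) (x y : m → ι) :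
    site l A x y = A (x l) (y l) * ∏ j ∈ Finset.univ.erase l, (1 : Matrix ι ι ℂ) (x j) (y j) := by
  rw [site, tensor, Matrix.of_apply, ← Finset.mul_prod_erase _ _ (Finset.mem_univ l)]
  simp only [Function.update_self]
  congr 1
  refine Finset.prod_congr rfl fun j hj => ?_
  rw [Function.update_of_ne (Finset.ne_of_mem_erase hj)]

theorem site_linear [DecidableEq m] (l : m) (c : ℂ) (A B : Matrix ι ι ℂ) :
    site l (c • A + B) = c • site l A + site l B := by
  ext x y
  simp only [site_apply, Matrix.add_apply, Matrix.smul_apply, smul_eq_mul]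
  ring

theorem site_conjTranspose [DecidableEq m] (l : m) (A : Matrix ι ι ℂ) :
    (site l A).conjTranspose = site l A.conjTranspose := by
  rw [site, tensor_conjTranspose, site]
  congr 1
  ext1 j
  by_cases h : j = l
  · subst h; simp
  · simp [h]

theorem site_diagonal [DecidableEq m] (l : m) (d : ι → ℂ) :
    site l (Matrix.diagonal d) = Matrix.diagonal fun x : m → ι => d (x l) := by
  have h : (Function.update (fun _ => 1) l (Matrix.diagonal d) : m → Matrix ι ι ℂ) =
      fun j => Matrix.diagonal ((Function.update (fun _ => 1) l d : m → ι → ℂ) j) := by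
    ext1 j
    by_cases h : j = l
    · subst h; simp
    · simp [h]
  rw [site, h, tensor_diagonal]
  congr 1
  ext x
  rw [← Finset.mul_prod_erase _ _ (Finset.mem_univ l)]
  rw [Finset.prod_eq_one, mul_one, Function.update_self]
  intro j hj
  rw [Function.update_of_ne (Finset.ne_of_mem_erase hj)]
  rfl

/-- The operator `∑ l, 1 ⊗ ⋯ ⊗ A ⊗ ⋯ ⊗ 1` as a linear function of `A`. -/
def totalOp (t : ℕ) : Matrix ι ι ℂ →ₗ[ℂ] Matrix (Fin t → ι) (Fin t → ι) ℂ where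
  toFun A := ∑ l, site l A
  map_add' A B := by
    rw [← Finset.sum_add_distrib]
    refine Finset.sum_congr rfl fun l _ => ?_
    simpa using site_linear l 1 A B
  map_smul' c A := by
    rw [RingHom.id_apply, Finset.smul_sum]
    refine Finset.sum_congr rfl fun l _ => ?_
    have h0 : site l (0 : Matrix ι ι ℂ) = 0 := by
      ext x y; simp [site_apply]
    simpa [h0] using site_linear l c A 0

/-- Operators on distinct factors commute, so only the terms with both operators on the same factor
survive. -/
theorem totalOp_lie (A B : Matrix ι ι ℂ) :
    totalOp t A * totalOp t B - totalOp t B * totalOp t A = totalOp t (A * B - B * A) := by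
  have key : ∀ l : Fin t, site l A * totalOp t B - totalOp t B * site l A =
      site l (A * B - B * A) := by
    intro l
    simp only [totalOp, LinearMap.coe_mk, AddHom.coe_mk, Finset.mul_sum, Finset.sum_mul,
      ← Finset.sum_sub_distrib]
    rw [Finset.sum_eq_single l]
    · rw [site_mul, site_mul]
      have := site_linear l (-1) (B * A) (A * B)
      rw [show A * B - B * A = (-1 : ℂ) • (B * A) + A * B by rw [neg_one_smul]; abel, this,
        neg_one_smul]
      abel
    · intro k _ hk
      rw [site_commute hk.symm, sub_self]
    · simp
  rw [show totalOp t (A * B - B * A) = ∑ l : Fin t, site l (A * B - B * A) from rfl,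
    ← Finset.sum_congr rfl fun l _ => key l, Finset.sum_sub_distrib, ← Finset.sum_mul,
    ← Finset.mul_sum]
  rfl

theorem totalOp_conjTranspose (A : Matrix ι ι ℂ) :
    (totalOp t A).conjTranspose = totalOp t A.conjTranspose := by
  simp only [totalOp, LinearMap.coe_mk, AddHom.coe_mk, Matrix.conjTranspose_sum, site_conjTranspose]

theorem totalOp_diagonal (d : ι → ℂ) :
    totalOp t (Matrix.diagonal d) = Matrix.diagonal fun x : Fin t → ι => ∑ l, d (x l) := by
  simp only [totalOp, LinearMap.coe_mk, AddHom.coe_mk, site_diagonal]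
  ext x y
  rw [Matrix.sum_apply]
  by_cases h : x = y
  · subst h; simp
  · simp [h]

/-- The intertwining form of the hypothesis needs no inverse, so it serves for `u` and for its
adjoint alike. -/
theorem tensorPow_mul_site (u A B : Matrix ι ι ℂ) (h : u * A = B * u) (l : Fin t) :
    tensorPow t u * site l A = site l B * tensorPow t u := by
  rw [site, site, tensorPow, tensor_mul, tensor_mul]
  congr 1
  ext1 j
  by_cases hj : j = l
  · subst hj; simp [h]
  · simp [hj]

theorem tensorPow_mul_totalOp (u A B : Matrix ι ι ℂ) (h : u * A = B * u) :
    tensorPow t u * totalOp t A = totalOp t B * tensorPow t u := by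
  simp only [totalOp, LinearMap.coe_mk, AddHom.coe_mk, Finset.mul_sum, Finset.sum_mul,
    tensorPow_mul_site u A B h]

end TensorAlgebra

/-! ### The Frobenius inner product -/

section Frobenius

variable {a b : Type} [Fintype a] [Fintype b]

attribute [local instance] Matrix.frobeniusNormedAddCommGroup Matrix.frobeniusNormedSpace

/-- The Frobenius (Hilbert–Schmidt) inner product on matrices. -/
abbrev frobeniusInnerProductSpace : InnerProductSpace ℂ (Matrix a b ℂ) where
  inner X Y := ∑ i, ∑ j, star (X i j) * Y i j
  norm_sq_eq_re_inner X := by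
    have h : ∀ z : ℂ, ‖z‖ ^ 2 = (star z * z).re := fun z => by
      rw [Complex.star_def, ← Complex.normSq_eq_conj_mul_self, Complex.ofReal_re,
        Complex.normSq_eq_norm_sq]
    rw [Matrix.frobenius_norm_def, ← Real.sqrt_eq_rpow, Real.sq_sqrt (by positivity)]
    simp only [Real.rpow_ofNat, h, map_sum, RCLike.re_eq_complex_re]
  conj_inner_symm X Y := by simp [mul_comm]
  add_left X Y Z := by simp [add_mul, Finset.sum_add_distrib]
  smul_left X Y c := by simp [mul_assoc, Finset.mul_sum]

attribute [local instance] frobeniusInnerProductSpace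

theorem inner_matrix (X Y : Matrix a b ℂ) : inner ℂ X Y = ∑ i, ∑ j, star (X i j) * Y i j := rfl

theorem norm_sq_matrix (X : Matrix a b ℂ) : ‖X‖ ^ 2 = ∑ i, ∑ j, ‖X i j‖ ^ 2 := by
  rw [Matrix.frobenius_norm_def, ← Real.sqrt_eq_rpow, Real.sq_sqrt (by positivity)]
  simp

theorem inner_matrix_eq_trace (X Y : Matrix a b ℂ) :
    inner ℂ X Y = (X.conjTranspose * Y).trace := by
  rw [inner_matrix, Finset.sum_comm]
  simp [Matrix.trace, Matrix.mul_apply]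

theorem inner_mul_left_matrix (u : Matrix a a ℂ) (X Y : Matrix a b ℂ) :
    inner ℂ (u * X) Y = inner ℂ X (u.conjTranspose * Y) := by
  rw [inner_matrix_eq_trace, inner_matrix_eq_trace, Matrix.conjTranspose_mul, Matrix.mul_assoc]

theorem inner_mul_right_matrix (u : Matrix b b ℂ) (X Y : Matrix a b ℂ) :
    inner ℂ (X * u) Y = inner ℂ X (Y * u.conjTranspose) := by
  rw [inner_matrix_eq_trace, inner_matrix_eq_trace, Matrix.conjTranspose_mul, Matrix.mul_assoc,
    Matrix.trace_mul_comm, Matrix.mul_assoc]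

/-- Commuting symmetric operators have a joint orthonormal eigenbasis. -/
theorem exists_joint_eigenbasis {E : Type*} [NormedAddCommGroup E] [InnerProductSpace ℂ E]
    [FiniteDimensional ℂ E] {A B : E →ₗ[ℂ] E} (hA : A.IsSymmetric) (hB : B.IsSymmetric)
    (hAB : Commute A B) :
    ∃ (r : ℕ) (v : OrthonormalBasis (Fin r) ℂ E) (α β : Fin r → ℂ),
      ∀ i, A (v i) = α i • v i ∧ B (v i) = β i • v i := by
  classical
  have hV := LinearMap.IsSymmetric.orthogonalFamily_eigenspace_inf_eigenspace hA hB
  have hI := LinearMap.IsSymmetric.directSum_isInternal_of_commute hA hB hAB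
  -- The joint eigenspaces are indexed by all pairs of complex numbers. All but finitely many are
  -- zero, and the subordinate basis needs a finite family.
  have hf : ∃ s : Finset (ℂ × ℂ), ∀ i ∉ s,
      (Module.End.eigenspace A i.2 ⊓ Module.End.eigenspace B i.1 : Submodule ℂ E) = ⊥ := by
    refine ⟨(Module.End.finite_hasEigenvalue B).toFinset ×ˢ
      (Module.End.finite_hasEigenvalue A).toFinset, fun i hi => ?_⟩
    simp only [Finset.mem_product, Set.Finite.mem_toFinset, not_and_or] at hi
    rcases hi with hi | hi
    · have : Module.End.eigenspace B i.1 = ⊥ := by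
        by_contra h; exact hi h
      rw [this, inf_bot_eq]
    · have : Module.End.eigenspace A i.2 = ⊥ := by
        by_contra h; exact hi h
      rw [this, bot_inf_eq]
  obtain ⟨s, hs⟩ := hf
  have hI' : iSup (fun i : s => (Module.End.eigenspace A i.1.2 ⊓ Module.End.eigenspace B i.1.1 :
      Submodule ℂ E)) = ⊤ := by
    rw [← hI.submodule_iSup_eq_top]
    refine le_antisymm (iSup_le fun i => le_iSup (fun i : ℂ × ℂ =>
      (Module.End.eigenspace A i.2 ⊓ Module.End.eigenspace B i.1 : Submodule ℂ E)) i.1)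
      (iSup_le fun i => ?_)
    by_cases h : i ∈ s
    · exact le_iSup (fun i : s => (Module.End.eigenspace A i.1.2 ⊓ Module.End.eigenspace B i.1.1 :
        Submodule ℂ E)) ⟨i, h⟩
    · rw [hs i h]; exact bot_le
  have hV' : OrthogonalFamily ℂ (fun i : s => (Module.End.eigenspace A i.1.2 ⊓
      Module.End.eigenspace B i.1.1 : Submodule ℂ E)) fun i => (Module.End.eigenspace A i.1.2 ⊓
      Module.End.eigenspace B i.1.1 : Submodule ℂ E).subtypeₗᵢ :=
    hV.comp Subtype.val_injective
  have hI2 : DirectSum.IsInternal (fun i : s => (Module.End.eigenspace A i.1.2 ⊓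
      Module.End.eigenspace B i.1.1 : Submodule ℂ E)) := by
    rw [hV'.isInternal_iff, hI', Submodule.top_orthogonal_eq_bot]
  refine ⟨_, hI2.subordinateOrthonormalBasis rfl hV',
    fun i => (hI2.subordinateOrthonormalBasisIndex rfl i hV').1.2,
    fun i => (hI2.subordinateOrthonormalBasisIndex rfl i hV').1.1, fun i => ?_⟩
  have := hI2.subordinateOrthonormalBasis_subordinate rfl i hV'
  exact ⟨Module.End.mem_eigenspace_iff.mp this.1, Module.End.mem_eigenspace_iff.mp this.2⟩

theorem norm_apply_le_of_eigenbasis {E : Type*} [NormedAddCommGroup E] [InnerProductSpace ℂ E]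
    {r : ℕ} (v : OrthonormalBasis (Fin r) ℂ E) {D : E →ₗ[ℂ] E} {δ : Fin r → ℂ}
    (hD : ∀ i, D (v i) = δ i • v i) {κ : ℝ} (hδ : ∀ i, ‖δ i‖ ≤ κ) (x : E) : ‖D x‖ ≤ κ * ‖x‖ := by
  -- For an empty basis `hδ` says nothing about the sign of `κ`, but then the space is zero.
  rcases isEmpty_or_nonempty (Fin r) with he | ⟨⟨i0⟩⟩
  · have : x = 0 := by rw [← v.sum_repr x]; simp
    simp [this]
  have hκ : 0 ≤ κ := (norm_nonneg _).trans (hδ i0)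
  have hx : D x = ∑ i, (v.repr x i * δ i) • v i := by
    conv_lhs => rw [← v.sum_repr x]
    simp [map_sum, hD, smul_smul]
  have h1 : ∀ i, inner ℂ (v i) (D x) = v.repr x i * δ i := by
    intro i
    rw [hx, v.orthonormal.inner_right_fintype]
  refine le_of_sq_le_sq ?_ (by positivity)
  rw [← v.sum_sq_norm_inner_right, mul_pow, ← v.sum_sq_norm_inner_right x, Finset.mul_sum]
  refine Finset.sum_le_sum fun i _ => ?_
  rw [h1, norm_mul, mul_pow, mul_comm, v.repr_apply_apply]
  gcongr
  exact hδ i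

end Frobenius

/-! ### The Lie algebra action and its Casimir operator -/

section Casimir

variable {ι : Type} [Fintype ι] [DecidableEq ι] {t : ℕ}

/-- The action of `A` on operators of `t` copies: the commutator with `∑ l, 1 ⊗ ⋯ ⊗ A ⊗ ⋯ ⊗ 1`. -/
def lieAction (t : ℕ) : Matrix ι ι ℂ →ₗ[ℂ] Module.End ℂ (Matrix (Fin t → ι) (Fin t → ι) ℂ) :=
  LinearMap.comp (LinearMap.mul ℂ (Matrix (Fin t → ι) (Fin t → ι) ℂ) -
    LinearMap.flip (LinearMap.mul ℂ (Matrix (Fin t → ι) (Fin t → ι) ℂ))) (totalOp t)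

theorem lieAction_apply (A : Matrix ι ι ℂ) (η : Matrix (Fin t → ι) (Fin t → ι) ℂ) :
    lieAction t A η = totalOp t A * η - η * totalOp t A := rfl

theorem lieAction_lie (A B : Matrix ι ι ℂ) :
    lieAction t A * lieAction t B - lieAction t B * lieAction t A = lieAction t (A * B - B * A) := by
  ext1 η
  simp only [LinearMap.sub_apply, Module.End.mul_apply, lieAction_apply, ← totalOp_lie]
  noncomm_ring

theorem lieAction_eq_sum (A : Matrix ι ι ℂ) :
    lieAction t A = ∑ i, ∑ j, A i j • lieAction t (Matrix.single i j 1) := by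
  conv_lhs => rw [Matrix.matrix_eq_sum_single A]
  simp only [map_sum, ← map_smul]
  simp [Matrix.smul_single]

/-- The Casimir operator of `gl(ι)` acting on operators of `t` copies. -/
def casimir (ι : Type) [Fintype ι] [DecidableEq ι] (t : ℕ) :
    Module.End ℂ (Matrix (Fin t → ι) (Fin t → ι) ℂ) :=
  ∑ i : ι, ∑ j : ι, lieAction t (Matrix.single i j 1) * lieAction t (Matrix.single j i 1)

/-- The hypothesis says that ∑ A_i ⊗ B_i is `κ` times the swap. The Casimir operator depends only on
this tensor, so matrix units may be replaced by conjugated matrix units or by Pauli operators. -/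
theorem sum_lieAction_mul_lieAction {α : Type} [Fintype α] (A B : α → Matrix ι ι ℂ) (κ : ℂ)
    (h : ∀ a b c d, ∑ i, A i a b * B i c d = if a = d ∧ b = c then κ else 0) :
    ∑ i, lieAction t (A i) * lieAction t (B i) = κ • casimir ι t := by
  have h1 : ∀ i, lieAction t (A i) * lieAction t (B i) = ∑ a, ∑ b, ∑ c, ∑ d,
      (A i a b * B i c d) • (lieAction t (Matrix.single a b 1) * lieAction t (Matrix.single c d 1)) := by
    intro i
    conv_lhs => rw [lieAction_eq_sum (A i), lieAction_eq_sum (B i)]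
    simp only [Finset.sum_mul]
    simp only [Finset.mul_sum, smul_mul_smul_comm]
  simp only [h1]
  rw [Finset.sum_comm, casimir, Finset.smul_sum]
  refine Finset.sum_congr rfl fun a _ => ?_
  rw [Finset.sum_comm, Finset.smul_sum]
  refine Finset.sum_congr rfl fun b _ => ?_
  rw [Finset.sum_comm, Finset.sum_eq_single b]
  · rw [Finset.sum_comm, Finset.sum_eq_single a]
    · rw [← Finset.sum_smul, h]; simp
    · intro d _ hd
      rw [← Finset.sum_smul, h]; simp [hd.symm]
    · simp
  · intro c _ hc
    rw [Finset.sum_comm]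
    refine Finset.sum_eq_zero fun d _ => ?_
    rw [← Finset.sum_smul, h]; simp [hc.symm]
  · simp

theorem casimir_commute_lieAction_single (k l : ι) :
    Commute (lieAction t (Matrix.single k l 1)) (casimir ι t) := by
  set T : ι → ι → Module.End ℂ (Matrix (Fin t → ι) (Fin t → ι) ℂ) :=
    fun i j => lieAction t (Matrix.single i j 1) with hT
  have hTT : ∀ i j p q, T i j * T p q = T p q * T i j +
      ((if j = p then T i q else 0) - (if q = i then T p j else 0)) := by
    intro i j p q
    have h := lieAction_lie (t := t) (Matrix.single i j (1 : ℂ)) (Matrix.single p q 1)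
    rw [sub_eq_iff_eq_add', map_sub] at h
    rw [hT]; dsimp only
    rw [h]
    congr 2
    · split_ifs with hjp
      · subst hjp; simp
      · rw [Matrix.single_mul_single_of_ne _ _ _ _ hjp, map_zero]
    · split_ifs with hjp
      · subst hjp; simp
      · rw [Matrix.single_mul_single_of_ne _ _ _ _ hjp, map_zero]
  change T k l * (∑ i, ∑ j, T i j * T j i) = (∑ i, ∑ j, T i j * T j i) * T k l
  -- The Leibniz rule for the commutator with `T k l`; summed over `i` and `j`, the four correction
  -- terms cancel in pairs.
  have h1 : ∀ i j, T k l * (T i j * T j i) = T i j * T j i * T k l +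
      (((if l = i then T k j * T j i else 0) - (if j = k then T i l * T j i else 0)) +
      ((if l = j then T i j * T k i else 0) - (if i = k then T i j * T j l else 0))) := by
    intro i j
    rw [← mul_assoc, hTT k l i j, add_mul, mul_assoc, hTT k l j i, mul_add, ← mul_assoc]
    simp only [mul_sub, sub_mul, ite_mul, mul_ite, zero_mul, mul_zero]
    abel
  simp only [Finset.mul_sum, Finset.sum_mul, h1, Finset.sum_add_distrib, Finset.sum_sub_distrib]
  rw [add_eq_left]
  have e1 : ∑ i, ∑ j, (if l = i then T k j * T j i else 0) = ∑ j, T k j * T j l := by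
    rw [Finset.sum_comm]; simp
  have e2 : ∑ i, ∑ j, (if j = k then T i l * T j i else 0) = ∑ i, T i l * T k i := by simp
  have e3 : ∑ i, ∑ j, (if l = j then T i j * T k i else 0) = ∑ i, T i l * T k i := by simp
  have e4 : ∑ i, ∑ j, (if i = k then T i j * T j l else 0) = ∑ j, T k j * T j l := by
    rw [Finset.sum_comm]; simp
  rw [e1, e2, e3, e4]
  abel

/-- Conjugation by `u^{⊗ t}`. -/
def conjAction (t : ℕ) (u : Matrix ι ι ℂ) : Module.End ℂ (Matrix (Fin t → ι) (Fin t → ι) ℂ) :=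
  LinearMap.mulLeft ℂ (tensorPow t u) * LinearMap.mulRight ℂ (tensorPow t u).conjTranspose

theorem conjAction_apply (u : Matrix ι ι ℂ) (η : Matrix (Fin t → ι) (Fin t → ι) ℂ) :
    conjAction t u η = tensorPow t u * η * (tensorPow t u).conjTranspose := by
  simp [conjAction, mul_assoc]

theorem tensorPow_mul_conjTranspose_self {u : Matrix ι ι ℂ} (hu : u ∈ Matrix.unitaryGroup ι ℂ) :
    tensorPow t u * (tensorPow t u).conjTranspose = 1 :=
  Matrix.mem_unitaryGroup_iff.mp (tensorPow_mem_unitary hu)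

theorem conjAction_mul (u v : Matrix ι ι ℂ) :
    conjAction t (u * v) = conjAction t u * conjAction t v := by
  ext1 η
  simp [conjAction_apply, tensorPow_mul, Matrix.conjTranspose_mul, mul_assoc]

theorem conjAction_one : conjAction t (1 : Matrix ι ι ℂ) = 1 := by
  ext1 η
  simp [conjAction_apply, tensorPow_one]

theorem conjAction_mul_lieAction {u : Matrix ι ι ℂ} (hu : u ∈ Matrix.unitaryGroup ι ℂ)
    (A : Matrix ι ι ℂ) :
    conjAction t u * lieAction t A = lieAction t (u * A * u.conjTranspose) * conjAction t u := by
  have hu' : u.conjTranspose * u = 1 := Matrix.mem_unitaryGroup_iff'.mp hu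
  have h1 : tensorPow t u * totalOp t A = totalOp t (u * A * u.conjTranspose) * tensorPow t u :=
    tensorPow_mul_totalOp _ _ _ (by rw [mul_assoc _ u.conjTranspose, hu', mul_one])
  have h2 : totalOp t A * (tensorPow t u).conjTranspose =
      (tensorPow t u).conjTranspose * totalOp t (u * A * u.conjTranspose) := by
    rw [← tensorPow_conjTranspose]
    symm
    refine tensorPow_mul_totalOp _ _ _ ?_
    rw [← mul_assoc, ← mul_assoc, hu', one_mul]
  ext1 η
  simp only [Module.End.mul_apply, conjAction_apply, lieAction_apply, mul_sub, sub_mul]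
  rw [← mul_assoc, h1, mul_assoc (tensorPow t u), mul_assoc η, h2]
  simp only [mul_assoc]

/-- Conjugation by `u` replaces the matrix units by their conjugates, and these still sum to the
swap because `u` is unitary. -/
theorem conjAction_commute_casimir {u : Matrix ι ι ℂ} (hu : u ∈ Matrix.unitaryGroup ι ℂ) :
    Commute (conjAction t u) (casimir ι t) := by
  have hu' : u * u.conjTranspose = 1 := Matrix.mem_unitaryGroup_iff.mp hu
  have hu'' : u.conjTranspose * u = 1 := Matrix.mem_unitaryGroup_iff'.mp hu
  have key : ∑ p : ι × ι, lieAction t (u * Matrix.single p.1 p.2 1 * u.conjTranspose) *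
      lieAction t (u * Matrix.single p.2 p.1 1 * u.conjTranspose) = (1 : ℂ) • casimir ι t := by
    refine sum_lieAction_mul_lieAction _ _ 1 fun a b c d => ?_
    have e : ∀ i j a b, (u * Matrix.single i j (1 : ℂ) * u.conjTranspose : Matrix ι ι ℂ) a b =
        u a i * u.conjTranspose j b := by
      intro i j a b
      rw [Matrix.mul_apply, Finset.sum_eq_single j]
      · simp
      · intro k _ hk
        rw [Matrix.mul_single_apply_of_ne _ _ _ _ _ hk, zero_mul]
      · simp
    simp only [e, Fintype.sum_prod_type]
    have : ∀ i j, u a i * u.conjTranspose j b * (u c j * u.conjTranspose i d) =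
        (u a i * u.conjTranspose i d) * (u c j * u.conjTranspose j b) := fun i j => by ring
    simp only [this, ← Finset.mul_sum, ← Finset.sum_mul]
    rw [← Matrix.mul_apply, ← Matrix.mul_apply, hu', Matrix.one_apply, Matrix.one_apply]
    by_cases h1 : a = d <;> by_cases h2 : b = c <;> simp [h1, h2, eq_comm]
  rw [one_smul, Fintype.sum_prod_type] at key
  show conjAction t u * casimir ι t = casimir ι t * conjAction t u
  conv_rhs => rw [← key]
  simp only [casimir, Finset.mul_sum, Finset.sum_mul]
  refine Finset.sum_congr rfl fun i _ => Finset.sum_congr rfl fun j _ => ?_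
  rw [← mul_assoc (conjAction t u), conjAction_mul_lieAction hu, mul_assoc (lieAction t _),
    conjAction_mul_lieAction hu, ← mul_assoc (lieAction t _)]

/-! ### Adjoints for the Hilbert–Schmidt inner product. -/

section Symmetric

attribute [local instance] Matrix.frobeniusNormedAddCommGroup Matrix.frobeniusNormedSpace
  frobeniusInnerProductSpace

theorem inner_lieAction_left (A : Matrix ι ι ℂ) (η ζ : Matrix (Fin t → ι) (Fin t → ι) ℂ) :
    inner ℂ (lieAction t A η) ζ = inner ℂ η (lieAction t A.conjTranspose ζ) := by
  rw [lieAction_apply, lieAction_apply, inner_sub_left, inner_sub_right, inner_mul_left_matrix,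
    inner_mul_right_matrix, totalOp_conjTranspose]

theorem inner_conjAction_left (u : Matrix ι ι ℂ) (η ζ : Matrix (Fin t → ι) (Fin t → ι) ℂ) :
    inner ℂ (conjAction t u η) ζ = inner ℂ η (conjAction t u.conjTranspose ζ) := by
  rw [conjAction_apply, conjAction_apply, inner_mul_right_matrix, inner_mul_left_matrix,
    Matrix.conjTranspose_conjTranspose, tensorPow_conjTranspose, Matrix.conjTranspose_conjTranspose,
    mul_assoc]

theorem norm_conjAction {u : Matrix ι ι ℂ} (hu : u ∈ Matrix.unitaryGroup ι ℂ)
    (η : Matrix (Fin t → ι) (Fin t → ι) ℂ) : ‖conjAction t u η‖ = ‖η‖ := by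
  have hu'' : u.conjTranspose * u = 1 := Matrix.mem_unitaryGroup_iff'.mp hu
  have h : inner ℂ (conjAction t u η) (conjAction t u η) = inner ℂ η η := by
    rw [inner_conjAction_left, ← Module.End.mul_apply, ← conjAction_mul, hu'', conjAction_one]
    rfl
  rw [@norm_eq_sqrt_re_inner ℂ, @norm_eq_sqrt_re_inner ℂ _ _ _ _ η, h]

theorem casimir_isSymmetric : (casimir ι t).IsSymmetric := by
  intro η ζ
  simp only [casimir, LinearMap.sum_apply, sum_inner, inner_sum, Module.End.mul_apply]
  refine Finset.sum_congr rfl fun i _ => Finset.sum_congr rfl fun j _ => ?_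
  rw [inner_lieAction_left, inner_lieAction_left]
  simp

/-- The actions of the matrix units (i,j) and (j,i) are adjoint to each other, so the Casimir form
at `η` is a sum of squared norms, one for each matrix unit. -/
theorem lieAction_eq_zero_of_casimir_eq_zero {η : Matrix (Fin t → ι) (Fin t → ι) ℂ}
    (h : casimir ι t η = 0) (A : Matrix ι ι ℂ) : lieAction t A η = 0 := by
  have h1 : (∑ i : ι, ∑ j : ι, ‖lieAction t (Matrix.single j i 1) η‖ ^ 2) = 0 := by
    have h2 : inner ℂ η (casimir ι t η) =
        ((∑ i : ι, ∑ j : ι, ‖lieAction t (Matrix.single j i 1) η‖ ^ 2 : ℝ) : ℂ) := by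
      simp only [casimir, LinearMap.sum_apply, inner_sum, Module.End.mul_apply, Complex.ofReal_sum]
      refine Finset.sum_congr rfl fun i _ => Finset.sum_congr rfl fun j _ => ?_
      have := inner_lieAction_left (Matrix.single j i 1) η (lieAction t (Matrix.single j i 1) η)
      rw [Matrix.conjTranspose_single, star_one] at this
      rw [← this, inner_self_eq_norm_sq_to_K]
      simp
    rw [h, inner_zero_right] at h2
    exact_mod_cast h2.symm
  have h3 : ∀ i j, lieAction t (Matrix.single j i 1) η = 0 := by
    intro i j
    rw [Finset.sum_eq_zero_iff_of_nonneg fun i _ => by positivity] at h1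
    have := h1 i (Finset.mem_univ _)
    rw [Finset.sum_eq_zero_iff_of_nonneg fun i _ => by positivity] at this
    simpa using this j (Finset.mem_univ _)
  rw [lieAction_eq_sum]
  simp [LinearMap.sum_apply, h3]

end Symmetric

end Casimir

/-! ### Weights and the lower bound on the Casimir operator -/

section Weights

variable {ι : Type} [Fintype ι] [DecidableEq ι] {t : ℕ}

/-- The weight of the matrix unit at `(x, y)`: how often each basis vector occurs in `x`, minus how
often it occurs in `y`. -/
def weight (x y : Fin t → ι) (i : ι) : ℤ :=
  ∑ l, ((if x l = i then 1 else 0) - (if y l = i then 1 else 0))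

theorem sum_mul_weight (d : ι → ℤ) (x y : Fin t → ι) :
    ∑ i, d i * weight x y i = ∑ l, d (x l) - ∑ l, d (y l) := by
  simp only [weight, Finset.mul_sum]
  rw [Finset.sum_comm, ← Finset.sum_sub_distrib]
  simp [mul_sub]

theorem sum_mul_weight_complex (d : ι → ℂ) (x y : Fin t → ι) :
    ∑ i, d i * weight x y i = ∑ l, d (x l) - ∑ l, d (y l) := by
  simp only [weight, Int.cast_sum, Finset.mul_sum]
  rw [Finset.sum_comm, ← Finset.sum_sub_distrib]
  simp [mul_sub]

theorem sum_weight (x y : Fin t → ι) : ∑ i, weight x y i = 0 := by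
  simpa using sum_mul_weight (fun _ => 1) x y

theorem sum_abs_weight_le (x y : Fin t → ι) : ∑ i, |weight x y i| ≤ 2 * t := by
  calc ∑ i, |weight x y i|
      ≤ ∑ i, ∑ l, ((if x l = i then (1 : ℤ) else 0) + (if y l = i then 1 else 0)) := by
        refine Finset.sum_le_sum fun i _ => (Finset.abs_sum_le_sum_abs _ _).trans
          (Finset.sum_le_sum fun l _ => ?_)
        split_ifs <;> simp
    _ = 2 * t := by
        rw [Finset.sum_comm]
        simp [Finset.sum_add_distrib]
        ring

theorem lieAction_diagonal_apply (d : ι → ℂ) (η : Matrix (Fin t → ι) (Fin t → ι) ℂ)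
    (x y : Fin t → ι) :
    lieAction t (Matrix.diagonal d) η x y = (∑ i, d i * weight x y i) * η x y := by
  rw [lieAction_apply, totalOp_diagonal, Matrix.sub_apply, Matrix.diagonal_mul, Matrix.mul_diagonal,
    sum_mul_weight_complex]
  ring

theorem lieAction_single_apply (i : ι) (η : Matrix (Fin t → ι) (Fin t → ι) ℂ) (x y : Fin t → ι) :
    lieAction t (Matrix.single i i 1) η x y = weight x y i * η x y := by
  rw [← Matrix.diagonal_single, lieAction_diagonal_apply]
  congr 1
  rw [Finset.sum_eq_single i] <;> simp +contextual

/-- A linear map commuting with the multiplications by `τ i` commutes with the multiplication by any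
function of the `τ i`. -/
theorem map_mul_entries {a κ : Type} [Fintype a] [DecidableEq a] (F : SuperOp a)
    (τ : κ → a → a → ℂ)
    (hF : ∀ i η, F (Matrix.of fun x y => τ i x y * η x y) = Matrix.of fun x y => τ i x y * F η x y)
    (g : a → a → ℂ) (hg : ∀ x y x' y', (∀ i, τ i x y = τ i x' y') → g x y = g x' y')
    (η : Matrix a a ℂ) :
    F (Matrix.of fun x y => g x y * η x y) = Matrix.of fun x y => g x y * F η x y := by
  have hs : ∀ (f : a → a → ℂ) (p q : a),
      (Matrix.of fun x y => f x y * Matrix.single p q (1 : ℂ) x y) = f p q • Matrix.single p q 1 := by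
    intro f p q
    ext x y
    by_cases h : p = x ∧ q = y
    · obtain ⟨rfl, rfl⟩ := h; simp
    · simp [Matrix.single_apply_of_ne _ _ _ _ _ h]
  -- The image of the matrix unit at (p,q) is supported on entries where every `τ i` takes the same
  -- value as at (p,q), hence `g` does too.
  have key : ∀ p q x y, g p q * F (Matrix.single p q 1) x y = g x y * F (Matrix.single p q 1) x y := by
    intro p q x y
    by_cases h0 : F (Matrix.single p q 1) x y = 0
    · simp [h0]
    · congr 1
      refine hg _ _ _ _ fun i => ?_
      have := congrFun (congrFun (hF i (Matrix.single p q 1)) x) y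
      rw [hs, map_smul] at this
      simpa [h0] using this
  have h1 : ∀ (ζ : Matrix a a ℂ) x y, F ζ x y = ∑ p, ∑ q, ζ p q * F (Matrix.single p q 1) x y := by
    intro ζ x y
    conv_lhs => rw [Matrix.matrix_eq_sum_single ζ]
    simp only [map_sum, Matrix.sum_apply]
    refine Finset.sum_congr rfl fun p _ => Finset.sum_congr rfl fun q _ => ?_
    rw [← mul_one (ζ p q), ← smul_eq_mul, ← Matrix.smul_single, map_smul]
    simp
  ext x y
  rw [Matrix.of_apply, h1, h1, Finset.mul_sum]
  refine Finset.sum_congr rfl fun p _ => ?_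
  rw [Finset.mul_sum]
  refine Finset.sum_congr rfl fun q _ => ?_
  rw [Matrix.of_apply, mul_assoc, mul_left_comm, key]
  ring

/-- The Casimir operator commutes with multiplications by functions of the weight. -/
theorem casimir_mul_entries (g : (Fin t → ι) → (Fin t → ι) → ℂ)
    (hg : ∀ x y x' y', weight x y = weight x' y' → g x y = g x' y')
    (η : Matrix (Fin t → ι) (Fin t → ι) ℂ) :
    casimir ι t (Matrix.of fun x y => g x y * η x y) =
      Matrix.of fun x y => g x y * casimir ι t η x y := by
  refine map_mul_entries (casimir ι t) (fun i x y => (weight x y i : ℂ)) (fun i η => ?_) g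
    (fun x y x' y' h => hg _ _ _ _ (funext fun i => by exact_mod_cast h i)) η
  have h : ∀ ζ, lieAction t (Matrix.single i i 1) ζ =
      Matrix.of fun x y => (weight x y i : ℂ) * ζ x y := by
    intro ζ; ext x y; exact lieAction_single_apply i ζ x y
  rw [← h, ← h]
  exact (congrArg (fun f => f η) (casimir_commute_lieAction_single (t := t) i i)).symm

/-- If `μ i ≥ 0`, the gain of 1 at `i` pays for a loss of at most 1 at `j`. If `μ i < 0`, then `μ j
< 0` too, and the loss at `i` is regained at `j`. The number `s` in the proof is the amount
transferred. -/
theorem sum_abs_le_sum_abs_shift (μ : ι → ℤ) {i j : ι} (hij : i ≠ j) (h : μ j ≤ μ i) :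
    ∑ k, |μ k| ≤ ∑ k, |μ k + ((if k = i then 1 else 0) - (if k = j then 1 else 0))| := by
  obtain ⟨s, hs1, hs2⟩ : ∃ s : ℤ, |μ i| + s ≤ |μ i + 1| ∧ |μ j| - s ≤ |μ j - 1| := by
    rcases le_or_gt 0 (μ i) with h0 | h0
    · refine ⟨1, ?_, ?_⟩ <;> grind
    · refine ⟨-1, ?_, ?_⟩ <;> grind
  have : ∑ k, |μ k| = ∑ k, (|μ k| + ((if k = i then s else 0) - (if k = j then s else 0))) := by
    simp [Finset.sum_add_distrib]
  rw [this]
  refine Finset.sum_le_sum fun k _ => ?_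
  by_cases h1 : k = i
  · subst h1; simpa [hij] using hs1
  · by_cases h2 : k = j
    · subst h2
      simp only [h1, if_false, if_true]
      simpa [sub_eq_add_neg] using hs2
    · simp [h1, h2]

/-- The sum of squares grows by 2(μ i - μ j) + 2. It breaks ties when the shift leaves the ℓ¹ norm
unchanged. -/
theorem sum_sq_lt_sum_sq_shift (μ : ι → ℤ) {i j : ι} (hij : i ≠ j) (h : μ j ≤ μ i) :
    ∑ k, μ k ^ 2 < ∑ k, (μ k + ((if k = i then 1 else 0) - (if k = j then 1 else 0))) ^ 2 := by
  have : ∀ k, (μ k + ((if k = i then 1 else 0) - (if k = j then 1 else 0))) ^ 2 =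
      μ k ^ 2 + ((if k = i then 2 * μ k + 1 else 0) - (if k = j then 2 * μ k - 1 else 0)) := by
    intro k
    by_cases h1 : k = i
    · subst h1; simp [hij]; ring
    · by_cases h2 : k = j
      · subst h2; simp [h1]; ring
      · simp [h1, h2]
  simp only [this, Finset.sum_add_distrib, Finset.sum_sub_distrib, Finset.sum_ite_eq',
    Finset.mem_univ, if_true]
  omega

/-- As the weight sums to zero, N μ_i is the sum over j of μ_i - μ_j; then the triangle inequality
applies. -/
theorem card_mul_sum_abs_le (μ : ι → ℤ) (hμ : ∑ i, μ i = 0) :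
    Fintype.card ι * ∑ i, |μ i| ≤ ∑ i, ∑ j, |μ i - μ j| := by
  rw [Finset.mul_sum]
  refine Finset.sum_le_sum fun i _ => ?_
  have : (Fintype.card ι : ℤ) * μ i = ∑ j, (μ i - μ j) := by
    rw [Finset.sum_sub_distrib, hμ]; simp
  calc (Fintype.card ι : ℤ) * |μ i| = |(Fintype.card ι : ℤ) * μ i| := by
        rw [abs_mul, Nat.abs_cast]
    _ ≤ _ := by rw [this]; exact Finset.abs_sum_le_sum_abs _ _

/-- On a nonzero eigenspace of the Casimir operator there is a bound `m` on the sizes of all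
occurring weights in terms of which the eigenvalue is large. -/
theorem exists_casimir_bound {c : ℂ} {η : Matrix (Fin t → ι) (Fin t → ι) ℂ} (hη : η ≠ 0)
    (hc : casimir ι t η = c • η) (hc0 : c ≠ 0) :
    ∃ m : ℤ, 0 < m ∧ m ≤ 2 * t ∧ (∃ r : ℝ, c = r ∧ (Fintype.card ι : ℝ) * m ≤ 2 * r) ∧
      ∀ ζ : Matrix (Fin t → ι) (Fin t → ι) ℂ, casimir ι t ζ = c • ζ → ∀ x y, ζ x y ≠ 0 →
        ∑ i, |weight x y i| ≤ m := by
  classical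
  -- The index pairs whose weight is carried by a joint eigenvector of the Casimir operator, at `c`,
  -- and of all diagonal matrix units.
  set P : (Fin t → ι) × (Fin t → ι) → Prop := fun p => ∃ w : Matrix (Fin t → ι) (Fin t → ι) ℂ,
    w ≠ 0 ∧ casimir ι t w = c • w ∧
      ∀ i, lieAction t (Matrix.single i i 1) w = (weight p.1 p.2 i : ℂ) • w with hP
  have hproj : ∀ ζ : Matrix (Fin t → ι) (Fin t → ι) ℂ, casimir ι t ζ = c • ζ → ∀ x y, ζ x y ≠ 0 →
      P (x, y) := by
    intro ζ hζ x y hxy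
    -- Cutting `ζ` down to one weight space commutes with the Casimir operator.
    refine ⟨Matrix.of fun x' y' => (if weight x' y' = weight x y then 1 else 0) * ζ x' y',
      fun h => hxy ?_, ?_, fun i => ?_⟩
    · simpa using congrFun (congrFun h x) y
    · rw [casimir_mul_entries _ (fun _ _ _ _ h => by rw [h]), hζ]
      ext x' y'
      simp
    · ext x' y'
      rw [lieAction_single_apply]
      by_cases h : weight x' y' = weight x y <;> simp [h]
  have hne : (Finset.univ.filter P).Nonempty := by
    by_contra h
    refine hη ?_
    ext x y
    by_contra hxy
    exact h ⟨(x, y), by simpa using hproj η hc x y hxy⟩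
  -- The first component is the quantity to be bounded; the second makes every shift towards a
  -- larger coordinate a strict increase.
  obtain ⟨p, hp, hmax⟩ := Finset.exists_max_image (Finset.univ.filter P)
    (fun p => toLex (∑ i, |weight p.1 p.2 i|, ∑ i, weight p.1 p.2 i ^ 2)) hne
  obtain ⟨w, hw0, hwc, hwμ⟩ := (Finset.mem_filter.mp hp).2
  set μ := weight p.1 p.2 with hμ
  have hbound : ∀ ζ : Matrix (Fin t → ι) (Fin t → ι) ℂ, casimir ι t ζ = c • ζ → ∀ x y, ζ x y ≠ 0 →
      toLex (∑ i, |weight x y i|, ∑ i, weight x y i ^ 2) ≤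
        toLex (∑ i, |μ i|, ∑ i, μ i ^ 2) := fun ζ hζ x y hxy =>
    hmax (x, y) (by simpa using hproj ζ hζ x y hxy)
  have hcomm : ∀ i j, lieAction t (Matrix.single i j 1) * casimir ι t =
      casimir ι t * lieAction t (Matrix.single i j 1) := casimir_commute_lieAction_single
  -- The image would have weight μ + e_i - e_j, which exceeds the lexicographic maximum. The order
  -- on the index set is dictated by `μ` itself, so no choice of positive roots is needed.
  have hraise : ∀ i j, i ≠ j → μ j ≤ μ i → lieAction t (Matrix.single i j 1) w = 0 := by
    intro i j hij hle
    by_contra hne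
    set v := lieAction t (Matrix.single i j 1) w with hv
    have hvc : casimir ι t v = c • v := by
      rw [hv, ← Module.End.mul_apply, ← hcomm, Module.End.mul_apply, hwc, map_smul]
    obtain ⟨x, y, hxy⟩ : ∃ x y, v x y ≠ 0 := by
      by_contra h
      push Not at h
      exact hne (by ext x y; exact h x y)
    have hvμ : ∀ k, weight x y k = μ k + ((if k = i then 1 else 0) - (if k = j then 1 else 0)) := by
      intro k
      have h1 := congrArg (fun f => f w) (lieAction_lie (t := t) (Matrix.single k k (1 : ℂ))
        (Matrix.single i j 1))
      simp only [LinearMap.sub_apply, Module.End.mul_apply, hwμ, map_smul, ← hv] at h1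
      have h2 : Matrix.single k k (1 : ℂ) * Matrix.single i j 1 -
          Matrix.single i j 1 * Matrix.single k k 1 =
          ((if k = i then 1 else 0) - (if k = j then 1 else 0) : ℂ) • Matrix.single i j (1 : ℂ) := by
        have h3 : Matrix.single k k (1 : ℂ) * Matrix.single i j 1 =
            (if k = i then 1 else 0 : ℂ) • Matrix.single i j (1 : ℂ) := by
          split_ifs with h
          · subst h; simp
          · rw [Matrix.single_mul_single_of_ne _ _ _ _ h, zero_smul]
        have h4 : Matrix.single i j (1 : ℂ) * Matrix.single k k 1 =
            (if k = j then 1 else 0 : ℂ) • Matrix.single i j (1 : ℂ) := by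
          split_ifs with h
          · subst h; simp
          · rw [Matrix.single_mul_single_of_ne _ _ _ _ (Ne.symm h), zero_smul]
        rw [h3, h4, sub_smul]
      rw [h2, map_smul, LinearMap.smul_apply, ← hv] at h1
      have h5 := congrFun (congrFun h1 x) y
      simp only [Matrix.sub_apply, Matrix.smul_apply, lieAction_single_apply, smul_eq_mul,
        ← sub_mul] at h5
      have h6 := mul_right_cancel₀ hxy h5
      rw [sub_eq_iff_eq_add'] at h6
      have : ((weight x y k : ℤ) : ℂ) =
          ((μ k + ((if k = i then 1 else 0) - (if k = j then 1 else 0)) : ℤ) : ℂ) := by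
        rw [h6]; push_cast; rfl
      exact_mod_cast this
    have h1 := hbound v hvc x y hxy
    rw [Prod.Lex.toLex_le_toLex] at h1
    simp only [hvμ] at h1
    have h2 := sum_abs_le_sum_abs_shift μ hij hle
    have h3 := sum_sq_lt_sum_sq_shift μ hij hle
    rcases h1 with h1 | h1
    · exact absurd h1 (not_lt.mpr h2)
    · exact absurd h1.2 (not_le.mpr h3)
  -- One of the two off-diagonal factors kills `w`. If it is the inner one, the product vanishes;
  -- otherwise the product equals the commutator, which acts by μ_i - μ_j.
  have hterm : ∀ i j, (lieAction t (Matrix.single i j 1) * lieAction t (Matrix.single j i 1)) w =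
      (((if i = j then μ i ^ 2 else 0) + max (μ i - μ j) 0 : ℤ) : ℂ) • w := by
    intro i j
    by_cases hij : i = j
    · subst hij
      rw [Module.End.mul_apply, hwμ, map_smul, hwμ, smul_smul]
      simp [sq]
    rcases le_total (μ i) (μ j) with h | h
    · rw [Module.End.mul_apply, hraise j i (Ne.symm hij) h, map_zero, max_eq_right (by omega)]
      simp [hij]
    · have h1 := congrArg (fun f => f w) (lieAction_lie (t := t) (Matrix.single i j (1 : ℂ))
        (Matrix.single j i 1))
      simp only [LinearMap.sub_apply, Module.End.mul_apply, hraise i j hij h, map_zero, sub_zero,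
        Matrix.single_mul_single_same, map_sub, hwμ, mul_one] at h1
      rw [Module.End.mul_apply, h1, max_eq_left (by omega), ← sub_smul]
      simp [hij]
  have hcas : casimir ι t w =
      ((∑ i, ∑ j, ((if i = j then μ i ^ 2 else 0) + max (μ i - μ j) 0) : ℤ) : ℂ) • w := by
    simp only [casimir, LinearMap.sum_apply, hterm, Int.cast_sum, Finset.sum_smul]
  have hceq : c = ((∑ i, ∑ j, ((if i = j then μ i ^ 2 else 0) + max (μ i - μ j) 0) : ℤ) : ℂ) := by
    rw [hwc] at hcas
    exact smul_left_injective ℂ hw0 hcas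
  refine ⟨∑ i, |μ i|, ?_, sum_abs_weight_le _ _, ⟨_, by rw [hceq]; exact (Complex.ofReal_intCast _).symm, ?_⟩, ?_⟩
  -- If the maximal weight were zero, the eigenvalue formula would give c = 0.
  · refine lt_of_le_of_ne (Finset.sum_nonneg fun i _ => abs_nonneg _) fun h => hc0 ?_
    have : ∀ i, μ i = 0 := by
      intro i
      have := (Finset.sum_eq_zero_iff_of_nonneg fun i _ => abs_nonneg (μ i)).mp h.symm i
        (Finset.mem_univ _)
      simpa using this
    rw [hceq]
    simp [this]
  · have h1 := card_mul_sum_abs_le μ (sum_weight _ _)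
    -- By symmetry the positive parts of μ_i - μ_j make up half of the sum of absolute values; the
    -- squares μ_i² are dropped.
    have h2 : ∑ i, ∑ j, |μ i - μ j| ≤
        2 * ∑ i, ∑ j, ((if i = j then μ i ^ 2 else 0) + max (μ i - μ j) 0) := by
      have h3 : ∑ i, ∑ j, |μ i - μ j| = 2 * ∑ i, ∑ j, max (μ i - μ j) 0 := by
        have h4 : ∀ z : ℤ, |z| = max z 0 + max (-z) 0 := fun z => by grind
        simp only [h4, Finset.sum_add_distrib, neg_sub]
        rw [Finset.sum_comm (f := fun i j => max (μ j - μ i) 0), two_mul]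
      rw [h3]
      gcongr with i _ j _
      have : 0 ≤ if i = j then μ i ^ 2 else 0 := by positivity
      omega
    exact_mod_cast h1.trans h2
  · intro ζ hζ x y hxy
    have := hbound ζ hζ x y hxy
    rw [Prod.Lex.toLex_le_toLex] at this
    rcases this with h | h
    · exact h.le
    · exact h.1.le

end Weights

/-! ### Diagonalization of Pauli operators -/

section PauliDiagonal

/-- The eigenvalues of the one-qubit Pauli matrices. -/
def bitSign (a : Fin 4) (b : Fin 2) : ℤ := if a = 0 ∨ b = 0 then 1 else -1

theorem bitSign_eq_or (a : Fin 4) (b : Fin 2) : bitSign a b = 1 ∨ bitSign a b = -1 := by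
  unfold bitSign; split_ifs <;> simp

/-- Unitaries diagonalizing the one-qubit Pauli matrices. -/
def bitFrame : Fin 4 → Matrix (Fin 2) (Fin 2) ℂ :=
  ![1, ((Real.sqrt 2)⁻¹ : ℂ) • !![1, 1; 1, -1], ((Real.sqrt 2)⁻¹ : ℂ) • !![1, 1; Complex.I, -Complex.I], 1]

theorem inv_sqrt_two_mul_self : ((Real.sqrt 2 : ℂ))⁻¹ * (Real.sqrt 2 : ℂ)⁻¹ = 1 / 2 := by
  rw [← mul_inv, ← Complex.ofReal_mul, Real.mul_self_sqrt (by norm_num)]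
  norm_num

theorem bitFrame_mem_unitary (a : Fin 4) : bitFrame a ∈ Matrix.unitaryGroup (Fin 2) ℂ := by
  have h := inv_sqrt_two_mul_self
  rw [Matrix.mem_unitaryGroup_iff, Matrix.star_eq_conjTranspose]
  fin_cases a
  · simp [bitFrame]
  · simp only [bitFrame]
    ext i j
    fin_cases i <;> fin_cases j <;> simp [Matrix.mul_apply, Fin.sum_univ_two, h]
    all_goals norm_num
  · simp only [bitFrame]
    ext i j
    fin_cases i <;> fin_cases j <;> simp [Matrix.mul_apply, Fin.sum_univ_two]
      <;> ring_nf <;> simp [sq, h]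
  · simp [bitFrame]

theorem pauliMatrix_mul_bitFrame (a : Fin 4) :
    pauliMatrix a * bitFrame a = bitFrame a * Matrix.diagonal fun b => (bitSign a b : ℂ) := by
  fin_cases a <;> ext i j <;> fin_cases i <;> fin_cases j <;>
    simp [bitFrame, pauliMatrix, Matrix.mul_apply, Fin.sum_univ_two, bitSign, Matrix.diagonal,
      Matrix.one_apply]
  all_goals (ring_nf; try simp)

variable {n : ℕ}

/-- The diagonal of the Pauli operator `p` in the basis given by `pauliFrame p`. -/
def pauliSign (p : Fin n → Fin 4) (x : Bits n) : ℤ := ∏ j, bitSign (p j) (x j)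

/-- A local unitary diagonalizing the Pauli operator `p`. -/
def pauliFrame (p : Fin n → Fin 4) : Matrix (Bits n) (Bits n) ℂ := tensor fun j => bitFrame (p j)

theorem pauliSign_eq_or (p : Fin n → Fin 4) (x : Bits n) : pauliSign p x = 1 ∨ pauliSign p x = -1 := by
  unfold pauliSign
  refine Finset.prod_induction (fun j => bitSign (p j) (x j)) (fun z => z = 1 ∨ z = -1) ?_ (by simp)
    fun j _ => bitSign_eq_or _ _
  rintro a b (rfl | rfl) (rfl | rfl) <;> simp

theorem pauliFrame_mem_unitary (p : Fin n → Fin 4) :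
    pauliFrame p ∈ Matrix.unitaryGroup (Bits n) ℂ := by
  rw [Matrix.mem_unitaryGroup_iff, Matrix.star_eq_conjTranspose, pauliFrame, tensor_conjTranspose,
    tensor_mul]
  rw [← tensor_one]
  congr 1
  ext1 j
  exact Matrix.mem_unitaryGroup_iff.mp (bitFrame_mem_unitary (p j))

theorem pauliFrame_conjTranspose_mem_unitary (p : Fin n → Fin 4) :
    (pauliFrame p).conjTranspose ∈ Matrix.unitaryGroup (Bits n) ℂ :=
  Unitary.star_mem (pauliFrame_mem_unitary p)

theorem tensor_pauliMatrix_eq (p : Fin n → Fin 4) :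
    tensor (fun j => pauliMatrix (p j)) = pauliFrame p *
      Matrix.diagonal (fun x => (pauliSign p x : ℂ)) * (pauliFrame p).conjTranspose := by
  have h : tensor (fun j => pauliMatrix (p j)) * pauliFrame p =
      pauliFrame p * Matrix.diagonal (fun x => (pauliSign p x : ℂ)) := by
    have h1 : Matrix.diagonal (fun x => (pauliSign p x : ℂ)) =
        tensor fun j => Matrix.diagonal fun b => (bitSign (p j) b : ℂ) := by
      rw [tensor_diagonal]
      simp [pauliSign]
    rw [h1, pauliFrame, tensor_mul, tensor_mul]
    simp_rw [pauliMatrix_mul_bitFrame]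
  have h2 : pauliFrame p * (pauliFrame p).conjTranspose = 1 :=
    Matrix.mem_unitaryGroup_iff.mp (pauliFrame_mem_unitary p)
  rw [← h, mul_assoc, h2, mul_one]

theorem pauliRotation_eq (p : PauliLabel n) (θ : ℝ) :
    pauliRotation p θ = pauliFrame p.1 *
      Matrix.diagonal (fun x => Complex.exp (Complex.I * θ / 2 * pauliSign p.1 x)) *
        (pauliFrame p.1).conjTranspose := by
  have hu := Matrix.mem_unitaryGroup_iff.mp (pauliFrame_mem_unitary p.1)
  have hinv : (pauliFrame p.1)⁻¹ = (pauliFrame p.1).conjTranspose := Matrix.inv_eq_right_inv hu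
  have hunit : IsUnit (pauliFrame p.1) := IsUnit.of_mul_eq_one _ hu
  rw [pauliRotation, pauliOp, tensor_pauliMatrix_eq, ← hinv, ← Matrix.smul_mul, ← Matrix.mul_smul,
    Matrix.exp_conj _ _ hunit, ← Matrix.diagonal_smul, Matrix.exp_diagonal]
  congr 3
  ext x
  rw [Pi.coe_exp, Complex.exp_eq_exp_ℂ]
  rfl

theorem diagonal_exp_mem_unitary {ι : Type} [Fintype ι] [DecidableEq ι] (θ : ℝ) (s : ι → ℤ) :
    Matrix.diagonal (fun b => Complex.exp (Complex.I * θ / 2 * s b)) ∈ Matrix.unitaryGroup ι ℂ := by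
  rw [Matrix.mem_unitaryGroup_iff, Matrix.star_eq_conjTranspose, Matrix.diagonal_conjTranspose,
    Matrix.diagonal_mul_diagonal, ← Matrix.diagonal_one]
  congr 1
  ext x
  rw [Pi.star_apply, Complex.star_def, ← Complex.exp_conj, ← Complex.exp_add]
  simp [neg_div, Complex.conj_ofNat]

theorem pauliRotation_mem_unitary (p : PauliLabel n) (θ : ℝ) :
    pauliRotation p θ ∈ Matrix.unitaryGroup (Bits n) ℂ := by
  rw [pauliRotation_eq]
  exact Submonoid.mul_mem _ (Submonoid.mul_mem _ (pauliFrame_mem_unitary _)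
    (diagonal_exp_mem_unitary _ _)) (pauliFrame_conjTranspose_mem_unitary _)

theorem pauliRotation_neg (p : PauliLabel n) (θ : ℝ) :
    pauliRotation p (-θ) = (pauliRotation p θ).conjTranspose := by
  rw [pauliRotation_eq, pauliRotation_eq, Matrix.conjTranspose_mul, Matrix.conjTranspose_mul,
    Matrix.conjTranspose_conjTranspose, Matrix.diagonal_conjTranspose, mul_assoc]
  congr 3
  ext x
  rw [Pi.star_apply, Complex.star_def, ← Complex.exp_conj]
  simp [Complex.conj_ofNat]

theorem sum_pauliMatrix (a b c d : Fin 2) :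
    ∑ p, pauliMatrix p a b * pauliMatrix p c d = if a = d ∧ b = c then 2 else 0 := by
  fin_cases a <;> fin_cases b <;> fin_cases c <;> fin_cases d <;>
    simp [Fin.sum_univ_four, pauliMatrix] <;> norm_num

/-- The sum of P ⊗ P over all Pauli strings is a product over qubits, and each factor is twice the
one-qubit swap. -/
theorem sum_tensor_pauliMatrix (a b c d : Bits n) :
    ∑ p : Fin n → Fin 4, tensor (fun j => pauliMatrix (p j)) a b *
      tensor (fun j => pauliMatrix (p j)) c d = if a = d ∧ b = c then (2 : ℂ) ^ n else 0 := by
  simp only [tensor, Matrix.of_apply, ← Finset.prod_mul_distrib]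
  rw [← Fintype.piFinset_univ, ← Finset.prod_univ_sum (fun _ => Finset.univ)
    (fun j q => pauliMatrix q (a j) (b j) * pauliMatrix q (c j) (d j))]
  simp only [sum_pauliMatrix]
  split_ifs with h
  · obtain ⟨rfl, rfl⟩ := h
    simp
  · by_cases h1 : a = d
    · have h2 : b ≠ c := fun h2 => h ⟨h1, h2⟩
      obtain ⟨j, hj⟩ := Function.ne_iff.mp h2
      exact Finset.prod_eq_zero (Finset.mem_univ j) (by simp [hj])
    · obtain ⟨j, hj⟩ := Function.ne_iff.mp h1
      exact Finset.prod_eq_zero (Finset.mem_univ j) (by simp [hj])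

theorem lieAction_one {ι : Type} [Fintype ι] [DecidableEq ι] (t : ℕ) :
    lieAction t (1 : Matrix ι ι ℂ) = 0 := by
  ext1 η
  ext x y
  rw [← Matrix.diagonal_one, lieAction_diagonal_apply]
  have : (∑ i, (1 : ℂ) * weight x y i) = 0 := by
    simp only [one_mul]
    exact_mod_cast sum_weight x y
  rw [this, zero_mul]
  rfl

/-- The swap identity includes the identity string, which acts by a zero commutator and can be
dropped. -/
theorem sum_lieAction_pauliOp (n t : ℕ) :
    ∑ p : PauliLabel n, lieAction t (pauliOp p) * lieAction t (pauliOp p) =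
      (2 : ℂ) ^ n • casimir (Bits n) t := by
  rw [← sum_lieAction_mul_lieAction (fun p : Fin n → Fin 4 => tensor fun j => pauliMatrix (p j))
    (fun p : Fin n → Fin 4 => tensor fun j => pauliMatrix (p j)) _ sum_tensor_pauliMatrix]
  rw [← Fintype.sum_subtype_add_sum_subtype (fun p : Fin n → Fin 4 => p ≠ 0)]
  refine left_eq_add.mpr ?_
  refine Finset.sum_eq_zero fun p _ => ?_
  have : (fun j => pauliMatrix (p.1 j)) = fun _ : Fin n => 1 := by
    ext1 j
    rw [not_not.mp p.2]
    rfl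
  rw [this, tensor_one, lieAction_one, zero_mul]

theorem card_pauliLabel (n : ℕ) : (Fintype.card (PauliLabel n) : ℝ) = (2 ^ n : ℝ) ^ 2 - 1 := by
  have : Fintype.card (PauliLabel n) = 4 ^ n - 1 := by
    rw [Fintype.card_subtype_compl]
    simp
  rw [this, Nat.cast_sub (Nat.one_le_pow _ _ (by norm_num))]
  push_cast
  rw [← pow_mul, mul_comm n 2, pow_mul]
  norm_num

end PauliDiagonal

/-! ### The random Pauli rotation channel -/

section Channel

variable {n t : ℕ}

/-- Differences of signs are even. This cancels the 1/2 in exp(iθP/2), so the phases have integer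
frequencies and average out exactly over a period 2π. -/
theorem exists_sum_pauliSign_sub (p : Fin n → Fin 4) (x y : Copies n t) :
    ∃ k : ℤ, ∑ l, pauliSign p (x l) - ∑ l, pauliSign p (y l) = 2 * k := by
  rw [← Finset.sum_sub_distrib]
  refine Finset.sum_induction (fun l => pauliSign p (x l) - pauliSign p (y l)) (fun z => ∃ k, z = 2 * k)
    ?_ ⟨0, rfl⟩ fun l _ => ?_
  · rintro _ _ ⟨a, rfl⟩ ⟨b, rfl⟩
    exact ⟨a + b, by ring⟩
  · rcases pauliSign_eq_or p (x l) with h1 | h1 <;> rcases pauliSign_eq_or p (y l) with h2 | h2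
    · exact ⟨0, by omega⟩
    · exact ⟨1, by omega⟩
    · exact ⟨-1, by omega⟩
    · exact ⟨0, by omega⟩

theorem integral_exp_int (k : ℤ) :
    (2 * Real.pi : ℂ)⁻¹ * ∫ θ : ℝ in (-Real.pi)..Real.pi, Complex.exp (Complex.I * k * θ) =
      if k = 0 then 1 else 0 := by
  have hpi : (2 * Real.pi : ℂ) ≠ 0 := by
    norm_cast; positivity
  split_ifs with h
  · subst h
    simp only [Int.cast_zero, mul_zero, zero_mul, Complex.exp_zero, intervalIntegral.integral_const]
    rw [Complex.real_smul, mul_one]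
    push_cast
    rw [sub_neg_eq_add, ← two_mul, inv_mul_cancel₀ hpi]
  · rw [integral_exp_mul_complex (by simp [h])]
    have : Complex.exp (Complex.I * k * Real.pi) = Complex.exp (Complex.I * k * (-Real.pi : ℝ)) := by
      rw [Complex.exp_eq_exp_iff_exists_int]
      exact ⟨k, by push_cast; ring⟩
    rw [this]
    simp

/-- Keep the entries on which the Pauli operator `p`, acting diagonally by commutator, vanishes. -/
def pauliMask (p : Fin n → Fin 4) (η : Matrix (Copies n t) (Copies n t) ℂ) :
    Matrix (Copies n t) (Copies n t) ℂ :=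
  Matrix.of fun x y =>
    (if ∑ l, pauliSign p (x l) = ∑ l, pauliSign p (y l) then 1 else 0) * η x y

theorem integral_mul_matrix_mul {a : Type} [Fintype a] (A B : Matrix a a ℂ)
    {F : ℝ → Matrix a a ℂ} (hF : ∀ i j, Continuous fun θ => F θ i j) (r s : ℝ) (x y : a) :
    ∫ θ in r..s, (A * F θ * B) x y = (A * (Matrix.of fun i j => ∫ θ in r..s, F θ i j) * B) x y := by
  simp only [Matrix.mul_apply, Finset.sum_mul, Matrix.of_apply]
  rw [intervalIntegral.integral_finsetSum]
  · refine Finset.sum_congr rfl fun j _ => ?_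
    rw [intervalIntegral.integral_finsetSum]
    · simp
    · exact fun i _ => Continuous.intervalIntegrable (by fun_prop) _ _
  · exact fun i _ => Continuous.intervalIntegrable (by fun_prop) _ _

theorem tensorPow_pauliRotation (p : PauliLabel n) (θ : ℝ) :
    tensorPow t (pauliRotation p θ) = tensorPow t (pauliFrame p.1) *
      Matrix.diagonal (fun x => Complex.exp (Complex.I * θ / 2 * ∑ l, (pauliSign p.1 (x l) : ℂ))) *
        (tensorPow t (pauliFrame p.1)).conjTranspose := by
  rw [pauliRotation_eq, tensorPow_mul, tensorPow_mul, tensorPow_diagonal, tensorPow_conjTranspose]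
  simp_rw [← Complex.exp_sum, Finset.mul_sum]

/-- In the frame diagonalizing P each entry acquires a phase exp(ikθ), and the average keeps exactly
the entries with k = 0. -/
theorem integral_rotation (p : PauliLabel n) (η : Matrix (Copies n t) (Copies n t) ℂ)
    (x y : Copies n t) :
    (2 * Real.pi : ℂ)⁻¹ * ∫ θ in (-Real.pi)..Real.pi,
        (tensorPow t (pauliRotation p θ) * η * tensorPow t (pauliRotation p (-θ))) x y =
      conjAction t (pauliFrame p.1)
        (pauliMask p.1 (conjAction t (pauliFrame p.1).conjTranspose η)) x y := by
  set ζ := conjAction t (pauliFrame p.1).conjTranspose η with hζ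
  have hF : ∀ θ : ℝ, tensorPow t (pauliRotation p θ) * η * tensorPow t (pauliRotation p (-θ)) =
      tensorPow t (pauliFrame p.1) * (Matrix.of fun x y =>
        Complex.exp (Complex.I * θ / 2 * (∑ l, (pauliSign p.1 (x l) : ℂ) -
          ∑ l, (pauliSign p.1 (y l) : ℂ))) * ζ x y) * (tensorPow t (pauliFrame p.1)).conjTranspose := by
    intro θ
    have : (Matrix.of fun x y => Complex.exp (Complex.I * θ / 2 * (∑ l, (pauliSign p.1 (x l) : ℂ) -
          ∑ l, (pauliSign p.1 (y l) : ℂ))) * ζ x y) =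
        Matrix.diagonal (fun x => Complex.exp (Complex.I * θ / 2 * ∑ l, (pauliSign p.1 (x l) : ℂ))) *
          ζ * Matrix.diagonal
            (fun x => Complex.exp (Complex.I * (-θ : ℝ) / 2 * ∑ l, (pauliSign p.1 (x l) : ℂ))) := by
      ext x y
      rw [Matrix.mul_diagonal, Matrix.diagonal_mul, Matrix.of_apply, mul_right_comm,
        ← Complex.exp_add]
      congr 2
      push_cast
      ring
    rw [this, tensorPow_pauliRotation, tensorPow_pauliRotation, hζ, conjAction_apply,
      tensorPow_conjTranspose, Matrix.conjTranspose_conjTranspose]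
    simp only [mul_assoc]
  simp_rw [hF]
  rw [integral_mul_matrix_mul _ _ (fun i j => by simp only [Matrix.of_apply]; fun_prop),
    conjAction_apply]
  rw [← smul_eq_mul, ← Matrix.smul_apply, ← Matrix.smul_mul, ← Matrix.mul_smul]
  refine congrFun (congrFun (congrArg (fun Z => tensorPow t (pauliFrame p.1) * Z *
    (tensorPow t (pauliFrame p.1)).conjTranspose) ?_) x) y
  ext x y
  obtain ⟨k, hk⟩ := exists_sum_pauliSign_sub p.1 x y
  have hk' : ∑ l, (pauliSign p.1 (x l) : ℂ) - ∑ l, (pauliSign p.1 (y l) : ℂ) = 2 * k := by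
    exact_mod_cast hk
  simp only [Matrix.smul_apply, Matrix.of_apply, pauliMask, hk', smul_eq_mul,
    intervalIntegral.integral_mul_const]
  have : ∀ θ : ℝ, Complex.I * θ / 2 * (2 * k) = Complex.I * k * θ := fun θ => by ring
  simp_rw [this]
  rw [← mul_assoc, integral_exp_int]
  congr 1
  have : k = 0 ↔ ∑ l, pauliSign p.1 (x l) = ∑ l, pauliSign p.1 (y l) := by omega
  simp [this]

theorem pauliChannel_apply (η : Matrix (Copies n t) (Copies n t) ℂ) :
    pauliChannel n t η = (Fintype.card (PauliLabel n) : ℂ)⁻¹ • ∑ p : PauliLabel n,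
      conjAction t (pauliFrame p.1)
        (pauliMask p.1 (conjAction t (pauliFrame p.1).conjTranspose η)) := by
  ext x y
  rw [Matrix.smul_apply, Matrix.sum_apply, smul_eq_mul]
  simp_rw [← integral_rotation]
  rfl

theorem pauliChannel_commute_casimir : Commute (pauliChannel n t) (casimir (Bits n) t) := by
  have hmask : ∀ (p : Fin n → Fin 4) (η : Matrix (Copies n t) (Copies n t) ℂ),
      casimir (Bits n) t (pauliMask p η) = pauliMask p (casimir (Bits n) t η) := by
    intro p η
    refine casimir_mul_entries (fun x y =>
      if ∑ l, pauliSign p (x l) = ∑ l, pauliSign p (y l) then 1 else 0) (fun x y x' y' h => ?_) η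
    -- The difference of sign sums pairs the signs with the weight, so the mask is a function of the
    -- weight.
    have h1 := sum_mul_weight (pauliSign p) x y
    rw [h, sum_mul_weight] at h1
    have : (∑ l, pauliSign p (x l) = ∑ l, pauliSign p (y l)) ↔
      (∑ l, pauliSign p (x' l) = ∑ l, pauliSign p (y' l)) := by omega
    simp [this]
  have hconj : ∀ {u : Matrix (Bits n) (Bits n) ℂ}, u ∈ Matrix.unitaryGroup (Bits n) ℂ → ∀ η,
      conjAction t u (casimir (Bits n) t η) = casimir (Bits n) t (conjAction t u η) :=
    fun hu η => congrArg (fun f => f η) (conjAction_commute_casimir (t := t) hu)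
  refine LinearMap.ext fun η => ?_
  simp only [Module.End.mul_apply, pauliChannel_apply, map_smul, map_sum]
  congr 1
  refine Finset.sum_congr rfl fun p _ => ?_
  rw [hconj (pauliFrame_conjTranspose_mem_unitary _), ← hmask, hconj (pauliFrame_mem_unitary _)]

theorem card_pauliLabel_ne_zero (hn : 1 ≤ n) : (Fintype.card (PauliLabel n) : ℂ) ≠ 0 := by
  have h1 := card_pauliLabel n
  have h2 : (2 : ℝ) ≤ 2 ^ n := by
    calc (2 : ℝ) = 2 ^ 1 := by norm_num
      _ ≤ 2 ^ n := pow_le_pow_right₀ (by norm_num) hn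
  have h3 : (Fintype.card (PauliLabel n) : ℝ) ≠ 0 := by nlinarith
  exact_mod_cast h3

/-- In the kernel every commutator vanishes. In the frame of P this means that all entries off the
mask are already zero. -/
theorem pauliChannel_of_casimir_eq_zero (hn : 1 ≤ n) {η : Matrix (Copies n t) (Copies n t) ℂ}
    (h : casimir (Bits n) t η = 0) : pauliChannel n t η = η := by
  have hterm : ∀ p : PauliLabel n, conjAction t (pauliFrame p.1)
        (pauliMask p.1 (conjAction t (pauliFrame p.1).conjTranspose η)) = η := by
    intro p
    set ζ := conjAction t (pauliFrame p.1).conjTranspose η with hζ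
    have h1 : casimir (Bits n) t ζ = 0 := by
      have := congrArg (fun f => f η)
        (conjAction_commute_casimir (t := t) (pauliFrame_conjTranspose_mem_unitary p.1))
      simp only [Module.End.mul_apply, h, map_zero] at this
      exact this.symm
    have h2 : pauliMask p.1 ζ = ζ := by
      have h3 := lieAction_eq_zero_of_casimir_eq_zero h1
        (Matrix.diagonal fun x => (pauliSign p.1 x : ℂ))
      ext x y
      have h4 := congrFun (congrFun h3 x) y
      rw [lieAction_diagonal_apply, sum_mul_weight_complex] at h4
      rw [pauliMask, Matrix.of_apply]
      split_ifs with h5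
      · rw [one_mul]
      · have : (∑ l, (pauliSign p.1 (x l) : ℂ) - ∑ l, (pauliSign p.1 (y l) : ℂ)) ≠ 0 := by
          rw [sub_ne_zero]
          exact_mod_cast h5
        rw [zero_mul]
        exact ((mul_eq_zero.mp h4).resolve_left this).symm
    have h6 : pauliFrame p.1 * (pauliFrame p.1).conjTranspose = 1 :=
      Matrix.mem_unitaryGroup_iff.mp (pauliFrame_mem_unitary p.1)
    rw [h2, hζ, ← Module.End.mul_apply, ← conjAction_mul, h6, conjAction_one]
    rfl
  rw [pauliChannel_apply, Finset.sum_congr rfl fun p _ => hterm p, Finset.sum_const,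
    Finset.card_univ, ← Nat.cast_smul_eq_nsmul ℂ, smul_smul, inv_mul_cancel₀ (card_pauliLabel_ne_zero hn), one_smul]

-- The spectral gap of the channel.

attribute [local instance] Matrix.frobeniusNormedAddCommGroup Matrix.frobeniusNormedSpace
  frobeniusInnerProductSpace

theorem inner_pauliMask (p : Fin n → Fin 4) (η ζ : Matrix (Copies n t) (Copies n t) ℂ) :
    inner ℂ (pauliMask p η) ζ = inner ℂ η (pauliMask p ζ) := by
  simp only [inner_matrix, pauliMask, Matrix.of_apply]
  refine Finset.sum_congr rfl fun i _ => Finset.sum_congr rfl fun j _ => ?_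
  split_ifs <;> simp

theorem pauliChannel_isSymmetric : (pauliChannel n t).IsSymmetric := by
  intro η ζ
  simp only [pauliChannel_apply, inner_smul_left, inner_smul_right, sum_inner, inner_sum]
  congr 1
  · rw [map_inv₀, Complex.conj_natCast]
  refine Finset.sum_congr rfl fun p _ => ?_
  rw [inner_conjAction_left, inner_pauliMask, ← Matrix.conjTranspose_conjTranspose (pauliFrame p.1),
    ← inner_conjAction_left, Matrix.conjTranspose_conjTranspose]

/-- In the frame of P the commutator multiplies each entry by ∑ ± weight. This factor is zero on the
entries kept by the mask, and at most the ℓ¹ norm of the weight on the others. -/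
theorem norm_sq_lieAction_pauliOp_le {c : ℂ} {m : ℤ} {η : Matrix (Copies n t) (Copies n t) ℂ}
    (hc : casimir (Bits n) t η = c • η)
    (hsupp : ∀ ζ : Matrix (Copies n t) (Copies n t) ℂ, casimir (Bits n) t ζ = c • ζ → ∀ x y,
      ζ x y ≠ 0 → ∑ i, |weight x y i| ≤ m) (p : PauliLabel n) :
    ‖lieAction t (pauliOp p) η‖ ^ 2 ≤ (m : ℝ) ^ 2 * (‖η‖ ^ 2 -
      ‖pauliMask p.1 (conjAction t (pauliFrame p.1).conjTranspose η)‖ ^ 2) := by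
  have hnorm := norm_conjAction (t := t) (pauliFrame_conjTranspose_mem_unitary p.1) η
  set ζ := conjAction t (pauliFrame p.1).conjTranspose η with hζ
  have hu : (pauliFrame p.1).conjTranspose * pauliFrame p.1 = 1 :=
    Matrix.mem_unitaryGroup_iff'.mp (pauliFrame_mem_unitary p.1)
  have h1 := congrArg (fun f => f η) (conjAction_mul_lieAction (t := t)
    (pauliFrame_conjTranspose_mem_unitary p.1) (pauliOp p))
  have h2 : (pauliFrame p.1).conjTranspose * pauliOp p *
      (pauliFrame p.1).conjTranspose.conjTranspose =
      Matrix.diagonal (fun x => (pauliSign p.1 x : ℂ)) := by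
    rw [pauliOp, tensor_pauliMatrix_eq, Matrix.conjTranspose_conjTranspose]
    simp only [mul_assoc, hu, mul_one]
    rw [← mul_assoc, hu, one_mul]
  rw [h2] at h1
  simp only [Module.End.mul_apply] at h1
  rw [← norm_conjAction (pauliFrame_conjTranspose_mem_unitary p.1), h1, ← hnorm, ← hζ]
  have hζc : casimir (Bits n) t (ζ) = c • ζ := by
    have := congrArg (fun f => f η)
      (conjAction_commute_casimir (t := t) (pauliFrame_conjTranspose_mem_unitary p.1))
    simp only [Module.End.mul_apply, hc, map_smul] at this
    exact this.symm
  rw [norm_sq_matrix, norm_sq_matrix, norm_sq_matrix, ← Finset.sum_sub_distrib, Finset.mul_sum]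
  refine Finset.sum_le_sum fun x _ => ?_
  rw [← Finset.sum_sub_distrib, Finset.mul_sum]
  refine Finset.sum_le_sum fun y _ => ?_
  rw [lieAction_diagonal_apply, sum_mul_weight_complex, pauliMask, Matrix.of_apply]
  by_cases h0 : ζ x y = 0
  · simp [h0]
  split_ifs with h5
  · have : (∑ l, (pauliSign p.1 (x l) : ℂ) - ∑ l, (pauliSign p.1 (y l) : ℂ)) = 0 := by
      rw [sub_eq_zero]
      exact_mod_cast h5
    simp [this]
  · rw [zero_mul, norm_zero, norm_mul, mul_pow]
    have h6 : |∑ l, pauliSign p.1 (x l) - ∑ l, pauliSign p.1 (y l)| ≤ m := by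
      rw [← sum_mul_weight]
      refine (Finset.abs_sum_le_sum_abs _ _).trans (le_trans (Finset.sum_le_sum fun i _ => ?_)
        (hsupp (ζ) hζc x y h0))
      rw [abs_mul]
      rcases pauliSign_eq_or p.1 i with h | h <;> simp [h]
    have h7 : ‖(∑ l, (pauliSign p.1 (x l) : ℂ) - ∑ l, (pauliSign p.1 (y l) : ℂ))‖ ≤ m := by
      have : (∑ l, (pauliSign p.1 (x l) : ℂ) - ∑ l, (pauliSign p.1 (y l) : ℂ)) =
          ((∑ l, pauliSign p.1 (x l) - ∑ l, pauliSign p.1 (y l) : ℤ) : ℂ) := by push_cast; rfl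
      rw [this, Complex.norm_intCast]
      exact_mod_cast h6
    have : (0 : ℝ) ^ 2 = 0 := by norm_num
    rw [this, sub_zero]
    gcongr

theorem sum_norm_sq_lieAction_pauliOp {r : ℝ} {η : Matrix (Copies n t) (Copies n t) ℂ}
    (hc : casimir (Bits n) t η = (r : ℂ) • η) :
    ∑ p : PauliLabel n, ‖lieAction t (pauliOp p) η‖ ^ 2 = 2 ^ n * r * ‖η‖ ^ 2 := by
  have h1 := congrArg (fun f => inner ℂ η (f η)) (sum_lieAction_pauliOp n t)
  simp only [LinearMap.sum_apply, inner_sum, Module.End.mul_apply, LinearMap.smul_apply, hc,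
    inner_smul_right, inner_self_eq_norm_sq_to_K] at h1
  have h2 : ∀ p : PauliLabel n, inner ℂ η (lieAction t (pauliOp p) (lieAction t (pauliOp p) η)) =
      ((‖lieAction t (pauliOp p) η‖ ^ 2 : ℝ) : ℂ) := by
    intro p
    have hherm : (pauliOp p).conjTranspose = pauliOp p := by
      rw [pauliOp, tensor_pauliMatrix_eq, Matrix.conjTranspose_mul, Matrix.conjTranspose_mul,
        Matrix.conjTranspose_conjTranspose, Matrix.diagonal_conjTranspose, mul_assoc]
      congr 3
      ext x
      simp
    have := inner_lieAction_left (t := t) (pauliOp p) η (lieAction t (pauliOp p) η)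
    rw [hherm] at this
    rw [← this, inner_self_eq_norm_sq_to_K]
    simp
  simp only [h2] at h1
  rw [← Complex.ofReal_sum] at h1
  have h3 : ((∑ p : PauliLabel n, ‖lieAction t (pauliOp p) η‖ ^ 2 : ℝ) : ℂ) =
      ((2 ^ n * r * ‖η‖ ^ 2 : ℝ) : ℂ) := by
    rw [h1]; push_cast; simp [mul_assoc]
  exact_mod_cast h3

theorem inner_pauliChannel (η : Matrix (Copies n t) (Copies n t) ℂ) :
    inner ℂ η (pauliChannel n t η) = (((Fintype.card (PauliLabel n) : ℝ)⁻¹ * ∑ p : PauliLabel n,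
      ‖pauliMask p.1 (conjAction t (pauliFrame p.1).conjTranspose η)‖ ^ 2 : ℝ) : ℂ) := by
  have hterm : ∀ p : PauliLabel n, inner ℂ η (conjAction t (pauliFrame p.1)
      (pauliMask p.1 (conjAction t (pauliFrame p.1).conjTranspose η))) =
      ((‖pauliMask p.1 (conjAction t (pauliFrame p.1).conjTranspose η)‖ ^ 2 : ℝ) : ℂ) := by
    intro p
    have h1 := inner_conjAction_left (t := t) (pauliFrame p.1).conjTranspose η
      (pauliMask p.1 (conjAction t (pauliFrame p.1).conjTranspose η))
    set ζ := conjAction t (pauliFrame p.1).conjTranspose η with hζ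
    have hidem : pauliMask p.1 (pauliMask p.1 ζ) = pauliMask p.1 ζ := by
      ext x y
      simp only [pauliMask, Matrix.of_apply]
      split_ifs <;> simp
    rw [Matrix.conjTranspose_conjTranspose] at h1
    rw [← h1, ← hidem, ← inner_pauliMask, hidem, inner_self_eq_norm_sq_to_K]
    simp
  rw [pauliChannel_apply, inner_smul_right, inner_sum, Finset.sum_congr rfl fun p _ => hterm p]
  push_cast
  rfl

/-- Here `e` is ‖η‖², `S` the sum of the squared norms of the projections of η, `K` the number of
Paulis and `r` the Casimir eigenvalue. Inserting N m ≤ 2r cancels one factor m, and then K ≤ N² and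
m ≤ 2t are used. -/
theorem gap_arithmetic {N K m r e S t : ℝ} (hN2 : 2 ≤ N) (hKN : K = N ^ 2 - 1) (hm0 : 0 < m)
    (hmt : m ≤ 2 * t) (he : 0 < e) (hr : N * m ≤ 2 * r) (h : N * r * e ≤ m ^ 2 * (K * e - S)) :
    K⁻¹ * S / e ≤ 1 - 1 / (4 * t) := by
  have hK0 : 0 < K := by nlinarith
  have ht : 0 < t := by linarith
  have h1 : N ^ 2 * e ≤ 2 * m * (K * e - S) := by
    have h2 : N * (N * m) * e ≤ N * (2 * r) * e := by gcongr
    have h3 : m * (N ^ 2 * e) ≤ m * (2 * m * (K * e - S)) := by nlinarith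
    exact le_of_mul_le_mul_left h3 hm0
  have h2 : 0 ≤ K * e - S := by
    have h3 : 0 ≤ (2 * m) * (K * e - S) := le_trans (by positivity) h1
    exact nonneg_of_mul_nonneg_right h3 (by positivity)
  have h3 : K * e ≤ 4 * t * (K * e - S) := by
    have h4 : 2 * m * (K * e - S) ≤ 4 * t * (K * e - S) :=
      mul_le_mul_of_nonneg_right (by linarith) h2
    have h5 : K * e ≤ N ^ 2 * e := mul_le_mul_of_nonneg_right (by linarith) he.le
    linarith
  rw [div_le_iff₀ he, inv_mul_le_iff₀ hK0]
  have h4 : K * e / (4 * t) ≤ K * e - S := by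
    rw [div_le_iff₀ (by positivity)]
    linarith
  have h5 : K * ((1 - 1 / (4 * t)) * e) = K * e - K * e / (4 * t) := by ring
  rw [h5]
  linarith

/-- The spectral gap: on nontrivial eigenspaces of the Casimir operator, the eigenvalues of the
channel are at most `1 - 1 / (4 t)`. -/
theorem pauliChannel_eigenvalue (hn : 1 ≤ n) {c M : ℂ}
    {η : Matrix (Copies n t) (Copies n t) ℂ} (hη : η ≠ 0) (hc : casimir (Bits n) t η = c • η)
    (hc0 : c ≠ 0) (hM : pauliChannel n t η = M • η) :
    ∃ r : ℝ, M = r ∧ 0 ≤ r ∧ r ≤ 1 - 1 / (4 * t) := by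
  obtain ⟨m, hm0, hmt, ⟨r, rfl, hr⟩, hsupp⟩ := exists_casimir_bound hη hc hc0
  have hN2 : (2 : ℝ) ≤ 2 ^ n := by
    calc (2 : ℝ) = 2 ^ 1 := by norm_num
      _ ≤ 2 ^ n := pow_le_pow_right₀ (by norm_num) hn
  have hη0 : 0 < ‖η‖ ^ 2 := by positivity
  have hinner := inner_pauliChannel η
  have hsum := sum_norm_sq_lieAction_pauliOp hc
  have hTp := fun p => norm_sq_lieAction_pauliOp_le hc hsupp p
  set Q : PauliLabel n → ℝ := fun p =>
    ‖pauliMask p.1 (conjAction t (pauliFrame p.1).conjTranspose η)‖ ^ 2 with hQ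
  have hQ0 : 0 ≤ ∑ p, Q p := Finset.sum_nonneg fun p _ => sq_nonneg _
  have hMr : M = (((Fintype.card (PauliLabel n) : ℝ)⁻¹ * ∑ p, Q p) / ‖η‖ ^ 2 : ℝ) := by
    rw [hM, inner_smul_right, inner_self_eq_norm_sq_to_K] at hinner
    rw [Complex.ofReal_div, ← hinner]
    have : ((‖η‖ ^ 2 : ℝ) : ℂ) ≠ 0 := by exact_mod_cast hη0.ne'
    push_cast at this ⊢
    exact (mul_div_cancel_right₀ _ this).symm
  refine ⟨_, hMr, div_nonneg (mul_nonneg (inv_nonneg.mpr (Nat.cast_nonneg _)) hQ0) hη0.le, ?_⟩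
  refine gap_arithmetic hN2 (card_pauliLabel n) (m := m) (r := r) (by exact_mod_cast hm0)
    (by exact_mod_cast hmt) hη0 (by simpa using hr) ?_
  rw [← hsum]
  refine (Finset.sum_le_sum fun p _ => hTp p).trans_eq ?_
  rw [← Finset.mul_sum, Finset.sum_sub_distrib, Finset.sum_const, Finset.card_univ, nsmul_eq_mul]

end Channel

/-! ### Invariance under the unitary group -/

section Invariance

variable {ι : Type} [Fintype ι] [DecidableEq ι] {t : ℕ}

/-- Weight zero means that `y` is a rearrangement of `x`. -/
theorem prod_eq_prod_of_weight_eq_zero (d : ι → ℂ) {x y : Fin t → ι} (h : ∀ i, weight x y i = 0) :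
    ∏ l, d (x l) = ∏ l, d (y l) := by
  have key : ∀ z : Fin t → ι, ∏ l, d (z l) = ∏ i, d i ^ (Finset.univ.filter fun l => z l = i).card := by
    intro z
    rw [← Finset.prod_fiberwise Finset.univ z]
    refine Finset.prod_congr rfl fun i _ => ?_
    rw [Finset.prod_congr rfl fun l hl => by rw [(Finset.mem_filter.mp hl).2], Finset.prod_const]
  rw [key, key]
  refine Finset.prod_congr rfl fun i _ => ?_
  congr 1
  have := h i
  rw [weight, Finset.sum_sub_distrib, Finset.sum_boole, Finset.sum_boole, sub_eq_zero] at this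
  exact_mod_cast this

theorem tensorPow_diagonal_comm {η : Matrix (Fin t → ι) (Fin t → ι) ℂ} (h : casimir ι t η = 0)
    (d : ι → ℂ) :
    tensorPow t (Matrix.diagonal d) * η = η * tensorPow t (Matrix.diagonal d) := by
  ext x y
  rw [tensorPow_diagonal, Matrix.diagonal_mul, Matrix.mul_diagonal, mul_comm]
  by_cases h0 : η x y = 0
  · simp [h0]
  · rw [prod_eq_prod_of_weight_eq_zero d fun i => ?_]
    have := congrFun (congrFun (lieAction_eq_zero_of_casimir_eq_zero h (Matrix.single i i 1)) x) y
    rw [lieAction_single_apply] at this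
    exact_mod_cast (mul_eq_zero.mp this).resolve_right h0

theorem tensorPow_hermitian_comm {η : Matrix (Fin t → ι) (Fin t → ι) ℂ} (h : casimir ι t η = 0)
    {X : Matrix ι ι ℂ} (hX : X.IsHermitian) :
    tensorPow t X * η = η * tensorPow t X := by
  obtain ⟨U, d, hU, rfl⟩ : ∃ (U : Matrix ι ι ℂ) (d : ι → ℂ), U ∈ Matrix.unitaryGroup ι ℂ ∧
      X = U * Matrix.diagonal d * U.conjTranspose := by
    refine ⟨hX.eigenvectorUnitary, RCLike.ofReal ∘ hX.eigenvalues, hX.eigenvectorUnitary.2, ?_⟩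
    conv_lhs => rw [hX.spectral_theorem, Unitary.conjStarAlgAut_apply]
    rfl
  have hU' : U.conjTranspose ∈ Matrix.unitaryGroup ι ℂ := Unitary.star_mem hU
  have h1 : casimir ι t (conjAction t U.conjTranspose η) = 0 := by
    have := congrArg (fun f => f η) (conjAction_commute_casimir (t := t) hU')
    simp only [Module.End.mul_apply, h, map_zero] at this
    exact this.symm
  have h2 := tensorPow_diagonal_comm h1 d
  rw [conjAction_apply, tensorPow_conjTranspose, Matrix.conjTranspose_conjTranspose] at h2
  have h3 := tensorPow_mul_conjTranspose_self (t := t) hU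
  rw [tensorPow_mul, tensorPow_mul, tensorPow_conjTranspose]
  set V := tensorPow t U
  set D := tensorPow t (Matrix.diagonal d)
  calc V * D * V.conjTranspose * η
      = V * (D * (V.conjTranspose * η * V)) * V.conjTranspose := by
        simp only [mul_assoc, h3, mul_one]
    _ = V * V.conjTranspose * η * (V * D * V.conjTranspose) := by rw [h2]; simp only [mul_assoc]
    _ = _ := by rw [h3, one_mul]

/-- Write A = X + iY with X, Y Hermitian. The entries of the commutator of η with (X + zY)^(⊗t) are
polynomials in z that vanish for all real z by the Hermitian case, hence also at z = i. This passes
from the Lie algebra to the group without integrating one-parameter subgroups. -/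
theorem tensorPow_comm {η : Matrix (Fin t → ι) (Fin t → ι) ℂ} (h : casimir ι t η = 0)
    (A : Matrix ι ι ℂ) : tensorPow t A * η = η * tensorPow t A := by
  obtain ⟨X, Y, hX, hY, hA⟩ : ∃ X Y : Matrix ι ι ℂ, X.IsHermitian ∧ Y.IsHermitian ∧
      A = X + Complex.I • Y := by
    refine ⟨(1 / 2 : ℝ) • (A + A.conjTranspose), (1 / 2 : ℝ) • (Complex.I • (A.conjTranspose - A)),
      ?_, ?_, ?_⟩
    · rw [Matrix.IsHermitian, Matrix.conjTranspose_smul, Matrix.conjTranspose_add,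
        Matrix.conjTranspose_conjTranspose, add_comm, star_trivial]
    · rw [Matrix.IsHermitian, Matrix.conjTranspose_smul, Matrix.conjTranspose_smul,
        Matrix.conjTranspose_sub, Matrix.conjTranspose_conjTranspose, star_trivial]
      simp [← smul_neg]
    · ext i j
      simp only [Matrix.add_apply, Matrix.smul_apply, Matrix.sub_apply, smul_eq_mul,
        Complex.real_smul]
      push_cast
      linear_combination (-(1 / 2) * (A.conjTranspose i j - A i j)) * Complex.I_mul_I
  ext x y
  set q : (Fin t → ι) → (Fin t → ι) → Polynomial ℂ := fun x y =>
    ∏ l, (Polynomial.C (X (x l) (y l)) + Polynomial.C (Y (x l) (y l)) * Polynomial.X) with hq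
  have hqe : ∀ z x y, (q x y).eval z = tensorPow t (X + z • Y) x y := by
    intro z x y
    simp [hq, mul_comm z, Polynomial.eval_prod, tensorPow, tensor]
  set P : Polynomial ℂ := ∑ w, q x w * Polynomial.C (η w y) - ∑ w, Polynomial.C (η x w) * q w y
    with hP
  have hPe : ∀ z, P.eval z = (tensorPow t (X + z • Y) * η - η * tensorPow t (X + z • Y)) x y := by
    intro z
    simp [hP, Polynomial.eval_finsetSum, hqe, Matrix.mul_apply]
  have hP0 : P = 0 := by
    refine Polynomial.eq_zero_of_infinite_isRoot P (Set.Infinite.mono (s := Set.range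
      (fun r : ℝ => (r : ℂ))) ?_ (Set.infinite_range_of_injective Complex.ofReal_injective))
    rintro _ ⟨r, rfl⟩
    change P.eval (r : ℂ) = 0
    rw [hPe, tensorPow_hermitian_comm h, sub_self]
    · rfl
    · refine hX.add ?_
      rw [Matrix.IsHermitian, Matrix.conjTranspose_smul, hY.eq]
      simp
  have := hPe Complex.I
  rw [hP0, ← hA, Polynomial.eval_zero, Matrix.sub_apply] at this
  exact (sub_eq_zero.mp this.symm)

theorem conjAction_of_casimir_eq_zero {η : Matrix (Fin t → ι) (Fin t → ι) ℂ}
    (h : casimir ι t η = 0) {u : Matrix ι ι ℂ} (hu : u ∈ Matrix.unitaryGroup ι ℂ) :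
    conjAction t u η = η := by
  rw [conjAction_apply, tensorPow_comm h, mul_assoc, tensorPow_mul_conjTranspose_self hu, mul_one]

/-- Divide by an N-th root of the determinant. Such phases cancel under conjugation, so
SU(N)-invariance extends to all unitaries, in particular to the rotations and frames. -/
theorem exists_specialUnitary_smul [Nonempty ι] {u : Matrix ι ι ℂ}
    (hu : u ∈ Matrix.unitaryGroup ι ℂ) :
    ∃ (c : ℂ) (v : Matrix.specialUnitaryGroup ι ℂ), c * star c = 1 ∧ u = c • v.1 := by
  obtain ⟨c, hc⟩ := IsAlgClosed.exists_pow_nat_eq u.det (n := Fintype.card ι) Fintype.card_pos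
  have hdet : ‖u.det‖ = 1 := by
    have h1 := congrArg Matrix.det (Matrix.mem_unitaryGroup_iff.mp hu)
    rw [Matrix.det_mul, Matrix.star_eq_conjTranspose, Matrix.det_conjTranspose, Matrix.det_one] at h1
    have h2 := congrArg norm h1
    rw [norm_mul, norm_star, norm_one] at h2
    nlinarith [norm_nonneg u.det]
  have hc1 : ‖c‖ = 1 := by
    rw [← hc, norm_pow] at hdet
    exact (pow_eq_one_iff_of_nonneg (norm_nonneg _) Fintype.card_ne_zero).mp hdet
  have hcc : c * star c = 1 := by
    rw [Complex.star_def, Complex.mul_conj, Complex.normSq_eq_norm_sq, hc1]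
    simp
  refine ⟨c, ⟨star c • u, ?_⟩, hcc, ?_⟩
  · rw [Matrix.mem_specialUnitaryGroup_iff]
    constructor
    · rw [Matrix.mem_unitaryGroup_iff, star_smul, star_star, Matrix.smul_mul, Matrix.mul_smul,
        Matrix.mem_unitaryGroup_iff.mp hu, smul_smul, mul_comm, hcc, one_smul]
    · rw [Matrix.det_smul, ← hc, ← mul_pow, mul_comm, hcc, one_pow]
  · rw [smul_smul, hcc, one_smul]

theorem conjAction_smul {c : ℂ} (hc : c * star c = 1) (u : Matrix ι ι ℂ) :
    conjAction t (c • u) = conjAction t u := by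
  ext1 η
  rw [conjAction_apply, conjAction_apply, tensorPow_smul, Matrix.conjTranspose_smul,
    Matrix.smul_mul, Matrix.mul_smul, Matrix.smul_mul, smul_smul, star_pow, ← mul_pow, mul_comm, hc]
  simp

end Invariance

/-! ### The Haar twirl -/

section HaarChannel

instance (ι : Type) [Fintype ι] [DecidableEq ι] : IsProbabilityMeasure (haarSU ι) :=
  ⟨by simpa [haarSU] using Measure.haarMeasure_self (G := Matrix.specialUnitaryGroup ι ℂ) (K₀ := ⊤)⟩

instance (ι : Type) [Fintype ι] [DecidableEq ι] : (haarSU ι).IsHaarMeasure := by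
  unfold haarSU; infer_instance

variable {n t : ℕ}

theorem integrable_haarSU {ι : Type} [Fintype ι] [DecidableEq ι]
    {f : Matrix.specialUnitaryGroup ι ℂ → ℂ} (hf : Continuous f) : Integrable f (haarSU ι) :=
  hf.integrable_of_hasCompactSupport (HasCompactSupport.of_compactSpace f)

theorem continuous_tensorPow_coe {ι : Type} [Fintype ι] [DecidableEq ι] :
    Continuous fun U : Matrix.specialUnitaryGroup ι ℂ => tensorPow t U.1 :=
  continuous_tensorPow t continuous_subtype_val

theorem haarChannel_apply (η : Matrix (Copies n t) (Copies n t) ℂ) (x y : Copies n t) :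
    haarChannel n t η x y = ∫ U, conjAction t U.1 η x y ∂(haarSU (Bits n)) := by
  simp only [conjAction_apply]
  rfl

theorem haarChannel_of_casimir_eq_zero {η : Matrix (Copies n t) (Copies n t) ℂ}
    (h : casimir (Bits n) t η = 0) : haarChannel n t η = η := by
  ext x y
  have : ∀ U : Matrix.specialUnitaryGroup (Bits n) ℂ, conjAction t U.1 η = η := fun U =>
    conjAction_of_casimir_eq_zero h (Matrix.mem_specialUnitaryGroup_iff.mp U.2).1
  rw [haarChannel_apply]
  simp [this]

theorem integral_haarSU_mul_matrix_mul {a : Type} [Fintype a] (A B : Matrix a a ℂ)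
    {F : Matrix.specialUnitaryGroup (Bits n) ℂ → Matrix a a ℂ} (hF : ∀ i j, Continuous fun U => F U i j)
    (x y : a) :
    ∫ U, (A * F U * B) x y ∂(haarSU (Bits n)) =
      (A * (Matrix.of fun i j => ∫ U, F U i j ∂(haarSU (Bits n))) * B) x y := by
  simp only [Matrix.mul_apply, Finset.sum_mul, Matrix.of_apply]
  rw [integral_finsetSum]
  · refine Finset.sum_congr rfl fun j _ => ?_
    rw [integral_finsetSum]
    · simp only [integral_const_mul, integral_mul_const]
    · exact fun i _ => integrable_haarSU (by fun_prop)
  · exact fun i _ => integrable_haarSU (by fun_prop)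

theorem continuous_conjAction_coe (η : Matrix (Copies n t) (Copies n t) ℂ) (x y : Copies n t) :
    Continuous fun U : Matrix.specialUnitaryGroup (Bits n) ℂ => conjAction t U.1 η x y := by
  simp only [conjAction_apply]
  exact (continuous_copiesConj η).matrix_elem x y

theorem conjAction_haarChannel {u : Matrix (Bits n) (Bits n) ℂ}
    (hu : u ∈ Matrix.unitaryGroup (Bits n) ℂ) (η : Matrix (Copies n t) (Copies n t) ℂ) :
    conjAction t u (haarChannel n t η) = haarChannel n t η := by
  obtain ⟨c, v, hc, rfl⟩ := exists_specialUnitary_smul hu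
  rw [conjAction_smul hc]
  ext x y
  have h1 : haarChannel n t η = Matrix.of fun x y => ∫ U, conjAction t U.1 η x y ∂(haarSU (Bits n)) := by
    ext x y
    exact haarChannel_apply η x y
  have h2 := integral_haarSU_mul_matrix_mul (tensorPow t v.1) (tensorPow t v.1).conjTranspose
    (fun i j => continuous_conjAction_coe η i j) x y
  rw [conjAction_apply]
  conv_lhs => rw [h1]
  rw [← h2, haarChannel_apply]
  have h3 : ∀ U : Matrix.specialUnitaryGroup (Bits n) ℂ, (tensorPow t v.1 * conjAction t U.1 η *
      (tensorPow t v.1).conjTranspose) x y = conjAction t (v * U).1 η x y := by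
    intro U
    rw [← conjAction_apply, ← Module.End.mul_apply, ← conjAction_mul]
    rfl
  simp_rw [h3]
  exact integral_mul_left_eq_self (fun U : Matrix.specialUnitaryGroup (Bits n) ℂ =>
    conjAction t U.1 η x y) v

theorem pauliChannel_haarChannel (hn : 1 ≤ n) (η : Matrix (Copies n t) (Copies n t) ℂ) :
    pauliChannel n t (haarChannel n t η) = haarChannel n t η := by
  ext x y
  change (Fintype.card (PauliLabel n) : ℂ)⁻¹ * ∑ p : PauliLabel n,
      (2 * Real.pi : ℂ)⁻¹ * ∫ θ in (-Real.pi)..Real.pi, (tensorPow t (pauliRotation p θ) *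
        haarChannel n t η * tensorPow t (pauliRotation p (-θ))) x y = _
  have h1 : ∀ p θ, tensorPow t (pauliRotation p θ) * haarChannel n t η *
      tensorPow t (pauliRotation p (-θ)) = haarChannel n t η := by
    intro p θ
    rw [pauliRotation_neg, tensorPow_conjTranspose, ← conjAction_apply,
      conjAction_haarChannel (pauliRotation_mem_unitary p θ)]
  have h2 := integral_exp_int 0
  simp only [Int.cast_zero, mul_zero, zero_mul, Complex.exp_zero, if_true,
    intervalIntegral.integral_const, Complex.real_smul, mul_one] at h2
  simp only [h1, intervalIntegral.integral_const, Complex.real_smul]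
  rw [← mul_assoc, h2, one_mul, Finset.sum_const, Finset.card_univ, nsmul_eq_mul,
    inv_mul_cancel_left₀ (card_pauliLabel_ne_zero hn)]

attribute [local instance] Matrix.frobeniusNormedAddCommGroup Matrix.frobeniusNormedSpace
  frobeniusInnerProductSpace

theorem inner_haarChannel (ζ η : Matrix (Copies n t) (Copies n t) ℂ) :
    inner ℂ ζ (haarChannel n t η) = ∫ U, inner ℂ ζ (conjAction t U.1 η) ∂(haarSU (Bits n)) := by
  have hi : ∀ i j, Integrable (fun U : Matrix.specialUnitaryGroup (Bits n) ℂ =>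
      star (ζ i j) * conjAction t U.1 η i j) (haarSU (Bits n)) := fun i j =>
    (integrable_haarSU (continuous_conjAction_coe η i j)).const_mul _
  simp only [inner_matrix, haarChannel_apply]
  rw [integral_finsetSum _ fun i _ => integrable_finsetSum _ fun j _ => hi i j]
  refine Finset.sum_congr rfl fun i _ => ?_
  rw [integral_finsetSum _ fun j _ => hi i j]
  simp only [integral_const_mul]

/-- The twirl Hη is fixed by the self-adjoint channel, hence orthogonal to η, whose eigenvalue is
not 1. As Hη is also fixed by all conjugations, ⟨Hη, Hη⟩ = ⟨Hη, η⟩ = 0. -/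
theorem haarChannel_eq_zero_of_eigenvalue_ne_one (hn : 1 ≤ n) {M : ℂ} (hM1 : M ≠ 1)
    {η : Matrix (Copies n t) (Copies n t) ℂ} (hM : pauliChannel n t η = M • η) :
    haarChannel n t η = 0 := by
  have h1 : inner ℂ (haarChannel n t η) η = 0 := by
    have h2 := pauliChannel_isSymmetric (haarChannel n t η) η
    rw [pauliChannel_haarChannel hn, hM, inner_smul_right] at h2
    have h3 : (1 - M) * inner ℂ (haarChannel n t η) η = 0 := by linear_combination h2
    exact (mul_eq_zero.mp h3).resolve_left (sub_ne_zero.mpr hM1.symm)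
  rw [← inner_self_eq_zero (𝕜 := ℂ), inner_haarChannel, ← h1]
  have h4 : ∀ U : Matrix.specialUnitaryGroup (Bits n) ℂ,
      inner ℂ (haarChannel n t η) (conjAction t U.1 η) = inner ℂ (haarChannel n t η) η := by
    intro U
    have hU := (Matrix.mem_specialUnitaryGroup_iff.mp U.2).1
    have h5 := inner_conjAction_left (t := t) U.1.conjTranspose (haarChannel n t η) η
    rw [Matrix.conjTranspose_conjTranspose, ← Matrix.star_eq_conjTranspose,
      conjAction_haarChannel (Unitary.star_mem hU)] at h5
    exact h5.symm
  simp [h4]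

/-- Convergence of the random Pauli rotation walk in the Frobenius norm. -/
theorem norm_pauliChannel_pow_sub_haarChannel_le (hn : 1 ≤ n) (ht : 1 ≤ t) (k : ℕ)
    (η : Matrix (Copies n t) (Copies n t) ℂ) :
    ‖(pauliChannel n t ^ k - haarChannel n t) η‖ ≤ (1 - 1 / (4 * t : ℝ)) ^ k * ‖η‖ := by
  have ht' : (1 : ℝ) ≤ t := by exact_mod_cast ht
  have hq : (0 : ℝ) ≤ 1 - 1 / (4 * t : ℝ) := by
    rw [sub_nonneg, div_le_one (by positivity)]
    linarith
  obtain ⟨r, v, α, β, hv⟩ := exists_joint_eigenbasis (pauliChannel_isSymmetric (n := n) (t := t))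
    casimir_isSymmetric pauliChannel_commute_casimir
  have hpow : ∀ i, (pauliChannel n t ^ k) (v i) = α i ^ k • v i := by
    intro i
    induction k with
    | zero => simp
    | succ k ih => rw [pow_succ', Module.End.mul_apply, ih, map_smul, (hv i).1, smul_smul, pow_succ]
  have hv0 : ∀ i, v i ≠ 0 := fun i => v.orthonormal.ne_zero i
  -- On the Casimir kernel the two channels agree; elsewhere the twirl vanishes and only the power
  -- of the channel eigenvalue remains.
  refine norm_apply_le_of_eigenbasis v (δ := fun i => if β i = 0 then 0 else α i ^ k) (fun i => ?_)
    (fun i => ?_) η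
  · rw [LinearMap.sub_apply, hpow]
    split_ifs with h
    · have h0 : casimir (Bits n) t (v i) = 0 := by rw [(hv i).2, h, zero_smul]
      have h1 : α i = 1 := by
        have := (hv i).1
        rw [pauliChannel_of_casimir_eq_zero hn h0] at this
        exact (smul_left_injective ℂ (hv0 i) ((one_smul ℂ (v i)).trans this)).symm
      rw [haarChannel_of_casimir_eq_zero h0, h1, one_pow, one_smul, sub_self, zero_smul]
    · obtain ⟨s, hs, hs0, hs1⟩ := pauliChannel_eigenvalue hn (hv0 i) (hv i).2 h (hv i).1
      rw [haarChannel_eq_zero_of_eigenvalue_ne_one hn ?_ (hv i).1, sub_zero]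
      rw [hs]
      have : s < 1 := hs1.trans_lt (sub_lt_self _ (by positivity))
      exact_mod_cast this.ne
  · split_ifs with h
    · rw [norm_zero]; positivity
    · obtain ⟨s, hs, hs0, hs1⟩ := pauliChannel_eigenvalue hn (hv0 i) (hv i).2 h (hv i).1
      rw [norm_pow, hs, Complex.norm_real, Real.norm_of_nonneg hs0]
      gcongr

end HaarChannel

/-! ### Trace norm and diamond norm -/

section TraceNorm

variable {b : Type} [Fintype b] [DecidableEq b]

/-- A singular value decomposition: `W` is unitary, `X W` has orthogonal columns, whose norms are
the singular values. -/
theorem exists_singular_basis (X : Matrix b b ℂ) :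
    ∃ (W : Matrix b b ℂ) (s : b → ℝ), W ∈ Matrix.unitaryGroup b ℂ ∧ (∀ q, 0 ≤ s q) ∧
      ∑ q, s q = traceNorm X ∧
      (X * W).conjTranspose * (X * W) = Matrix.diagonal fun q => ((s q ^ 2 : ℝ) : ℂ) := by
  set hX := Matrix.isHermitian_conjTranspose_mul_self X
  have hnn : ∀ q, 0 ≤ hX.eigenvalues q := (Matrix.posSemidef_conjTranspose_mul_self X).eigenvalues_nonneg
  refine ⟨hX.eigenvectorUnitary, fun q => Real.sqrt (hX.eigenvalues q), hX.eigenvectorUnitary.2,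
    fun q => Real.sqrt_nonneg _, rfl, ?_⟩
  have h := hX.conjStarAlgAut_star_eigenvectorUnitary
  rw [Unitary.conjStarAlgAut_apply] at h
  simp only [Real.sq_sqrt (hnn _)]
  rw [Matrix.conjTranspose_mul]
  simpa [mul_assoc, Function.comp_def, Matrix.star_eq_conjTranspose] using h

theorem sum_norm_sq_mul_unitary {W : Matrix b b ℂ} (hW : W ∈ Matrix.unitaryGroup b ℂ) (z : b → ℂ) :
    ∑ q, ‖∑ j, z j * W j q‖ ^ 2 = ∑ j, ‖z j‖ ^ 2 := by
  have h : ∀ v : b → ℂ, ((∑ q, ‖v q‖ ^ 2 : ℝ) : ℂ) = dotProduct v (star v) := by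
    intro v
    simp only [dotProduct, Pi.star_apply, Complex.star_def, Complex.mul_conj, Complex.normSq_eq_norm_sq]
    push_cast; rfl
  have h1 : dotProduct (Matrix.vecMul z W) (star (Matrix.vecMul z W)) = dotProduct z (star z) := by
    rw [Matrix.star_vecMul, ← Matrix.dotProduct_mulVec, Matrix.mulVec_mulVec,
      ← Matrix.star_eq_conjTranspose, Matrix.mem_unitaryGroup_iff.mp hW, Matrix.one_mulVec]
  rw [← h, ← h] at h1
  exact_mod_cast h1

/-- The left vectors are left unnormalized, with norm `s q`, so zero singular values need no
separate treatment. -/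
theorem exists_sum_vecMulVec (X : Matrix b b ℂ) :
    ∃ (x w : b → b → ℂ) (s : b → ℝ), (∀ q, 0 ≤ s q) ∧ ∑ q, s q = traceNorm X ∧
      X = ∑ q, Matrix.vecMulVec (x q) (star (w q)) ∧ (∀ q, ∑ i, ‖x q i‖ ^ 2 = s q ^ 2) ∧
      ∀ q, ∑ i, ‖w q i‖ ^ 2 = 1 := by
  obtain ⟨W, s, hW, hs0, hs, hd⟩ := exists_singular_basis X
  refine ⟨fun q i => (X * W) i q, fun q i => W i q, s, hs0, hs, ?_, fun q => ?_, fun q => ?_⟩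
  · have : X = X * W * W.conjTranspose := by
      rw [mul_assoc, ← Matrix.star_eq_conjTranspose, Matrix.mem_unitaryGroup_iff.mp hW, mul_one]
    conv_lhs => rw [this]
    ext i j
    rw [Matrix.mul_apply, Matrix.sum_apply]
    rfl
  · have := congrFun (congrFun hd q) q
    rw [Matrix.diagonal_apply_eq, Matrix.mul_apply] at this
    simp only [Matrix.conjTranspose_apply, Complex.star_def, ← Complex.normSq_eq_conj_mul_self,
      Complex.normSq_eq_norm_sq] at this
    exact_mod_cast this
  · have := congrFun (congrFun (Matrix.mem_unitaryGroup_iff'.mp hW) q) q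
    rw [Matrix.one_apply_eq, Matrix.mul_apply] at this
    simp only [Matrix.star_apply, Complex.star_def, ← Complex.normSq_eq_conj_mul_self,
      Complex.normSq_eq_norm_sq] at this
    exact_mod_cast this

/-- The trace norm is attained on a contraction. -/
theorem exists_contraction_trace_mul (Y : Matrix b b ℂ) :
    ∃ V : Matrix b b ℂ, (V * Y).trace = traceNorm Y ∧
      ∀ z : b → ℂ, ∑ i, ‖∑ j, z j * V j i‖ ^ 2 ≤ ∑ j, ‖z j‖ ^ 2 := by
  obtain ⟨W, s, hW, hs0, hs, hd⟩ := exists_singular_basis Y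
  -- Since the inverse of 0 is 0, this is a partial isometry even if `Y` is singular.
  set N : Matrix b b ℂ := Matrix.diagonal (fun q => ((s q)⁻¹ : ℂ)) * (Y * W).conjTranspose with hN
  have hWW := Matrix.mem_unitaryGroup_iff.mp hW
  refine ⟨W * N, ?_, fun z => ?_⟩
  · rw [mul_assoc, Matrix.trace_mul_comm, mul_assoc, hN, mul_assoc, hd, Matrix.diagonal_mul_diagonal,
      Matrix.trace_diagonal, ← hs]
    push_cast
    refine Finset.sum_congr rfl fun q _ => ?_
    by_cases h : (s q : ℂ) = 0
    · simp [h]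
    · field_simp
  · have h1 : N * N.conjTranspose = Matrix.diagonal fun q => if s q = 0 then 0 else 1 := by
      rw [hN, Matrix.conjTranspose_mul (Matrix.diagonal _), Matrix.conjTranspose_conjTranspose,
        Matrix.diagonal_conjTranspose, mul_assoc, ← mul_assoc (Y * W).conjTranspose, hd,
        Matrix.diagonal_mul_diagonal, Matrix.diagonal_mul_diagonal]
      congr 1
      ext q
      by_cases h : s q = 0
      · simp [h]
      · have : (s q : ℂ) ≠ 0 := by exact_mod_cast h
        simp [h]
        field_simp
    rw [← sum_norm_sq_mul_unitary hW z]
    set y : b → ℂ := fun q => ∑ j, z j * W j q with hy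
    have h2 : ∀ i, ∑ j, z j * (W * N) j i = Matrix.vecMul y N i := by
      intro i
      have : Matrix.vecMul z (W * N) = Matrix.vecMul (Matrix.vecMul z W) N := by
        rw [Matrix.vecMul_vecMul]
      exact congrFun this i
    have h : ∀ v : b → ℂ, ((∑ q, ‖v q‖ ^ 2 : ℝ) : ℂ) = dotProduct v (star v) := by
      intro v
      simp only [dotProduct, Pi.star_apply, Complex.star_def, Complex.mul_conj,
        Complex.normSq_eq_norm_sq]
      push_cast; rfl
    simp only [h2]
    have h3 : dotProduct (Matrix.vecMul y N) (star (Matrix.vecMul y N)) =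
        ((∑ q, (if s q = 0 then 0 else 1) * ‖y q‖ ^ 2 : ℝ) : ℂ) := by
      rw [Matrix.star_vecMul, ← Matrix.dotProduct_mulVec, Matrix.mulVec_mulVec, h1]
      simp only [dotProduct, Matrix.mulVec_diagonal, Pi.star_apply, Complex.ofReal_sum]
      refine Finset.sum_congr rfl fun q _ => ?_
      have h4 : y q * star (y q) = ((‖y q‖ ^ 2 : ℝ) : ℂ) := by
        rw [Complex.star_def, Complex.mul_conj, Complex.normSq_eq_norm_sq]
      split_ifs
      · simp
      · rw [one_mul, one_mul, h4]
    rw [← h] at h3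
    rw [Complex.ofReal_injective h3]
    refine Finset.sum_le_sum fun q _ => ?_
    change _ ≤ ‖y q‖ ^ 2
    split_ifs <;> simp

end TraceNorm

/-! ### From the Hilbert–Schmidt norm to the diamond norm. -/

section Diamond

variable {a : Type} [Fintype a] [DecidableEq a]

theorem sum_norm_sq_block_le {m : ℕ} (V : Matrix (a × Fin m) (a × Fin m) ℂ)
    (hV : ∀ z : a × Fin m → ℂ, ∑ i, ‖∑ j, z j * V j i‖ ^ 2 ≤ ∑ j, ‖z j‖ ^ 2) (j : a) (w : Fin m → ℂ) :
    ∑ i, ‖∑ r, w r * V (j, r) i‖ ^ 2 ≤ ∑ r, ‖w r‖ ^ 2 := by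
  have := hV fun y => if y.1 = j then w y.2 else 0
  simp only [Fintype.sum_prod_type, ite_mul, zero_mul] at this
  have e1 : ∀ i, ∑ x, ∑ r, (if x = j then w r * V (x, r) i else 0) = ∑ r, w r * V (j, r) i := by
    intro i
    rw [Finset.sum_eq_single j] <;> simp +contextual
  have e2 : ∑ x, ∑ r, ‖(if x = j then w r else 0)‖ ^ 2 = ∑ r, ‖w r‖ ^ 2 := by
    rw [Finset.sum_eq_single j] <;> simp +contextual
  rw [e2] at this
  simpa only [e1, Fintype.sum_prod_type] using this

attribute [local instance] Matrix.frobeniusNormedAddCommGroup Matrix.frobeniusNormedSpace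
  frobeniusInnerProductSpace

/-- For a rank-one input the trace pairs two families: `G`, built from blocks of the contraction,
and `F`, the images under D of matrices with a single nonzero column. By Cauchy–Schwarz each
contributes the square root of dim a, so the factor is dim a, independent of the auxiliary dimension
`m`. -/
theorem norm_trace_mul_tensorId_le {D : SuperOp a} {κ : ℝ} (hκ : 0 ≤ κ) (hD : ∀ η, ‖D η‖ ≤ κ * ‖η‖)
    {m : ℕ} {V : Matrix (a × Fin m) (a × Fin m) ℂ}
    (hV : ∀ z : a × Fin m → ℂ, ∑ i, ‖∑ j, z j * V j i‖ ^ 2 ≤ ∑ j, ‖z j‖ ^ 2)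
    (x w : a × Fin m → ℂ) {r s : ℝ} (hr : 0 ≤ r) (hs : 0 ≤ s) (hx : ∑ i, ‖x i‖ ^ 2 = r ^ 2)
    (hw : ∑ i, ‖w i‖ ^ 2 = s ^ 2) :
    ‖(V * tensorId D m (Matrix.vecMulVec x (star w))).trace‖ ≤ Fintype.card a * κ * (r * s) := by
  set F : a → Fin m → Matrix a a ℂ := fun l p =>
    D (Matrix.of fun i j => if j = l then x (i, p) else 0) with hF
  have hblock : ∀ (i : a) (p : Fin m) (j : a) (q : Fin m),
      tensorId D m (Matrix.vecMulVec x (star w)) (i, p) (j, q) =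
      ∑ l, star (w (l, q)) * F l p i j := by
    intro i p j q
    have : (Matrix.of fun i j => Matrix.vecMulVec x (star w) (i, p) (j, q)) =
        ∑ l, star (w (l, q)) • (Matrix.of fun i j => if j = l then x (i, p) else 0 : Matrix a a ℂ) := by
      ext i j
      simp [Matrix.vecMulVec, Matrix.sum_apply, mul_comm]
    change D (Matrix.of fun i j => Matrix.vecMulVec x (star w) (i, p) (j, q)) i j = _
    rw [this, map_sum, Matrix.sum_apply]
    refine Finset.sum_congr rfl fun l _ => ?_
    rw [map_smul]
    rfl
  set G : a → a → a × Fin m → ℂ := fun l j i => ∑ q, star (w (l, q)) * V (j, q) i with hG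
  have htr : (V * tensorId D m (Matrix.vecMulVec x (star w))).trace =
      ∑ y : (a × a) × (a × Fin m), G y.1.1 y.1.2 y.2 * F y.1.1 y.2.2 y.2.1 y.1.2 := by
    have h1 : (V * tensorId D m (Matrix.vecMulVec x (star w))).trace =
        ∑ j, ∑ q, ∑ y : a × Fin m, ∑ l, V (j, q) y * (star (w (l, q)) * F l y.2 y.1 j) := by
      simp only [Matrix.trace, Matrix.diag, Matrix.mul_apply, ← Finset.mul_sum, ← hblock]
      rw [Fintype.sum_prod_type]
    rw [h1, Fintype.sum_prod_type, Fintype.sum_prod_type]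
    rw [Finset.sum_comm (f := fun l j => ∑ y : a × Fin m, G l j y * F l y.2 y.1 j)]
    refine Finset.sum_congr rfl fun j _ => ?_
    rw [Finset.sum_comm, Finset.sum_comm (f := fun l y => G l j y * F l y.2 y.1 j)]
    refine Finset.sum_congr rfl fun y _ => ?_
    rw [Finset.sum_comm]
    refine Finset.sum_congr rfl fun l _ => ?_
    rw [hG, Finset.sum_mul]
    exact Finset.sum_congr rfl fun q _ => by ring
  have hG2 : ∑ y : (a × a) × (a × Fin m), ‖G y.1.1 y.1.2 y.2‖ ^ 2 ≤ Fintype.card a * s ^ 2 := by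
    rw [Fintype.sum_prod_type, Fintype.sum_prod_type]
    calc ∑ l, ∑ j, ∑ i, ‖G l j i‖ ^ 2 ≤ ∑ l, ∑ j : a, ∑ q, ‖w (l, q)‖ ^ 2 := by
          refine Finset.sum_le_sum fun l _ => Finset.sum_le_sum fun j _ => ?_
          simpa [hG] using sum_norm_sq_block_le V hV j fun q => star (w (l, q))
      _ = Fintype.card a * s ^ 2 := by
          rw [← hw, Fintype.sum_prod_type]
          simp [Finset.mul_sum]
  have hF2 : ∑ y : (a × a) × (a × Fin m), ‖F y.1.1 y.2.2 y.2.1 y.1.2‖ ^ 2 ≤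
      κ ^ 2 * (Fintype.card a * r ^ 2) := by
    have h1 : ∀ l p, ∑ i, ∑ j, ‖F l p i j‖ ^ 2 ≤ κ ^ 2 * ∑ i, ‖x (i, p)‖ ^ 2 := by
      intro l p
      rw [← norm_sq_matrix]
      calc ‖F l p‖ ^ 2 ≤ (κ * ‖(Matrix.of fun i j => if j = l then x (i, p) else 0 : Matrix a a ℂ)‖) ^ 2 := by
            gcongr
            exact hD _
        _ = _ := by
            rw [mul_pow, norm_sq_matrix]
            congr 1
            refine Finset.sum_congr rfl fun i _ => ?_
            rw [Finset.sum_eq_single l] <;> simp +contextual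
    calc ∑ y : (a × a) × (a × Fin m), ‖F y.1.1 y.2.2 y.2.1 y.1.2‖ ^ 2
        = ∑ l, ∑ p, ∑ i, ∑ j, ‖F l p i j‖ ^ 2 := by
          rw [Fintype.sum_prod_type, Fintype.sum_prod_type]
          refine Finset.sum_congr rfl fun l _ => ?_
          rw [Finset.sum_comm, Fintype.sum_prod_type_right]
      _ ≤ ∑ l : a, ∑ p, κ ^ 2 * ∑ i, ‖x (i, p)‖ ^ 2 :=
          Finset.sum_le_sum fun l _ => Finset.sum_le_sum fun p _ => h1 l p
      _ = κ ^ 2 * (Fintype.card a * r ^ 2) := by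
          rw [← hx, Fintype.sum_prod_type_right, Finset.sum_const, Finset.card_univ, nsmul_eq_mul,
            ← Finset.mul_sum]
          ring
  rw [htr]
  refine (norm_sum_le _ _).trans ?_
  simp only [norm_mul]
  refine (Real.sum_mul_le_sqrt_mul_sqrt _ _ _).trans ?_
  calc _ ≤ Real.sqrt (Fintype.card a * s ^ 2) * Real.sqrt (κ ^ 2 * (Fintype.card a * r ^ 2)) := by
        gcongr
    _ = Fintype.card a * κ * (r * s) := by
        rw [← Real.sqrt_mul (by positivity)]
        rw [show (Fintype.card a * s ^ 2) * (κ ^ 2 * (Fintype.card a * r ^ 2)) =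
          (Fintype.card a * κ * (r * s)) ^ 2 by ring]
        exact Real.sqrt_sq (by positivity)

theorem traceNorm_tensorId_le {D : SuperOp a} {κ : ℝ} (hκ : 0 ≤ κ) (hD : ∀ η, ‖D η‖ ≤ κ * ‖η‖)
    {m : ℕ} (X : Matrix (a × Fin m) (a × Fin m) ℂ) :
    traceNorm (tensorId D m X) ≤ Fintype.card a * κ * traceNorm X := by
  obtain ⟨V, hVt, hV⟩ := exists_contraction_trace_mul (tensorId D m X)
  obtain ⟨x, w, s, hs0, hs, hX, hx, hw⟩ := exists_sum_vecMulVec X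
  calc traceNorm (tensorId D m X) ≤ |traceNorm (tensorId D m X)| := le_abs_self _
    _ = ‖(V * tensorId D m X).trace‖ := by rw [hVt, Complex.norm_real, Real.norm_eq_abs]
    _ = ‖∑ q, (V * tensorId D m (Matrix.vecMulVec (x q) (star (w q)))).trace‖ := by
        conv_lhs => rw [hX]
        rw [map_sum, Finset.mul_sum, Matrix.trace_sum]
    _ ≤ ∑ q, Fintype.card a * κ * (s q * 1) :=
        (norm_sum_le _ _).trans (Finset.sum_le_sum fun q _ => norm_trace_mul_tensorId_le hκ hD hV _ _
          (hs0 q) zero_le_one (hx q) (by rw [hw, one_pow]))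
    _ = Fintype.card a * κ * traceNorm X := by
        rw [← Finset.mul_sum, ← hs]
        simp

theorem diamondNorm_le {D : SuperOp a} {κ : ℝ} (hκ : 0 ≤ κ) (hD : ∀ η, ‖D η‖ ≤ κ * ‖η‖) :
    diamondNorm D ≤ ENNReal.ofReal (Fintype.card a * κ) := by
  refine iSup_le fun m => iSup_le fun X => iSup_le fun hX => ENNReal.ofReal_le_ofReal ?_
  refine (traceNorm_tensorId_le hκ hD X).trans ?_
  exact mul_le_of_le_one_right (by positivity) hX

end Diamond

/-! ### The Choi form of a superoperator -/

section Choi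

variable {a : Type} [Fintype a] [DecidableEq a]

/-- The Choi matrix of `D`, acting on vectors indexed by `a × a` written as matrices. -/
def choiMap (D : SuperOp a) : SuperOp a where
  toFun z := Matrix.of fun i k => ∑ j, ∑ l, D (Matrix.single k l 1) i j * z j l
  map_add' y z := by
    ext i k
    simp [mul_add, Finset.sum_add_distrib]
  map_smul' c z := by
    ext i k
    simp [Finset.mul_sum, mul_left_comm]

theorem choiMap_apply (D : SuperOp a) (z : Matrix a a ℂ) (i k : a) :
    choiMap D z i k = ∑ j, ∑ l, D (Matrix.single k l 1) i j * z j l := rfl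

theorem choiMap_add (D E : SuperOp a) : choiMap (D + E) = choiMap D + choiMap E := by
  ext1 z
  ext i k
  simp [choiMap_apply, add_mul, Finset.sum_add_distrib]

theorem choiMap_sub (D E : SuperOp a) : choiMap (D - E) = choiMap D - choiMap E := by
  ext1 z
  ext i k
  simp [choiMap_apply, sub_mul, Finset.sum_sub_distrib]

theorem choiMap_smul (c : ℂ) (D : SuperOp a) : choiMap (c • D) = c • choiMap D := by
  ext1 z
  ext i k
  simp [choiMap_apply, Finset.mul_sum, mul_assoc]

attribute [local instance] Matrix.frobeniusNormedAddCommGroup Matrix.frobeniusNormedSpace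
  frobeniusInnerProductSpace

theorem apply_eq_sum_single (D : SuperOp a) (η : Matrix a a ℂ) (i j : a) :
    D η i j = ∑ k, ∑ l, η k l * D (Matrix.single k l 1) i j := by
  conv_lhs => rw [Matrix.matrix_eq_sum_single η]
  simp only [map_sum, Matrix.sum_apply]
  refine Finset.sum_congr rfl fun k _ => Finset.sum_congr rfl fun l _ => ?_
  rw [← mul_one (η k l), ← smul_eq_mul, ← Matrix.smul_single, map_smul]
  simp

/-- Hermitian-preserving superoperators. -/
def PreservesStar (D : SuperOp a) : Prop := ∀ η, D η.conjTranspose = (D η).conjTranspose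

theorem PreservesStar.choiMap_isSymmetric {D : SuperOp a} (hD : PreservesStar D) :
    (choiMap D).IsSymmetric := by
  intro y z
  simp only [inner_matrix, choiMap_apply, Finset.mul_sum, star_sum, star_mul', Finset.sum_mul]
  have h : ∀ i k j l, star (D (Matrix.single k l 1) i j) = D (Matrix.single l k 1) j i := by
    intro i k j l
    have := congrFun (congrFun (hD (Matrix.single k l 1)) j) i
    rw [Matrix.conjTranspose_single, star_one, Matrix.conjTranspose_apply] at this
    exact this.symm
  simp only [h]
  have e : ∀ f : a → a → a → a → ℂ, ∑ i, ∑ k, ∑ j, ∑ l, f i k j l = ∑ j, ∑ l, ∑ i, ∑ k, f i k j l := by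
    intro f
    rw [← Fintype.sum_prod_type' (f := fun i k => ∑ j, ∑ l, f i k j l),
      ← Fintype.sum_prod_type' (f := fun j l => ∑ i, ∑ k, f i k j l)]
    simp only [← Fintype.sum_prod_type' (f := fun j l => f _ _ j l),
      ← Fintype.sum_prod_type' (f := fun i k => f i k _ _)]
    exact Finset.sum_comm
  rw [e]
  refine Finset.sum_congr rfl fun i _ => Finset.sum_congr rfl fun k _ => Finset.sum_congr rfl fun j _ =>
    Finset.sum_congr rfl fun l _ => ?_
  ring

/-- Contracting the auxiliary index turns the pair x, y into one matrix z = y x†. The auxiliary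
system thus disappears from the positivity test. -/
theorem dotProduct_tensorId_vecMulVec (D : SuperOp a) {m : ℕ} (x y : a × Fin m → ℂ) :
    dotProduct (star y) ((tensorId D m (Matrix.vecMulVec x (star x))).mulVec y) =
      inner ℂ (Matrix.of fun j l => ∑ q, y (j, q) * star (x (l, q)))
        (choiMap D (Matrix.of fun j l => ∑ q, y (j, q) * star (x (l, q)))) := by
  set z : Matrix a a ℂ := Matrix.of fun j l => ∑ q, y (j, q) * star (x (l, q)) with hz
  have h1 : ∀ i p, (tensorId D m (Matrix.vecMulVec x (star x))).mulVec y (i, p) =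
      ∑ k, x (k, p) * choiMap D z i k := by
    intro i p
    have h2 : ∀ j q, tensorId D m (Matrix.vecMulVec x (star x)) (i, p) (j, q) =
        ∑ k, ∑ l, x (k, p) * star (x (l, q)) * D (Matrix.single k l 1) i j := by
      intro j q
      change D (Matrix.of fun k l => Matrix.vecMulVec x (star x) (k, p) (l, q)) i j = _
      rw [apply_eq_sum_single]
      rfl
    simp only [Matrix.mulVec, dotProduct, Fintype.sum_prod_type, h2, choiMap_apply, hz,
      Matrix.of_apply, Finset.mul_sum, Finset.sum_mul]
    calc ∑ j, ∑ q, ∑ k, ∑ l, x (k, p) * star (x (l, q)) * D (Matrix.single k l 1) i j * y (j, q)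
        = ∑ j, ∑ k, ∑ l, ∑ q, x (k, p) * star (x (l, q)) * D (Matrix.single k l 1) i j * y (j, q) := by
          refine Finset.sum_congr rfl fun j _ => ?_
          rw [Finset.sum_comm]
          refine Finset.sum_congr rfl fun k _ => ?_
          rw [Finset.sum_comm]
      _ = ∑ k, ∑ j, ∑ l, ∑ q, x (k, p) * star (x (l, q)) * D (Matrix.single k l 1) i j * y (j, q) :=
          Finset.sum_comm
      _ = _ := by
          refine Finset.sum_congr rfl fun k _ => Finset.sum_congr rfl fun j _ =>
            Finset.sum_congr rfl fun l _ => Finset.sum_congr rfl fun q _ => by ring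
  simp only [dotProduct, Fintype.sum_prod_type, h1, inner_matrix, Pi.star_apply, Finset.mul_sum]
  refine Finset.sum_congr rfl fun i _ => ?_
  rw [Finset.sum_comm]
  refine Finset.sum_congr rfl fun k _ => ?_
  rw [hz, Matrix.of_apply, star_sum, Finset.sum_mul]
  refine Finset.sum_congr rfl fun p _ => ?_
  simp
  ring

/-- Choi's criterion: a positive semidefinite input is a sum of rank-one terms, and each of these is
tested by the Choi form. -/
theorem PreservesStar.isCompletelyPositive {D : SuperOp a} (hD : PreservesStar D)
    (h : ∀ z, 0 ≤ (inner ℂ z (choiMap D z) : ℂ)) : IsCompletelyPositive D := by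
  intro m X hX
  obtain ⟨B, rfl⟩ : ∃ B : Matrix (a × Fin m) (a × Fin m) ℂ, X = B.conjTranspose * B := by
    open scoped MatrixOrder in
    obtain ⟨B, hB⟩ := CStarAlgebra.nonneg_iff_eq_star_mul_self.mp hX.nonneg
    exact ⟨B, hB⟩
  have hB : B.conjTranspose * B = ∑ r, Matrix.vecMulVec (star (B r)) (star (star (B r))) := by
    ext i j
    rw [Matrix.mul_apply, Matrix.sum_apply]
    simp [Matrix.vecMulVec]
  rw [hB, map_sum]
  refine Matrix.posSemidef_sum _ fun r _ => ?_
  refine Matrix.PosSemidef.of_dotProduct_mulVec_nonneg ?_ fun y => ?_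
  · ext p q
    set Y := Matrix.vecMulVec (star (B r)) (star (star (B r))) with hY
    change star (D (Matrix.of fun i j => Y (i, q.2) (j, p.2)) q.1 p.1) =
      D (Matrix.of fun i j => Y (i, p.2) (j, q.2)) p.1 q.1
    rw [← Matrix.conjTranspose_apply, ← hD]
    refine congrFun (congrFun (congrArg D ?_) p.1) q.1
    ext i j
    simp [hY, Matrix.vecMulVec, mul_comm]
  · rw [dotProduct_tensorId_vecMulVec]
    exact h _

theorem norm_single_one (k l : a) : ‖(Matrix.single k l (1 : ℂ) : Matrix a a ℂ)‖ = 1 := by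
  have h : ‖(Matrix.single k l (1 : ℂ) : Matrix a a ℂ)‖ ^ 2 = 1 := by
    rw [norm_sq_matrix, Finset.sum_eq_single k]
    · rw [Finset.sum_eq_single l] <;> simp +contextual [eq_comm]
    · intro i _ hi
      simp [hi.symm]
    · simp
  exact (pow_eq_one_iff_of_nonneg (norm_nonneg _) two_ne_zero).mp h

/-- The operator norm is at most the Hilbert–Schmidt norm, whose square is the sum of ‖D(E_kl)‖²
over all (dim a)² matrix units. -/
theorem norm_choiMap_le {D : SuperOp a} {κ : ℝ} (hκ : 0 ≤ κ) (hD : ∀ η, ‖D η‖ ≤ κ * ‖η‖)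
    (z : Matrix a a ℂ) : ‖choiMap D z‖ ≤ Fintype.card a * κ * ‖z‖ := by
  have key : ‖choiMap D z‖ ^ 2 ≤ (Fintype.card a * κ * ‖z‖) ^ 2 := by
    calc ‖choiMap D z‖ ^ 2 = ∑ i, ∑ k, ‖∑ j, ∑ l, D (Matrix.single k l 1) i j * z j l‖ ^ 2 :=
          norm_sq_matrix _
      _ ≤ ∑ i, ∑ k, (∑ j, ∑ l, ‖D (Matrix.single k l 1) i j‖ ^ 2) * ‖z‖ ^ 2 := by
          refine Finset.sum_le_sum fun i _ => Finset.sum_le_sum fun k _ => ?_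
          rw [norm_sq_matrix z]
          simp only [← Fintype.sum_prod_type' (f := fun j l => D (Matrix.single k l 1) i j * z j l),
            ← Fintype.sum_prod_type' (f := fun j l => ‖D (Matrix.single k l 1) i j‖ ^ 2),
            ← Fintype.sum_prod_type' (f := fun j l => ‖z j l‖ ^ 2)]
          refine le_trans ?_ (Finset.sum_mul_sq_le_sq_mul_sq _ _ _)
          gcongr
          refine (norm_sum_le _ _).trans_eq ?_
          simp only [norm_mul]
      _ = (∑ k, ∑ l, ‖D (Matrix.single k l 1)‖ ^ 2) * ‖z‖ ^ 2 := by
          simp only [← Finset.sum_mul, norm_sq_matrix (D _)]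
          congr 1
          rw [Finset.sum_comm]
          refine Finset.sum_congr rfl fun k _ => ?_
          rw [Finset.sum_comm (s := Finset.univ (α := a)) (f := fun l i => ∑ j, ‖D (Matrix.single k l 1) i j‖ ^ 2)]
          refine Finset.sum_congr rfl fun i _ => ?_
          rw [Finset.sum_comm]
      _ ≤ (∑ k : a, ∑ l : a, κ ^ 2) * ‖z‖ ^ 2 := by
          gcongr with k _ l _
          have := hD (Matrix.single k l 1)
          rwa [norm_single_one, mul_one] at this
      _ = _ := by
          simp
          ring
  exact le_of_sq_le_sq key (by positivity)

theorem choiMap_one (z : Matrix a a ℂ) : choiMap 1 z = z.trace • (1 : Matrix a a ℂ) := by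
  ext i k
  rw [choiMap_apply]
  by_cases h : i = k
  · subst h
    rw [Matrix.trace, Matrix.smul_apply, Matrix.one_apply_eq, smul_eq_mul, mul_one]
    refine Finset.sum_congr rfl fun j _ => ?_
    rw [Finset.sum_eq_single j] <;> simp +contextual
  · simp [Ne.symm h, Matrix.one_apply_ne h]

end Choi

/-! ### The Choi form of the Haar twirl -/

section HaarChoi

variable {n t : ℕ}

attribute [local instance] Matrix.frobeniusNormedAddCommGroup Matrix.frobeniusNormedSpace
  frobeniusInnerProductSpace

theorem tensorPow_coe_mem_unitary (t : ℕ) (U : Matrix.specialUnitaryGroup (Bits n) ℂ) :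
    tensorPow t U.1 ∈ Matrix.unitaryGroup (Copies n t) ℂ :=
  tensorPow_mem_unitary (Matrix.mem_specialUnitaryGroup_iff.mp U.2).1

theorem continuous_inner_tensorPow (z : Matrix (Copies n t) (Copies n t) ℂ) :
    Continuous fun U : Matrix.specialUnitaryGroup (Bits n) ℂ => (inner ℂ z (tensorPow t U.1) : ℂ) := by
  have h : ∀ i j, Continuous fun U : Matrix.specialUnitaryGroup (Bits n) ℂ => tensorPow t U.1 i j :=
    fun i j => continuous_tensorPow_coe.matrix_elem i j
  simp only [inner_matrix]
  fun_prop

theorem continuous_inner_tensorPow_left (z : Matrix (Copies n t) (Copies n t) ℂ) :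
    Continuous fun U : Matrix.specialUnitaryGroup (Bits n) ℂ => (inner ℂ (tensorPow t U.1) z : ℂ) := by
  have : (fun U : Matrix.specialUnitaryGroup (Bits n) ℂ => (inner ℂ (tensorPow t U.1) z : ℂ)) =
      fun U => star (inner ℂ z (tensorPow t U.1) : ℂ) := by
    ext U
    exact (inner_conj_symm _ _).symm
  rw [this]
  exact (continuous_inner_tensorPow z).star

theorem conjAction_single_apply {ι : Type} [Fintype ι] [DecidableEq ι] (u : Matrix ι ι ℂ)
    (k l i j : Fin t → ι) :
    conjAction t u (Matrix.single k l 1) i j = tensorPow t u i k * star (tensorPow t u j l) := by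
  rw [conjAction_apply, Matrix.mul_apply, Finset.sum_eq_single l]
  · simp
  · intro m _ hm
    rw [Matrix.mul_single_apply_of_ne _ _ _ _ _ hm, zero_mul]
  · simp

/-- The Choi form of conjugation by V is the rank-one form of the vector V; the twirl averages these
over V = U^(⊗t). -/
theorem inner_choiMap_haarChannel (y z : Matrix (Copies n t) (Copies n t) ℂ) :
    inner ℂ y (choiMap (haarChannel n t) z) =
      ∫ U, inner ℂ (tensorPow t U.1) z * inner ℂ y (tensorPow t U.1) ∂(haarSU (Bits n)) := by
  have hc : ∀ i j, Continuous fun U : Matrix.specialUnitaryGroup (Bits n) ℂ => tensorPow t U.1 i j :=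
    fun i j => continuous_tensorPow_coe.matrix_elem i j
  have h1 : ∀ U : Matrix.specialUnitaryGroup (Bits n) ℂ,
      (inner ℂ (tensorPow t U.1) z * inner ℂ y (tensorPow t U.1) : ℂ) =
      ∑ i, ∑ k, star (y i k) * ∑ j, ∑ l, (tensorPow t U.1 i k * star (tensorPow t U.1 j l)) * z j l := by
    intro U
    rw [mul_comm, inner_matrix, inner_matrix, Finset.sum_mul]
    refine Finset.sum_congr rfl fun i _ => ?_
    rw [Finset.sum_mul]
    refine Finset.sum_congr rfl fun k _ => ?_
    rw [mul_assoc, Finset.mul_sum]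
    congr 1
    refine Finset.sum_congr rfl fun j _ => ?_
    rw [Finset.mul_sum]
    exact Finset.sum_congr rfl fun l _ => by ring
  simp only [h1]
  rw [integral_finsetSum _ fun i _ => integrable_haarSU (by fun_prop), inner_matrix]
  refine Finset.sum_congr rfl fun i _ => ?_
  rw [integral_finsetSum _ fun i _ => integrable_haarSU (by fun_prop)]
  refine Finset.sum_congr rfl fun k _ => ?_
  rw [integral_const_mul, choiMap_apply]
  congr 1
  rw [integral_finsetSum _ fun i _ => integrable_haarSU (by fun_prop)]
  refine Finset.sum_congr rfl fun j _ => ?_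
  rw [integral_finsetSum _ fun i _ => integrable_haarSU (by fun_prop)]
  refine Finset.sum_congr rfl fun l _ => ?_
  rw [integral_mul_const, haarChannel_apply]
  simp only [conjAction_single_apply]

theorem choiMap_haarChannel_isSymmetric : (choiMap (haarChannel n t)).IsSymmetric := by
  intro y z
  rw [← inner_conj_symm, inner_choiMap_haarChannel, inner_choiMap_haarChannel, ← integral_conj]
  congr 1
  ext U
  rw [map_mul, inner_conj_symm, inner_conj_symm]
  ring

theorem choiMap_haarChannel_mul (v : Matrix.specialUnitaryGroup (Bits n) ℂ)
    (z : Matrix (Copies n t) (Copies n t) ℂ) :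
    choiMap (haarChannel n t) (tensorPow t v.1 * z) = tensorPow t v.1 * choiMap (haarChannel n t) z := by
  refine ext_inner_left ℂ fun y => ?_
  have h1 := inner_mul_left_matrix (tensorPow t v.1).conjTranspose y (choiMap (haarChannel n t) z)
  rw [Matrix.conjTranspose_conjTranspose] at h1
  rw [← h1, inner_choiMap_haarChannel, inner_choiMap_haarChannel,
    ← integral_mul_left_eq_self (fun U : Matrix.specialUnitaryGroup (Bits n) ℂ =>
    (inner ℂ (tensorPow t U.1) (tensorPow t v.1 * z) * inner ℂ y (tensorPow t U.1) : ℂ)) v]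
  congr 1
  ext U
  have h2 : tensorPow t (v * U).1 = tensorPow t v.1 * tensorPow t U.1 := tensorPow_mul _ _
  have h3 : (tensorPow t v.1).conjTranspose * tensorPow t v.1 = 1 :=
    Matrix.mem_unitaryGroup_iff'.mp (tensorPow_coe_mem_unitary t v)
  rw [h2, inner_mul_left_matrix, ← mul_assoc, h3, one_mul, inner_mul_left_matrix,
    Matrix.conjTranspose_conjTranspose]

/-- The Choi form at z is the integral of |⟨U^(⊗t), z⟩|². A continuous nonnegative function with
zero Haar integral vanishes everywhere. -/
theorem inner_tensorPow_eq_zero {z : Matrix (Copies n t) (Copies n t) ℂ}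
    (hz : choiMap (haarChannel n t) z = 0) {u : Matrix (Bits n) (Bits n) ℂ}
    (hu : u ∈ Matrix.unitaryGroup (Bits n) ℂ) : (inner ℂ (tensorPow t u) z : ℂ) = 0 := by
  obtain ⟨c, v, hc, rfl⟩ := exists_specialUnitary_smul hu
  set f : Matrix.specialUnitaryGroup (Bits n) ℂ → ℝ := fun U => ‖(inner ℂ (tensorPow t U.1) z : ℂ)‖ ^ 2
    with hf
  have hfc : Continuous f := ((continuous_inner_tensorPow_left z).norm).pow 2
  have h1 : ∫ U, f U ∂(haarSU (Bits n)) = 0 := by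
    have h2 := inner_choiMap_haarChannel z z
    rw [hz, inner_zero_right] at h2
    have h3 : ∀ U : Matrix.specialUnitaryGroup (Bits n) ℂ,
        (inner ℂ (tensorPow t U.1) z * inner ℂ z (tensorPow t U.1) : ℂ) = (f U : ℂ) := by
      intro U
      rw [← inner_conj_symm z, Complex.mul_conj, Complex.normSq_eq_norm_sq]
    simp only [h3] at h2
    have h4 : ∫ U, (f U : ℂ) ∂(haarSU (Bits n)) = ((∫ U, f U ∂(haarSU (Bits n)) : ℝ) : ℂ) :=
      integral_complex_ofReal
    rw [h4] at h2
    exact_mod_cast h2.symm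
  have h4 : f =ᵐ[haarSU (Bits n)] fun _ => 0 :=
    (integral_eq_zero_iff_of_nonneg (fun U => by positivity)
      (hfc.integrable_of_hasCompactSupport (HasCompactSupport.of_compactSpace f))).mp h1
  have h5 := (Continuous.ae_eq_iff_eq (haarSU (Bits n)) hfc continuous_const).mp h4
  have h6 := congrFun h5 v
  rw [tensorPow_smul, inner_smul_left]
  simp only [hf] at h6
  rw [norm_eq_zero.mp (pow_eq_zero_iff two_ne_zero |>.mp h6), mul_zero]

/-- Nonzero eigenvalues of the Choi form of the Haar twirl are not too small. -/
theorem choiMap_haarChannel_eigenvalue {lam : ℂ} (hlam : lam ≠ 0)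
    {b : Matrix (Copies n t) (Copies n t) ℂ} (hb : b ≠ 0)
    (hG : choiMap (haarChannel n t) b = lam • b) :
    ∃ s : ℝ, lam = s ∧ 1 ≤ (Fintype.card (Copies n t) : ℝ) ^ 2 * s := by
  set G := choiMap (haarChannel n t) with hGdef
  set K : Submodule ℂ (Matrix (Copies n t) (Copies n t) ℂ) := Module.End.eigenspace G lam with hK
  have hKmem : ∀ x, x ∈ K ↔ G x = lam • x := fun x => Module.End.mem_eigenspace_iff
  have hbK : b ∈ K := (hKmem b).mpr hG
  set r := Module.finrank ℂ K with hr
  set β : Fin r → Matrix (Copies n t) (Copies n t) ℂ := fun i => (stdOrthonormalBasis ℂ K i : _) with hβ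
  have hβK : ∀ i, β i ∈ K := fun i => (stdOrthonormalBasis ℂ K i).2
  have hβexp : ∀ k ∈ K, k = ∑ i, (inner ℂ (β i) k : ℂ) • β i := by
    intro k hk
    have := congrArg (Subtype.val) ((stdOrthonormalBasis ℂ K).sum_repr' ⟨k, hk⟩)
    simpa using this.symm
  have hβorth : Orthonormal ℂ β := (stdOrthonormalBasis ℂ K).orthonormal.comp_linearIsometry K.subtypeₗᵢ
  -- The orthogonal projection onto the eigenspace. It commutes with left multiplication by U^(⊗t),
  -- so its values on these operators are determined by `e = Q 1`.
  set Q : Matrix (Copies n t) (Copies n t) ℂ → Matrix (Copies n t) (Copies n t) ℂ :=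
    fun x => ∑ i, (inner ℂ (β i) x : ℂ) • β i with hQ
  have hQK : ∀ x, Q x ∈ K := fun x => Submodule.sum_mem _ fun i _ => Submodule.smul_mem _ _ (hβK i)
  have hQinner : ∀ k ∈ K, ∀ x, (inner ℂ k (Q x) : ℂ) = inner ℂ k x := by
    intro k hk x
    conv_rhs => rw [hβexp k hk]
    simp only [hQ, inner_sum, inner_smul_right, sum_inner, inner_smul_left, inner_conj_symm]
    exact Finset.sum_congr rfl fun i _ => mul_comm _ _
  have hQsymm : ∀ x y, (inner ℂ x (Q y) : ℂ) = inner ℂ (Q x) y := by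
    intro x y
    rw [← hQinner _ (hQK x) y, ← inner_conj_symm x, ← inner_conj_symm (Q x), hQinner _ (hQK y)]
  have hKeq : ∀ x ∈ K, ∀ y ∈ K, (∀ k ∈ K, (inner ℂ k x : ℂ) = inner ℂ k y) → x = y := by
    intro x hx y hy h
    rw [hβexp x hx, hβexp y hy]
    exact Finset.sum_congr rfl fun i _ => by rw [h _ (hβK i)]
  have hKmul : ∀ (v : Matrix.specialUnitaryGroup (Bits n) ℂ), ∀ x ∈ K, tensorPow t v.1 * x ∈ K := by
    intro v x hx
    rw [hKmem, hGdef, choiMap_haarChannel_mul, ← hGdef, (hKmem x).mp hx, Matrix.mul_smul]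
  have hKmul' : ∀ (v : Matrix.specialUnitaryGroup (Bits n) ℂ), ∀ x ∈ K,
      (tensorPow t v.1).conjTranspose * x ∈ K := by
    intro v x hx
    have : (tensorPow t v.1).conjTranspose = tensorPow t (v⁻¹).1 := by
      rw [← tensorPow_conjTranspose]; rfl
    rw [this]
    exact hKmul _ _ hx
  set e := Q 1 with he
  have hQu : ∀ v : Matrix.specialUnitaryGroup (Bits n) ℂ, Q (tensorPow t v.1) = tensorPow t v.1 * e := by
    intro v
    refine hKeq _ (hQK _) _ (hKmul v _ (hQK _)) fun k hk => ?_
    have h1 := inner_mul_left_matrix (tensorPow t v.1).conjTranspose k e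
    have h2 := inner_mul_left_matrix (tensorPow t v.1).conjTranspose k 1
    rw [Matrix.conjTranspose_conjTranspose] at h1 h2
    rw [hQinner k hk, ← h1, he, hQinner _ (hKmul' v k hk), h2, mul_one]
  -- Expanding the Choi form over U and using Q(U^(⊗t)) = U^(⊗t) e moves right multiplication by `e`
  -- onto `Q`, which fixes `k`.
  have hbe : ∀ k ∈ K, k * e = k := by
    intro k hk
    have h1 : G k = lam • k := (hKmem k).mp hk
    have h2 : lam • (k * e) = lam • k := by
      refine ext_inner_left ℂ fun y => ?_
      have h3 := inner_mul_right_matrix e.conjTranspose y (G k)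
      rw [Matrix.conjTranspose_conjTranspose] at h3
      rw [← Matrix.smul_mul, ← h1, ← h3, hGdef, inner_choiMap_haarChannel]
      have h4 : ∀ U : Matrix.specialUnitaryGroup (Bits n) ℂ,
          (inner ℂ (y * e.conjTranspose) (tensorPow t U.1) : ℂ) = inner ℂ (Q y) (tensorPow t U.1) := by
        intro U
        rw [inner_mul_right_matrix, Matrix.conjTranspose_conjTranspose, ← hQu, hQsymm]
      simp only [h4]
      rw [← inner_choiMap_haarChannel, ← hGdef, h1, inner_smul_right, inner_smul_right, ← inner_conj_symm (Q y),
        hQinner k hk, inner_conj_symm]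
    exact smul_right_injective _ hlam h2
  have he0 : e ≠ 0 := by
    intro h
    have := hbe b hbK
    rw [h, mul_zero] at this
    exact hb this.symm
  -- `e` is a nonzero idempotent and the Frobenius norm is submultiplicative.
  have hnorm : 1 ≤ ‖e‖ := by
    have h1 : ‖e‖ ≤ ‖e‖ * ‖e‖ := by
      conv_lhs => rw [← hbe e (hQK 1)]
      exact Matrix.frobenius_norm_mul e e
    exact le_of_mul_le_mul_right (by simpa using h1) (norm_pos_iff.mpr he0)
  have hQnorm : ∀ x, ((‖Q x‖ ^ 2 : ℝ) : ℂ) = ∑ i, (inner ℂ x (β i) * inner ℂ (β i) x : ℂ) := by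
    intro x
    have : ((‖Q x‖ ^ 2 : ℝ) : ℂ) = inner ℂ (Q x) (Q x) := by
      rw [inner_self_eq_norm_sq_to_K]; simp
    rw [this, hQinner _ (hQK x), ← hQsymm]
    simp only [hQ, inner_sum, inner_smul_right]
    exact Finset.sum_congr rfl fun i _ => mul_comm _ _
  -- The trace of the Choi form over the eigenspace is the Haar average of ‖Q(U^(⊗t))‖², which is
  -- constantly ‖e‖². With r ≤ d² this bounds the eigenvalue below.
  have htrace : (r : ℂ) * lam = ((‖e‖ ^ 2 : ℝ) : ℂ) := by
    have h1 : ∑ i, (inner ℂ (β i) (G (β i)) : ℂ) = r * lam := by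
      have : ∀ i, (inner ℂ (β i) (G (β i)) : ℂ) = lam := by
        intro i
        rw [(hKmem _).mp (hβK i), inner_smul_right, inner_self_eq_norm_sq_to_K, hβorth.1 i]
        simp
      simp [this]
    rw [← h1]
    simp only [hGdef, inner_choiMap_haarChannel]
    have hint : ∀ i ∈ Finset.univ, Integrable (fun U : Matrix.specialUnitaryGroup (Bits n) ℂ =>
        (inner ℂ (tensorPow t U.1) (β i) * inner ℂ (β i) (tensorPow t U.1) : ℂ)) (haarSU (Bits n)) :=
      fun i _ => integrable_haarSU
        ((continuous_inner_tensorPow_left _).mul (continuous_inner_tensorPow _))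
    rw [← integral_finsetSum _ hint]
    simp only [← hQnorm, hQu]
    have h2 : ∀ U : Matrix.specialUnitaryGroup (Bits n) ℂ, ‖tensorPow t U.1 * e‖ = ‖e‖ := by
      intro U
      rw [@norm_eq_sqrt_re_inner ℂ, @norm_eq_sqrt_re_inner ℂ _ _ _ _ e, inner_mul_left_matrix,
        ← mul_assoc, ← Matrix.star_eq_conjTranspose,
        Matrix.mem_unitaryGroup_iff'.mp (tensorPow_coe_mem_unitary t U), one_mul]
    simp [h2]
  have hr0 : (0 : ℝ) < r := by
    have : Nontrivial K := ⟨⟨⟨b, hbK⟩, 0, fun h => hb (congrArg Subtype.val h)⟩⟩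
    exact_mod_cast Module.finrank_pos (R := ℂ) (M := K)
  have hrle : (r : ℝ) ≤ (Fintype.card (Copies n t) : ℝ) ^ 2 := by
    have := Submodule.finrank_le K
    rw [Module.finrank_matrix, Module.finrank_self, mul_one] at this
    rw [sq]
    exact_mod_cast this
  refine ⟨‖e‖ ^ 2 / r, ?_, ?_⟩
  · have : (r : ℂ) ≠ 0 := by exact_mod_cast hr0.ne'
    push_cast at htrace ⊢
    rw [← htrace, mul_div_cancel_left₀ _ this]
  · rw [mul_div_assoc', le_div_iff₀ hr0, one_mul]
    exact hrle.trans (le_mul_of_one_le_right (by positivity) (one_le_pow₀ hnorm))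

end HaarChoi

/-! ### Comparison of the Choi forms -/

section Compare

variable {n t : ℕ}

theorem PreservesStar.add {a : Type} [Fintype a] [DecidableEq a] {D E : SuperOp a}
    (hD : PreservesStar D) (hE : PreservesStar E) : PreservesStar (D + E) := fun η => by
  rw [LinearMap.add_apply, LinearMap.add_apply, hD, hE, Matrix.conjTranspose_add]

theorem PreservesStar.sub {a : Type} [Fintype a] [DecidableEq a] {D E : SuperOp a}
    (hD : PreservesStar D) (hE : PreservesStar E) : PreservesStar (D - E) := fun η => by
  rw [LinearMap.sub_apply, LinearMap.sub_apply, hD, hE, Matrix.conjTranspose_sub]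

theorem PreservesStar.smul {a : Type} [Fintype a] [DecidableEq a] {D : SuperOp a}
    (hD : PreservesStar D) (r : ℝ) : PreservesStar ((r : ℂ) • D) := fun η => by
  rw [LinearMap.smul_apply, LinearMap.smul_apply, hD, Matrix.conjTranspose_smul]
  simp

theorem PreservesStar.pow {a : Type} [Fintype a] [DecidableEq a] {D : SuperOp a}
    (hD : PreservesStar D) (k : ℕ) : PreservesStar (D ^ k) := by
  induction k with
  | zero => exact fun η => rfl
  | succ k ih => exact fun η => by rw [pow_succ', Module.End.mul_apply, Module.End.mul_apply, ih, hD]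

theorem preservesStar_conjAction {ι : Type} [Fintype ι] [DecidableEq ι] (u : Matrix ι ι ℂ) :
    PreservesStar (conjAction t u) := fun η => by
  rw [conjAction_apply, conjAction_apply, Matrix.conjTranspose_mul, Matrix.conjTranspose_mul,
    Matrix.conjTranspose_conjTranspose, mul_assoc]

theorem preservesStar_pauliChannel : PreservesStar (pauliChannel n t) := fun η => by
  rw [pauliChannel_apply, pauliChannel_apply, Matrix.conjTranspose_smul, Matrix.conjTranspose_sum,
    star_inv₀, star_natCast]
  congr 1
  refine Finset.sum_congr rfl fun p _ => ?_
  rw [preservesStar_conjAction]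
  refine Eq.trans (congrArg (conjAction t (pauliFrame p.1)) ?_) (preservesStar_conjAction _ _)
  ext x y
  simp only [pauliMask, Matrix.of_apply, Matrix.conjTranspose_apply]
  split_ifs with h1 h2 h2
  · simp
  · exact absurd h1.symm h2
  · exact absurd h2.symm h1
  · simp

theorem preservesStar_haarChannel : PreservesStar (haarChannel n t) := fun η => by
  ext x y
  rw [Matrix.conjTranspose_apply, haarChannel_apply, haarChannel_apply, Complex.star_def,
    ← integral_conj]
  congr 1
  ext U
  rw [preservesStar_conjAction]
  rfl

/-- Composing with a conjugation conjugates the Choi form by left multiplication, which allows one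
step of the walk to be peeled off at a time. -/
theorem choiMap_conjAction_mul (u : Matrix (Bits n) (Bits n) ℂ) (F : SuperOp (Copies n t))
    (z : Matrix (Copies n t) (Copies n t) ℂ) :
    choiMap (conjAction t u * F) z =
      tensorPow t u * choiMap F ((tensorPow t u).conjTranspose * z) := by
  ext i k
  rw [Matrix.mul_apply]
  simp only [choiMap_apply, Module.End.mul_apply, conjAction_apply, Matrix.mul_apply,
    Finset.mul_sum, Finset.sum_mul]
  calc ∑ j, ∑ l, ∑ j', ∑ i', tensorPow t u i i' * F (Matrix.single k l 1) i' j' *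
        (tensorPow t u).conjTranspose j' j * z j l
      = ∑ j, ∑ i', ∑ j', ∑ l, tensorPow t u i i' * F (Matrix.single k l 1) i' j' *
        (tensorPow t u).conjTranspose j' j * z j l := by
        refine Finset.sum_congr rfl fun j _ => ?_
        rw [Finset.sum_comm]
        simp_rw [Finset.sum_comm (f := fun l i' => tensorPow t u i i' * F (Matrix.single k l 1) i' _ *
          (tensorPow t u).conjTranspose _ j * z j l)]
        rw [Finset.sum_comm]
    _ = ∑ i', ∑ j, ∑ j', ∑ l, tensorPow t u i i' * F (Matrix.single k l 1) i' j' *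
        (tensorPow t u).conjTranspose j' j * z j l := Finset.sum_comm
    _ = _ := by
        refine Finset.sum_congr rfl fun i' _ => ?_
        rw [Finset.sum_comm]
        refine Finset.sum_congr rfl fun j' _ => ?_
        rw [Finset.sum_comm]
        refine Finset.sum_congr rfl fun l _ => Finset.sum_congr rfl fun j _ => ?_
        ring

theorem pauliChannel_eq_average (η : Matrix (Copies n t) (Copies n t) ℂ) (x y : Copies n t) :
    pauliChannel n t η x y = (Fintype.card (PauliLabel n) : ℂ)⁻¹ * ∑ p : PauliLabel n,
      (2 * Real.pi : ℂ)⁻¹ * ∫ θ in (-Real.pi)..Real.pi, conjAction t (pauliRotation p θ) η x y := by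
  simp only [conjAction_apply, ← tensorPow_conjTranspose, ← pauliRotation_neg]
  rfl

theorem continuous_conjAction_pauliRotation (p : PauliLabel n)
    (η : Matrix (Copies n t) (Copies n t) ℂ) (x y : Copies n t) :
    Continuous fun θ => conjAction t (pauliRotation p θ) η x y := by
  simp only [conjAction_apply, ← tensorPow_conjTranspose, ← pauliRotation_neg]
  exact (continuous_copiesRotation p η).matrix_elem x y

theorem choiMap_pauliChannel_mul (F : SuperOp (Copies n t)) (z : Matrix (Copies n t) (Copies n t) ℂ)
    (i k : Copies n t) :
    choiMap (pauliChannel n t * F) z i k = (Fintype.card (PauliLabel n) : ℂ)⁻¹ *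
      ∑ p : PauliLabel n, (2 * Real.pi : ℂ)⁻¹ * ∫ θ in (-Real.pi)..Real.pi,
        choiMap (conjAction t (pauliRotation p θ) * F) z i k := by
  have hc : ∀ (p : PauliLabel n) (l j : Copies n t), Continuous fun θ =>
      conjAction t (pauliRotation p θ) (F (Matrix.single k l 1)) i j :=
    fun p l j => continuous_conjAction_pauliRotation p _ i j
  have h1 : ∀ p : PauliLabel n, ∫ θ in (-Real.pi)..Real.pi,
        choiMap (conjAction t (pauliRotation p θ) * F) z i k =
      ∑ j, ∑ l, (∫ θ in (-Real.pi)..Real.pi,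
        conjAction t (pauliRotation p θ) (F (Matrix.single k l 1)) i j) * z j l := by
    intro p
    simp only [choiMap_apply, Module.End.mul_apply]
    rw [intervalIntegral.integral_finsetSum
      fun j _ => Continuous.intervalIntegrable (by fun_prop) _ _]
    refine Finset.sum_congr rfl fun j _ => ?_
    rw [intervalIntegral.integral_finsetSum
      fun l _ => Continuous.intervalIntegrable (by fun_prop) _ _]
    simp
  simp only [h1]
  rw [choiMap_apply]
  simp only [Module.End.mul_apply, pauliChannel_eq_average, Finset.mul_sum, Finset.sum_mul]
  calc ∑ j, ∑ l, ∑ p : PauliLabel n, _ = ∑ j, ∑ p : PauliLabel n, ∑ l, _ :=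
        Finset.sum_congr rfl fun j _ => Finset.sum_comm
    _ = ∑ p : PauliLabel n, ∑ j, ∑ l, _ := Finset.sum_comm
    _ = _ := by
        refine Finset.sum_congr rfl fun p _ => Finset.sum_congr rfl fun j _ =>
          Finset.sum_congr rfl fun l _ => ?_
        ring

attribute [local instance] Matrix.frobeniusNormedAddCommGroup Matrix.frobeniusNormedSpace
  frobeniusInnerProductSpace

/-- The Choi form of the walk averages rank-one forms of vectors u^(⊗t). In the induction each
rotation moves `z` to another vector orthogonal to all u^(⊗t), so the hypothesis has to range over
the whole unitary group. -/
theorem choiMap_pauliChannel_pow_eq_zero (k : ℕ) {z : Matrix (Copies n t) (Copies n t) ℂ}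
    (hz : ∀ u ∈ Matrix.unitaryGroup (Bits n) ℂ, (inner ℂ (tensorPow t u) z : ℂ) = 0) :
    choiMap (pauliChannel n t ^ k) z = 0 := by
  induction k generalizing z with
  | zero =>
    have h := hz 1 (Submonoid.one_mem _)
    rw [tensorPow_one, inner_matrix_eq_trace, Matrix.conjTranspose_one, one_mul] at h
    rw [pow_zero, choiMap_one, h, zero_smul]
  | succ k ih =>
    ext i j
    rw [pow_succ', choiMap_pauliChannel_mul]
    have h : ∀ (p : PauliLabel n) (θ : ℝ),
        choiMap (conjAction t (pauliRotation p θ) * pauliChannel n t ^ k) z = 0 := by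
      intro p θ
      rw [choiMap_conjAction_mul, ih, mul_zero]
      intro u hu
      rw [← inner_mul_left_matrix, ← tensorPow_mul]
      exact hz _ (Submonoid.mul_mem _ (pauliRotation_mem_unitary p θ) hu)
    simp [h]

/-- Split z into its parts z0 in the kernel of the twirl's Choi form and z1 orthogonal to it. The
difference form J kills z0, so |⟨z, Jz⟩| ≤ dκ‖z1‖², and the eigenvalue bound d⁻² on z1 turns ‖z1‖²
into at most d² times the twirl's form. -/
theorem inner_choiMap_sub_le {k : ℕ} {κ ε : ℝ} (hκ : 0 ≤ κ)
    (hD : ∀ η, ‖(pauliChannel n t ^ k - haarChannel n t) η‖ ≤ κ * ‖η‖)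
    (hε : (Fintype.card (Copies n t) : ℝ) ^ 3 * κ ≤ ε) (z : Matrix (Copies n t) (Copies n t) ℂ) :
    ∃ h δ : ℝ, (inner ℂ z (choiMap (haarChannel n t) z) : ℂ) = h ∧
      (inner ℂ z (choiMap (pauliChannel n t ^ k - haarChannel n t) z) : ℂ) = δ ∧ |δ| ≤ ε * h := by
  set d : ℝ := ((Fintype.card (Copies n t) : ℕ) : ℝ) with hd
  set G := choiMap (haarChannel n t) with hG
  set J := choiMap (pauliChannel n t ^ k - haarChannel n t) with hJ
  have hJsymm : J.IsSymmetric :=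
    ((preservesStar_pauliChannel.pow k).sub preservesStar_haarChannel).choiMap_isSymmetric
  -- The operator is paired with itself, since only an eigenbasis of this one form is needed.
  obtain ⟨r, v, lam, β, hv⟩ := exists_joint_eigenbasis (choiMap_haarChannel_isSymmetric (n := n) (t := t))
    choiMap_haarChannel_isSymmetric (Commute.refl _)
  replace hv : ∀ i, G (v i) = lam i • v i := fun i => (hv i).1
  have hs : ∀ i, lam i = ((lam i).re : ℂ) ∧ 0 ≤ (lam i).re ∧ (lam i ≠ 0 → 1 ≤ d ^ 2 * (lam i).re) := by
    intro i
    by_cases h : lam i = 0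
    · simp [h]
    · obtain ⟨s, hs, h1⟩ := choiMap_haarChannel_eigenvalue h (v.orthonormal.ne_zero i) (hv i)
      rw [hs]
      refine ⟨by simp, ?_, fun _ => by rw [Complex.ofReal_re]; exact h1⟩
      rw [Complex.ofReal_re]
      by_contra hneg
      push Not at hneg
      nlinarith [sq_nonneg d]
  set c : Fin r → ℂ := fun i => inner ℂ (v i) z with hc
  have hz : z = ∑ i, c i • v i := (v.sum_repr' z).symm
  set z1 := ∑ i, (if lam i = 0 then 0 else c i) • v i with hz1
  set z0 := ∑ i, (if lam i = 0 then c i else 0) • v i with hz0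
  have hz01 : z = z0 + z1 := by
    rw [hz, hz0, hz1, ← Finset.sum_add_distrib]
    refine Finset.sum_congr rfl fun i _ => ?_
    split_ifs <;> simp
  have hGz0 : G z0 = 0 := by
    rw [hz0, map_sum]
    refine Finset.sum_eq_zero fun i _ => ?_
    rw [map_smul, hv]
    split_ifs with h <;> simp [h]
  have hJz0 : J z0 = 0 := by
    rw [hJ, choiMap_sub, LinearMap.sub_apply, ← hG, hGz0, sub_zero]
    exact choiMap_pauliChannel_pow_eq_zero k fun u hu => inner_tensorPow_eq_zero hGz0 hu
  have hJz : J z = J z1 := by rw [hz01, map_add, hJz0, zero_add]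
  have hinner : (inner ℂ z (J z) : ℂ) = inner ℂ z1 (J z1) := by
    rw [hJz, ← hJsymm, hJz, hJsymm]
  have hreal : ((inner ℂ z (J z) : ℂ).re : ℂ) = inner ℂ z (J z) := by
    have := hJsymm z z
    rw [← inner_conj_symm] at this
    exact Complex.conj_eq_iff_re.mp this
  have hn1 : ‖z1‖ ^ 2 = ∑ i, ‖(if lam i = 0 then 0 else c i)‖ ^ 2 := by
    rw [← v.sum_sq_norm_inner_right]
    refine Finset.sum_congr rfl fun i _ => ?_
    rw [hz1, v.orthonormal.inner_right_fintype]
  refine ⟨∑ i, (lam i).re * ‖c i‖ ^ 2, (inner ℂ z (J z) : ℂ).re, ?_, hreal.symm, ?_⟩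
  · have h1 : G z = ∑ i, (lam i * c i) • v i := by
      conv_lhs => rw [hz]
      rw [map_sum]
      refine Finset.sum_congr rfl fun i _ => ?_
      rw [map_smul, hv, smul_smul, mul_comm]
    rw [h1, inner_sum]
    push_cast
    refine Finset.sum_congr rfl fun i _ => ?_
    rw [inner_smul_right, ← inner_conj_symm z, mul_assoc, Complex.mul_conj,
      Complex.normSq_eq_norm_sq, ← (hs i).1]
    push_cast
    rfl
  · have h1 : |(inner ℂ z (J z) : ℂ).re| ≤ d * κ * ‖z1‖ ^ 2 := by
      refine (Complex.abs_re_le_norm _).trans ?_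
      rw [hinner]
      refine (norm_inner_le_norm _ _).trans ?_
      have := norm_choiMap_le hκ hD z1
      nlinarith [norm_nonneg z1]
    have h2 : ‖z1‖ ^ 2 ≤ d ^ 2 * ∑ i, (lam i).re * ‖c i‖ ^ 2 := by
      rw [hn1, Finset.mul_sum]
      refine Finset.sum_le_sum fun i _ => ?_
      split_ifs with h
      · simp [h]
      · rw [← mul_assoc]
        exact le_mul_of_one_le_left (sq_nonneg _) ((hs i).2.2 h)
    have h3 : 0 ≤ ∑ i, (lam i).re * ‖c i‖ ^ 2 :=
      Finset.sum_nonneg fun i _ => mul_nonneg (hs i).2.1 (sq_nonneg _)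
    have hd0 : 0 ≤ d := Nat.cast_nonneg _
    calc |(inner ℂ z (J z) : ℂ).re| ≤ d * κ * (d ^ 2 * ∑ i, (lam i).re * ‖c i‖ ^ 2) :=
          h1.trans (mul_le_mul_of_nonneg_left h2 (by positivity))
      _ = d ^ 3 * κ * ∑ i, (lam i).re * ‖c i‖ ^ 2 := by ring
      _ ≤ _ := mul_le_mul_of_nonneg_right hε h3

theorem cple_of_norm_le {k : ℕ} {κ ε : ℝ} (hκ : 0 ≤ κ)
    (hD : ∀ η, ‖(pauliChannel n t ^ k - haarChannel n t) η‖ ≤ κ * ‖η‖)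
    (hε : (Fintype.card (Copies n t) : ℝ) ^ 3 * κ ≤ ε) :
    CPLE (((1 - ε : ℝ) : ℂ) • haarChannel n t) (pauliChannel n t ^ k) ∧
      CPLE (pauliChannel n t ^ k) (((1 + ε : ℝ) : ℂ) • haarChannel n t) := by
  have hC := (preservesStar_pauliChannel (n := n) (t := t)).pow k
  have hH := preservesStar_haarChannel (n := n) (t := t)
  constructor
  · have e : pauliChannel n t ^ k - ((1 - ε : ℝ) : ℂ) • haarChannel n t =
        (pauliChannel n t ^ k - haarChannel n t) + (ε : ℂ) • haarChannel n t := by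
      push_cast; module
    rw [CPLE, e]
    refine ((hC.sub hH).add (hH.smul ε)).isCompletelyPositive fun z => ?_
    obtain ⟨h, δ, h1, h2, h3⟩ := inner_choiMap_sub_le hκ hD hε z
    rw [choiMap_add, choiMap_smul, LinearMap.add_apply, LinearMap.smul_apply, inner_add_right,
      inner_smul_right, h1, h2]
    have : 0 ≤ δ + ε * h := by linarith [neg_abs_le δ]
    exact_mod_cast this
  · have e : ((1 + ε : ℝ) : ℂ) • haarChannel n t - pauliChannel n t ^ k =
        (ε : ℂ) • haarChannel n t - (pauliChannel n t ^ k - haarChannel n t) := by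
      push_cast; module
    rw [CPLE, e]
    refine ((hH.smul ε).sub (hC.sub hH)).isCompletelyPositive fun z => ?_
    obtain ⟨h, δ, h1, h2, h3⟩ := inner_choiMap_sub_le hκ hD hε z
    rw [choiMap_sub, choiMap_smul, LinearMap.sub_apply, LinearMap.smul_apply, inner_sub_right,
      inner_smul_right, h1, h2]
    have : 0 ≤ ε * h - δ := by linarith [le_abs_self δ]
    exact_mod_cast this

/-! ### From the gap to the number of steps. -/

theorem pow_mul_gap_pow_le {c ε : ℝ} (hc : 0 < c) (hε : 0 < ε) {n t k : ℕ} (ht : 1 ≤ t)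
    (h : (4 * Real.log c) * n * (t : ℝ) ^ 2 + 4 * t * Real.log (1 / ε) ≤ (k : ℝ)) :
    c ^ (n * t) * (1 - 1 / (4 * t : ℝ)) ^ k ≤ ε := by
  have ht' : (1 : ℝ) ≤ t := by exact_mod_cast ht
  have ht0 : (0 : ℝ) < 4 * t := by linarith
  have hq : (0 : ℝ) ≤ 1 - 1 / (4 * t : ℝ) := by
    rw [sub_nonneg, div_le_one ht0]
    linarith
  have h1 : (1 - 1 / (4 * t : ℝ)) ^ k ≤ Real.exp (-(k / (4 * t))) := by
    calc (1 - 1 / (4 * t : ℝ)) ^ k ≤ Real.exp (-(1 / (4 * t))) ^ k := by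
          gcongr
          exact Real.one_sub_le_exp_neg _
      _ = _ := by rw [← Real.exp_nat_mul]; congr 1; ring
  have h2 : c ^ (n * t) = Real.exp (n * t * Real.log c) := by
    rw [← Real.exp_log (pow_pos hc _), Real.log_pow]
    push_cast; rfl
  rw [one_div, Real.log_inv] at h
  have h3 : n * t * Real.log c - Real.log ε ≤ k / (4 * t) := by
    rw [le_div_iff₀ ht0]
    linarith
  calc c ^ (n * t) * (1 - 1 / (4 * t : ℝ)) ^ k
      ≤ Real.exp (n * t * Real.log c) * Real.exp (-(k / (4 * t))) := by rw [h2]; gcongr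
    _ = Real.exp (n * t * Real.log c - k / (4 * t)) := by rw [← Real.exp_add]; rfl
    _ ≤ Real.exp (Real.log ε) := Real.exp_le_exp.mpr (by linarith)
    _ = ε := Real.exp_log hε

theorem card_copies (n t : ℕ) : (Fintype.card (Copies n t) : ℝ) = 2 ^ (n * t) := by
  simp [pow_mul]

theorem gap_pow_nonneg {t : ℕ} (ht : 1 ≤ t) (k : ℕ) : 0 ≤ (1 - 1 / (4 * t : ℝ)) ^ k := by
  have ht' : (1 : ℝ) ≤ t := by exact_mod_cast ht
  refine pow_nonneg ?_ _
  rw [sub_nonneg, div_le_one (by linarith)]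
  linarith

theorem diamondNorm_pauliChannel_pow_sub_le {n t k : ℕ} (hn : 1 ≤ n) (ht : 1 ≤ t) {ε : ℝ} (hε : 0 < ε)
    (h : (4 * Real.log 2) * n * (t : ℝ) ^ 2 + 4 * t * Real.log (1 / ε) ≤ (k : ℝ)) :
    diamondNorm (pauliChannel n t ^ k - haarChannel n t) ≤ ENNReal.ofReal ε := by
  refine (diamondNorm_le (gap_pow_nonneg ht k)
    (norm_pauliChannel_pow_sub_haarChannel_le hn ht k)).trans (ENNReal.ofReal_le_ofReal ?_)
  rw [card_copies]
  exact pow_mul_gap_pow_le two_pos hε ht h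

theorem cple_pauliChannel_pow {n t k : ℕ} (hn : 1 ≤ n) (ht : 1 ≤ t) {ε : ℝ} (hε : 0 < ε)
    (h : (4 * Real.log 8) * n * (t : ℝ) ^ 2 + 4 * t * Real.log (1 / ε) ≤ (k : ℝ)) :
    CPLE (((1 - ε : ℝ) : ℂ) • haarChannel n t) (pauliChannel n t ^ k) ∧
      CPLE (pauliChannel n t ^ k) (((1 + ε : ℝ) : ℂ) • haarChannel n t) := by
  refine cple_of_norm_le (gap_pow_nonneg ht k) (norm_pauliChannel_pow_sub_haarChannel_le hn ht k) ?_
  have e : (2 ^ (n * t) : ℝ) ^ 3 = 8 ^ (n * t) := by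
    rw [← pow_mul, mul_comm, pow_mul]
    norm_num
  rw [card_copies, e]
  exact pow_mul_gap_pow_le (by norm_num) hε ht h

end Compare

/-! ### Circuits for products of Pauli rotations -/

section Circuits

variable {n : ℕ}

/-- The sign of the parity of the bits of `x` at the positions in `l`. -/
def paritySign (l : List (Fin n)) (x : Bits n) : ℤ := (l.map fun j => bitSign 3 (x j)).prod

theorem paritySign_cons (a : Fin n) (l : List (Fin n)) (x : Bits n) :
    paritySign (a :: l) x = bitSign 3 (x a) * paritySign l x := List.prod_cons

theorem paritySign_update {l : List (Fin n)} {q : Fin n} (hq : q ∉ l) (x : Bits n) (b : Fin 2) :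
    paritySign l (Function.update x q b) = paritySign l x := by
  unfold paritySign
  congr 1
  refine List.map_congr_left fun j hj => ?_
  rw [Function.update_of_ne (ne_of_mem_of_not_mem hj hq)]

theorem bitSign_add (a b : Fin 2) : bitSign 3 (a + b) = bitSign 3 a * bitSign 3 b := by
  fin_cases a <;> fin_cases b <;> rfl

/-- The CNOT is an involutive permutation of the basis, so conjugation substitutes its action into
the diagonal. -/
theorem cnot_mul_diagonal_mul_cnot {c q : Fin n} (h : c ≠ q) (g : Bits n → ℂ) :
    (Gate.cnot c q h).matrix * Matrix.diagonal g * (Gate.cnot c q h).matrix =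
      Matrix.diagonal fun x => g (Function.update x q (x q + x c)) := by
  have hf (x : Bits n) : Function.update (Function.update x q (x q + x c)) q
      (Function.update x q (x q + x c) q + Function.update x q (x q + x c) c) = x := by
    have h2 : ∀ a b : Fin 2, a + b + b = a := by decide
    rw [Function.update_self, Function.update_of_ne h, h2, Function.update_idem,
      Function.update_eq_self]
  ext x y
  rw [Matrix.mul_apply]
  simp only [Matrix.mul_diagonal, Gate.matrix, Matrix.of_apply]
  rw [Finset.sum_eq_single (Function.update y q (y q + y c))]
  · simp only [if_true, mul_one, hf]
    by_cases hxy : x = y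
    · subst hxy; simp
    · simp [hxy]
  · intro z _ hz
    simp [hz]
  · simp

/-- A layer of CNOT gates halves the number of bits whose parity is to be computed. -/
theorem exists_cnot_layer (F : ℤ → ℂ) (l : List (Fin n)) (hl : l.Nodup) :
    ∃ (L : List (Gate n)) (k : List (Fin n)),
      (L.Pairwise fun g h => Disjoint g.support h.support) ∧
      (∀ g ∈ L, ∀ j ∈ g.support, j ∈ l) ∧ k.Sublist l ∧ l.length ≤ 2 * k.length ∧ 2 * k.length ≤ l.length + 1 ∧
      L.length + k.length = l.length ∧
      -- The bits in `pre` are the targets already set aside by earlier pairs; carrying them along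
      -- makes the induction close.
      ∀ pre : List (Fin n), pre.Disjoint l →
        (L.map Gate.matrix).prod *
            Matrix.diagonal (fun x => F (paritySign pre x * paritySign k x)) *
            (L.reverse.map Gate.matrix).prod =
          Matrix.diagonal fun x => F (paritySign pre x * paritySign l x) := by
  match l, hl with
  | [], _ => exact ⟨[], [], by simp⟩
  | [a], _ => exact ⟨[], [a], by simp⟩
  | a :: b :: l, hl =>
    have hab : b ≠ a := by rintro rfl; simp at hl
    have hal : a ∉ l := by simp at hl; tauto
    have hbl : b ∉ l := by simp at hl; tauto
    obtain ⟨L, k, hL, hLl, hk, hle, hlen, hsum, hmat⟩ :=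
      exists_cnot_layer F l (by simp at hl; tauto)
    refine ⟨.cnot b a hab :: L, a :: k, ?_, ?_, ?_, ?_, ?_, ?_, ?_⟩
    · refine List.pairwise_cons.mpr ⟨fun g hg => ?_, hL⟩
      rw [Finset.disjoint_left]
      intro j hj hjg
      simp only [Gate.support, Finset.mem_insert, Finset.mem_singleton] at hj
      rcases hj with rfl | rfl
      · exact hbl (hLl g hg _ hjg)
      · exact hal (hLl g hg _ hjg)
    · intro g hg j hj
      rcases List.mem_cons.mp hg with rfl | hg
      · simp only [Gate.support, Finset.mem_insert, Finset.mem_singleton] at hj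
        rcases hj with rfl | rfl <;> simp
      · simp [hLl g hg j hj]
    · exact (hk.cons b).cons_cons a
    · simp only [List.length_cons]; omega
    · simp only [List.length_cons]; omega
    · simp only [List.length_cons]; omega
    · intro pre hpre
      have hapre : a ∉ pre := fun h => hpre h (by simp)
      -- The target `a` joins the prefix, and the outer CNOT then replaces its sign by the product
      -- of the signs of `a` and `b`.
      have h1 := hmat (a :: pre) (by
        intro j hj hjl
        rcases List.mem_cons.mp hj with rfl | hj
        · exact hal hjl
        · exact hpre hj (by simp [hjl]))
      have h2 : (fun x => F (paritySign pre x * paritySign (a :: k) x)) =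
          fun x => F (paritySign (a :: pre) x * paritySign k x) := by
        ext x
        rw [paritySign_cons, paritySign_cons]
        congr 1; ring
      rw [h2, List.reverse_cons, List.map_append, List.prod_append, List.map_cons, List.prod_cons,
        List.map_singleton, List.prod_singleton]
      have h3 (A B D E : Matrix (Bits n) (Bits n) ℂ) :
          A * B * D * (E * A) = A * (B * D * E) * A := by
        simp only [mul_assoc]
      rw [h3, h1, cnot_mul_diagonal_mul_cnot]
      congr 1
      ext x
      simp only [paritySign_cons, paritySign_update hapre, paritySign_update hal, Function.update_self,
        bitSign_add]
      congr 1; ring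

/-- Each halving wraps the smaller circuit in a CNOT layer and its reverse. Removing one bit costs
two CNOTs and the last bit one phase gate, so there are at most 2|l| - 1 gates and 2r + 1 layers. -/
theorem exists_parity_circuit (θ : ℝ) (r : ℕ) (l : List (Fin n)) (hl : l.Nodup) (hne : l ≠ [])
    (hr : l.length ≤ 2 ^ r) :
    ∃ c : Circuit n, c.matrix =
        Matrix.diagonal (fun x => Complex.exp (Complex.I * θ / 2 * paritySign l x)) ∧
      c.size + 1 ≤ 2 * l.length ∧ c.depth ≤ 2 * r + 1 := by
  induction r generalizing l with
  | zero =>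
    obtain ⟨a, rfl⟩ : ∃ a, l = [a] := by
      refine List.length_eq_one_iff.mp ?_
      have := List.length_pos_of_ne_nil hne
      simp at hr; omega
    refine ⟨⟨[[.single a ⟨_, diagonal_exp_mem_unitary θ (bitSign 3)⟩]], by simp⟩, ?_, ?_, ?_⟩
    · simp only [Circuit.matrix, List.map_cons, List.map_nil, List.prod_cons, List.prod_nil, mul_one,
        List.reverse_singleton, Gate.matrix]
      refine (site_diagonal a _).trans ?_
      simp [paritySign]
    · simp [Circuit.size]
    · simp [Circuit.depth]
  | succ r ih =>
    obtain ⟨L, k, hL, -, hk, hle, hlen, hsum, hmat⟩ :=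
      exists_cnot_layer (fun s => Complex.exp (Complex.I * θ / 2 * s)) l hl
    have hl0 := List.length_pos_of_ne_nil hne
    have hkne : k ≠ [] := by
      rintro rfl
      simp only [List.length_nil] at hle
      omega
    obtain ⟨c, hc, hsize, hdepth⟩ := ih k (hk.nodup hl) hkne (by rw [pow_succ] at hr; omega)
    refine ⟨⟨[L.reverse] ++ c.layers ++ [L], ?_⟩, ?_, ?_, ?_⟩
    · intro m hm
      simp only [List.mem_append, List.mem_singleton] at hm
      rcases hm with (rfl | hm) | rfl
      · exact List.pairwise_reverse.mpr (hL.imp fun h => h.symm)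
      · exact c.disjoint m hm
      · exact hL
    · have h := hmat [] (by simp)
      simp only [paritySign, List.map_nil, List.prod_nil, one_mul] at h
      simp only [Circuit.matrix] at hc ⊢
      simp only [List.map_append, List.map_singleton, List.reverse_append, List.reverse_singleton,
        List.prod_append, List.prod_singleton, hc]
      rw [← mul_assoc]
      exact h
    · simp only [Circuit.size] at hsize ⊢
      simp only [List.map_append, List.map_singleton, List.sum_append, List.sum_singleton,
        List.length_reverse]
      omega
    · simp only [Circuit.depth] at hdepth ⊢
      simp only [List.length_append, List.length_singleton]
      omega

theorem prod_single_gates (v : Fin n → Matrix.unitaryGroup (Fin 2) ℂ) (l : List (Fin n))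
    (hl : l.Nodup) : ((l.map fun q => Gate.single q (v q)).map Gate.matrix).prod =
      tensor fun j => if j ∈ l then (v j).1 else 1 := by
  induction l with
  | nil => simp [tensor_one]
  | cons a l ih =>
    obtain ⟨ha, hl⟩ := List.nodup_cons.mp hl
    rw [List.map_cons, List.map_cons, List.prod_cons, ih hl, Gate.matrix, tensor_mul]
    congr 1
    ext1 j
    by_cases h : j = a
    · subst h; simp [ha]
    · simp [h]

/-- The layer applying `v q` to each qubit `q`. -/
def localLayer (v : Fin n → Matrix.unitaryGroup (Fin 2) ℂ) : List (Gate n) :=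
  (List.finRange n).map fun q => Gate.single q (v q)

theorem localLayer_matrix (v : Fin n → Matrix.unitaryGroup (Fin 2) ℂ) :
    ((localLayer v).map Gate.matrix).prod = tensor fun j => (v j).1 := by
  rw [localLayer, prod_single_gates v _ (List.nodup_finRange n)]
  simp

theorem localLayer_pairwise (v : Fin n → Matrix.unitaryGroup (Fin 2) ℂ) :
    (localLayer v).Pairwise fun g h => Disjoint g.support h.support := by
  rw [localLayer, List.pairwise_map]
  exact (List.nodup_finRange n).imp fun h => by simpa [Gate.support] using h

theorem pauliSign_eq_paritySign (p : Fin n → Fin 4) (x : Bits n) :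
    pauliSign p x = paritySign ((Finset.univ.filter fun j => p j ≠ 0).toList) x := by
  rw [paritySign, Finset.prod_map_toList, Finset.prod_filter, pauliSign]
  refine Finset.prod_congr rfl fun j _ => ?_
  by_cases h : p j = 0 <;> simp [bitSign, h]

/-- The two frame layers use 2n gates and the parity circuit fewer than 2n; they add two layers to
its depth. -/
theorem exists_pauliRotation_circuit (p : PauliLabel n) (θ : ℝ) :
    ∃ c : Circuit n, c.matrix = pauliRotation p θ ∧ c.size ≤ 4 * n ∧
      c.depth ≤ 2 * Nat.clog 2 n + 3 := by
  set S := Finset.univ.filter fun j => p.1 j ≠ 0 with hS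
  have hSn : S.toList.length ≤ n := by
    rw [Finset.length_toList]
    exact (Finset.card_le_univ S).trans_eq (Fintype.card_fin n)
  obtain ⟨j, hj⟩ := Function.ne_iff.mp p.2
  have hne : S.toList ≠ [] :=
    List.ne_nil_of_mem (Finset.mem_toList.mpr (Finset.mem_filter.mpr ⟨Finset.mem_univ j, hj⟩))
  obtain ⟨c, hc, hsize, hdepth⟩ := exists_parity_circuit θ (Nat.clog 2 n) S.toList S.nodup_toList hne
    (hSn.trans (Nat.le_pow_clog (by norm_num) n))
  set v : Fin n → Matrix.unitaryGroup (Fin 2) ℂ := fun j => ⟨_, bitFrame_mem_unitary (p.1 j)⟩ with hv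
  refine ⟨⟨[localLayer fun j => star (v j)] ++ c.layers ++ [localLayer v], ?_⟩, ?_, ?_, ?_⟩
  · intro m hm
    simp only [List.mem_append, List.mem_singleton] at hm
    rcases hm with (rfl | hm) | rfl
    · exact localLayer_pairwise _
    · exact c.disjoint m hm
    · exact localLayer_pairwise _
  · simp only [Circuit.matrix] at hc ⊢
    simp only [List.map_append, List.map_singleton, List.reverse_append, List.reverse_singleton,
      List.prod_append, List.prod_singleton, hc, localLayer_matrix]
    rw [pauliRotation_eq, pauliFrame, tensor_conjTranspose, mul_assoc]
    simp only [pauliSign_eq_paritySign]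
    rfl
  · simp only [Circuit.size] at hsize ⊢
    simp only [List.map_append, List.map_singleton, List.sum_append, List.sum_singleton, localLayer,
      List.length_map, List.length_finRange]
    omega
  · simp only [Circuit.depth] at hdepth ⊢
    simp only [List.length_append, List.length_singleton]
    omega

theorem exists_circuit_list_prod {s d : ℕ} (l : List (Matrix (Bits n) (Bits n) ℂ))
    (h : ∀ A ∈ l, ∃ c : Circuit n, c.matrix = A ∧ c.size ≤ s ∧ c.depth ≤ d) :
    ∃ c : Circuit n, c.matrix = l.reverse.prod ∧ c.size ≤ l.length * s ∧
      c.depth ≤ l.length * d := by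
  induction l with
  | nil => exact ⟨⟨[], by simp⟩, by simp [Circuit.matrix], by simp [Circuit.size],
      by simp [Circuit.depth]⟩
  | cons A l ih =>
    obtain ⟨c, hc, hs, hd⟩ := ih fun B hB => h B (List.mem_cons_of_mem A hB)
    obtain ⟨c', hc', hs', hd'⟩ := h A List.mem_cons_self
    refine ⟨⟨c'.layers ++ c.layers, ?_⟩, ?_, ?_, ?_⟩
    · intro m hm
      exact (List.mem_append.mp hm).elim (c'.disjoint m) (c.disjoint m)
    · simp only [Circuit.matrix] at hc hc' ⊢
      simp [hc, hc']
    · simp only [Circuit.size] at hs hs' ⊢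
      simp only [List.map_append, List.sum_append, List.length_cons, Nat.succ_mul]
      omega
    · simp only [Circuit.depth] at hd hd' ⊢
      simp only [List.length_append, List.length_cons, Nat.succ_mul]
      omega

theorem two_mul_clog_add_three_le (hn : 1 ≤ n) :
    ((2 * Nat.clog 2 n + 3 : ℕ) : ℝ) ≤ 8 * max 1 (Real.log n) := by
  have h1 := le_max_left 1 (Real.log n)
  have h2 := le_max_right 1 (Real.log n)
  rcases hn.eq_or_lt with rfl | hn
  -- For n = 1 the ceiling logarithm is 0 and its predecessor bound is unavailable.
  · simp; norm_num
  have hlt := Nat.pow_pred_clog_lt_self (b := 2) (by norm_num) (x := n) hn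
  have h3 : ((Nat.clog 2 n : ℝ) - 1) * Real.log 2 ≤ Real.log n := by
    have hpos : 1 ≤ Nat.clog 2 n := Nat.clog_pos (by norm_num) hn
    have h4 : ((2 : ℝ) ^ (Nat.clog 2 n).pred) ≤ n := by exact_mod_cast hlt.le
    have h5 := Real.log_le_log (by positivity) h4
    rw [Real.log_pow, Nat.pred_eq_sub_one, Nat.cast_sub hpos] at h5
    simpa using h5
  -- Only log 2 > 2/3 matters. The depth is then at most 5 + 3 log n, which is at most 8 max(1, log
  -- n).
  have h6 := Real.log_two_gt_d9
  have h7 : (0 : ℝ) ≤ Real.log n := Real.log_nonneg (by exact_mod_cast hn.le)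
  have h8 : (Nat.clog 2 n : ℝ) - 1 ≤ 3 / 2 * Real.log n := by
    by_contra hcon
    push Not at hcon
    nlinarith
  push_cast
  linarith

theorem exists_rotationProduct_circuit {k : ℕ} (hn : 1 ≤ n) (P : Fin k → PauliLabel n)
    (θ : Fin k → ℝ) :
    ∃ c : Circuit n, c.matrix = rotationProduct P θ ∧ (c.size : ℝ) ≤ 8 * (k * n) ∧
      (c.depth : ℝ) ≤ 8 * (k * max 1 (Real.log n)) := by
  obtain ⟨c, hc, hs, hd⟩ := exists_circuit_list_prod
    (List.ofFn fun j => pauliRotation (P j) (θ j)) (s := 4 * n) (d := 2 * Nat.clog 2 n + 3) (by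
      intro A hA
      obtain ⟨j, rfl⟩ := List.mem_ofFn.mp hA
      exact exists_pauliRotation_circuit (P j) (θ j))
  rw [List.length_ofFn] at hs hd
  refine ⟨c, hc, ?_, ?_⟩
  · calc (c.size : ℝ) ≤ ((k * (4 * n) : ℕ) : ℝ) := by exact_mod_cast hs
      _ ≤ 8 * (k * n) := by
        push_cast
        nlinarith [mul_nonneg (Nat.cast_nonneg (α := ℝ) k) (Nat.cast_nonneg (α := ℝ) n)]
  · calc (c.depth : ℝ) ≤ ((k * (2 * Nat.clog 2 n + 3) : ℕ) : ℝ) := by exact_mod_cast hd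
      _ = k * ((2 * Nat.clog 2 n + 3 : ℕ) : ℝ) := by push_cast; ring
      _ ≤ k * (8 * max 1 (Real.log n)) :=
        mul_le_mul_of_nonneg_left (two_mul_clog_add_three_le hn) (Nat.cast_nonneg k)
      _ = _ := by ring

end Circuits

end RandomPauli

end

/-! ### The theorem assembled. -/

theorem corollary2 :
    (∀ n t k : ℕ, 1 ≤ n → 1 ≤ t → ∀ ε : ℝ, 0 < ε →
      ((4 * Real.log 2) * n * (t : ℝ) ^ 2 + 4 * t * Real.log (1 / ε) ≤ (k : ℝ) →
        RandomPauli.diamondNorm (RandomPauli.pauliChannel n t ^ k - RandomPauli.haarChannel n t) ≤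
          ENNReal.ofReal ε) ∧
      ((4 * Real.log 8) * n * (t : ℝ) ^ 2 + 4 * t * Real.log (1 / ε) ≤ (k : ℝ) →
        RandomPauli.CPLE (((1 - ε : ℝ) : ℂ) • RandomPauli.haarChannel n t)
            (RandomPauli.pauliChannel n t ^ k) ∧
          RandomPauli.CPLE (RandomPauli.pauliChannel n t ^ k)
            (((1 + ε : ℝ) : ℂ) • RandomPauli.haarChannel n t))) ∧
    (∃ C : ℝ, ∀ n k : ℕ, 1 ≤ n →
      ∀ (P : Fin k → RandomPauli.PauliLabel n) (θ : Fin k → ℝ),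
        ∃ c : RandomPauli.Circuit n,
          c.matrix = RandomPauli.rotationProduct P θ ∧
          (c.size : ℝ) ≤ C * (k * n) ∧
          (c.depth : ℝ) ≤ C * (k * max 1 (Real.log n))) :=
  ⟨fun _ _ _ hn ht _ hε => ⟨RandomPauli.diamondNorm_pauliChannel_pow_sub_le hn ht hε,
    RandomPauli.cple_pauliChannel_pow hn ht hε⟩,
    -- The depth bound determines this constant; the gate count needs only 4.
    8, fun _ _ hn P θ => RandomPauli.exists_rotationProduct_circuit hn P θ⟩
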